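/- Let $d\ge 1$ and $\alpha,\beta\in[-\tfrac12,\infty)^d$. For real $a,b>-1$ let $$\rho^{(a,b)}(x)=\frac{\Gamma(a+b+2)}{\Gamma(b+1)\Gamma(a+1)2^{a+b+1}}(1-x)^{a}(1+x)^{b}$$ be the Jacobi probability density on $(-1,1)$, let $\rho^{(\alpha,\beta)}(x)=\prod_{j=1}^d\rho^{(\alpha_j,\beta_j)}(x_j)$ on $(-1,1)^d$, and let $\rho_c=\prod_{j=1}^d \rho^{(-1/2,-1/2)}(x_j)$ be the Chebyshev density. For each $j$ let $\varphi^j_0,\varphi^j_1,\dots$ be the orthonormal polynomials of $\rho^{(\alpha_j,\beta_j)}$ ($\deg\varphi^j_m=m$, unique up to sign), and put $\psi_k(x)=\prod_j\varphi^j_{k_j}(x_j)$ for $k\in\Lambda=\{k\in\mathbb N_0^d:\ |k|\le n\}$, $M=|\Lambda|$, $n\ge 0$. For samples $z^{(1)},\dots,z^{(N)}\in(-1,1)^d$ let $\Phi=(\psi_k(z^{(i)}))_{i,k}\in\mathbb R^{N\times M}$, let $\tilde\Phi\in\mathbb R^{N(d+1)\times M}$ be $\Phi$ stacked on the matrices $(\partial_{x_m}\psi_k(z^{(i)}))_{i,k}$,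 $m=1,\dots,d$, and let $W=\mathrm{diag}(W^0,\dots,W^d)$ and $P$ be the diagonal matrices with $$W^0_{ii}=\sqrt{\frac{\rho^{(\alpha,\beta)}(z^{(i)})}{\rho_c(z^{(i)})}},\quad W^m_{ii}=\sqrt{\frac{\rho^{(\alpha+e_m,\beta+e_m)}(z^{(i)})}{\rho_c(z^{(i)})}},\quad P_{kk}=\Bigl(1+\sum_{m=1}^d c^2(k_m,\alpha_m,\beta_m)\Bigr)^{-1/2},$$ $$c^2(m,a,b)=m(m+a+b+1)\frac{(a+b+2)(a+b+3)}{4(a+1)(b+1)},$$ where $e_m$ is the $m$-th unit vector. Put $\widehat\Phi=W\tilde\Phi P$. Let $\mu_L$ be the largest squared entry of the preconditioned standard design matrix $W^0\Phi$, and let $\beta_L(\widehat\Phi)$ be the largest value, over all columns $k$ and all samples $z^{(i)}$, of the squared Euclidean norm of the vector of the $d+1$ entries of column $k$ of $\widehat\Phi$ that belong to $z^{(i)}$ (both are $0$ if $N=0$). Let $$C=\max_{1\le j\le d}\frac{2+\sqrt{(\alpha_j+1)^2+(\beta_j+1)^2}}{2+\sqrt{\alpha_j^2+\beta_j^2}}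 .$$ Then: 1. $1\le C\le 1+\frac{\sqrt2}{2}$; $C=1$ if $\alpha_k=\beta_k=-\frac12$ for all $k$, and $C=1+\frac{\sqrt2}2$ if $\alpha_k=\beta_k=0$ for some $k$. 2. For all samples $z^{(1)},\dots,z^{(N)}\in(-1,1)^d$, $$\mu_L\le\prod_{j=1}^d 2e\Bigl(2+\sqrt{\alpha_j^2+\beta_j^2}\Bigr),\qquad \beta_L(\widehat\Phi)\le C\prod_{j=1}^d 2e\Bigl(2+\sqrt{\alpha_j^2+\beta_j^2}\Bigr),$$ and, with $\mathcal N(\cdot)$ the nullspace, $P\,\mathcal N(\widehat\Phi)\subseteq\mathcal N(\Phi)$ (that is, $\mathcal N(\widehat\Phi P^{-1})\subseteq\mathcal N(\Phi)$). 3. If $z^{(1)},\dots,z^{(N)}$ are independent random vectors with density $\rho_c$, then almost surely all of them lie in $(-1,1)^d$, and if $1\le N<M$ (under-sampling), then almost surely $P\,\mathcal N(\widehat\Phi)\subsetneq\mathcal N(\Phi)$. -/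

import Mathlib

open MeasureTheory ProbabilityTheory

noncomputable section

namespace JacobiPCE

/-- The normalization constant
`d^{(α,β)} = Γ(α+β+2) / (Γ(β+1) Γ(α+1) 2^{α+β+1})`. -/
def normConst (α β : ℝ) : ℝ :=
  Real.Gamma (α + β + 2) /
    (Real.Gamma (β + 1) * Real.Gamma (α + 1) * (2 : ℝ) ^ (α + β + 1))

/-- The univariate Jacobi (Beta) probability density on `(-1,1)`. -/
def density (α β x : ℝ) : ℝ :=
  normConst α β * (1 - x) ^ α * (1 + x) ^ β

/-- The univariate Jacobi probability measure, carried by `(-1,1)`. -/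
def jacobiMeasure (α β : ℝ) : Measure ℝ :=
  (volume.restrict (Set.Ioo (-1 : ℝ) 1)).withDensity
    (fun x => ENNReal.ofReal (density α β x))

/-- The tensor-product Jacobi density `∏ⱼ ρ^{(αⱼ,βⱼ)}(xⱼ)`. -/
def densityPi {d : ℕ} (α β x : Fin d → ℝ) : ℝ :=
  ∏ j, density (α j) (β j) (x j)

/-- The tensor-product Chebyshev density `ρ_c = ρ^{(-1/2,-1/2)}`. -/
def chebDensity {d : ℕ} (x : Fin d → ℝ) : ℝ :=
  densityPi (fun _ => -1 / 2) (fun _ => -1 / 2) x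

/-- The tensor-product Chebyshev (arcsine) probability measure on the cube. -/
def chebMeasure (d : ℕ) : Measure (Fin d → ℝ) :=
  Measure.pi (fun _ => jacobiMeasure (-1 / 2) (-1 / 2))

/-- The open cube `(-1,1)^d`; `ρ_c` is infinite on its boundary, which is a Chebyshev-null set. -/
def cube (d : ℕ) : Set (Fin d → ℝ) := {x | ∀ j, x j ∈ Set.Ioo (-1 : ℝ) 1}

/-- `p 0, p 1, …` are the orthonormal polynomials of the Jacobi density `ρ^{(α,β)}`:
`p n` has degree `n`, and the family is orthonormal. This determines each `p n` up to its sign. -/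
structure IsJacobiBasis (α β : ℝ) (p : ℕ → Polynomial ℝ) : Prop where
  degree_eq : ∀ n, (p n).degree = n
  orthonormal : ∀ n m,
    ∫ x in (-1 : ℝ)..1, (p n).eval x * (p m).eval x * density α β x = if n = m then 1 else 0

section Existence

open Polynomial

theorem density_integrable {α β : ℝ} (hα : -1 < α) (hβ : -1 < β) :
    IntervalIntegrable (density α β) volume (-1) 1 := by
  have h := Complex.betaIntegral_convergent (u := (β + 1 : ℝ)) (v := (α + 1 : ℝ))
    (by simpa using by linarith) (by simpa using by linarith)
  have h1 : IntervalIntegrable (fun x : ℝ => x ^ β * (1 - x) ^ α) volume 0 1 := by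
    refine h.norm.congr_uIoo ?_
    intro x hx
    rw [Set.uIoo_of_le zero_le_one] at hx
    have e1 : (1 - (x : ℂ)) = ((1 - x : ℝ) : ℂ) := by push_cast; ring
    simp only [norm_mul]
    rw [e1, Complex.norm_cpow_eq_rpow_re_of_pos hx.1,
      Complex.norm_cpow_eq_rpow_re_of_pos (by linarith [hx.2])]
    simp
  have h2 := (h1.comp_mul_right (c := 1 / 2) |>.comp_add_right 1)
  norm_num at h2
  have h3 := h2.const_mul (normConst α β * 2 ^ α * 2 ^ β)
  refine h3.congr_uIoo ?_
  intro x hx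
  rw [Set.uIoo_of_le (by norm_num)] at hx
  have a1 : (0:ℝ) ≤ 1 - x := by linarith [hx.2]
  have a2 : (0:ℝ) ≤ 1 + x := by linarith [hx.1]
  have e1 : (x + 1) * (1 / 2) = (1 + x) / 2 := by ring
  have e2 : 1 - (1 + x) / 2 = (1 - x) / 2 := by ring
  simp only [density, e1, e2]
  rw [Real.div_rpow a2 (by norm_num), Real.div_rpow a1 (by norm_num)]
  have := Real.rpow_pos_of_pos (two_pos : (0:ℝ) < 2) α
  have := Real.rpow_pos_of_pos (two_pos : (0:ℝ) < 2) β
  field_simp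

theorem density_pos {α β : ℝ} (hα : -1 < α) (hβ : -1 < β) {x : ℝ}
    (hx : x ∈ Set.Ioo (-1 : ℝ) 1) : 0 < density α β x := by
  have h1 : 0 < 1 - x := by linarith [hx.2]
  have h2 : 0 < 1 + x := by linarith [hx.1]
  have := Real.Gamma_pos_of_pos (s := α + β + 2) (by linarith)
  have := Real.Gamma_pos_of_pos (s := β + 1) (by linarith)
  have := Real.Gamma_pos_of_pos (s := α + 1) (by linarith)
  unfold density normConst
  positivity

theorem density_nonneg {α β : ℝ} (hα : -1 < α) (hβ : -1 < β) {x : ℝ}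
    (hx : x ∈ Set.Icc (-1 : ℝ) 1) : 0 ≤ density α β x := by
  have h1 : 0 ≤ 1 - x := by linarith [hx.2]
  have h2 : 0 ≤ 1 + x := by linarith [hx.1]
  have := Real.Gamma_pos_of_pos (s := α + β + 2) (by linarith)
  have := Real.Gamma_pos_of_pos (s := β + 1) (by linarith)
  have := Real.Gamma_pos_of_pos (s := α + 1) (by linarith)
  unfold density normConst
  positivity

theorem poly_density_integrable {α β : ℝ} (hα : -1 < α) (hβ : -1 < β) (p : ℝ[X]) :
    IntervalIntegrable (fun x => p.eval x * density α β x) volume (-1) 1 :=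
  (density_integrable hα hβ).continuousOn_mul p.continuous.continuousOn

/-- The orthonormal Jacobi polynomials exist. -/
theorem exists_isJacobiBasis {α β : ℝ} (hα : -1 < α) (hβ : -1 < β) :
    ∃ p, IsJacobiBasis α β p := by
  have hint := fun p => poly_density_integrable hα hβ p
  let I : ℝ[X] → ℝ := fun p => ∫ x in (-1 : ℝ)..1, p.eval x * density α β x
  have hadd : ∀ p q, I (p + q) = I p + I q := by
    intro p q
    simp only [I, eval_add, add_mul]
    exact intervalIntegral.integral_add (hint p) (hint q)
  have hsmul : ∀ (c : ℝ) p, I (c • p) = c * I p := by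
    intro c p
    simp only [I, eval_smul, smul_eq_mul, mul_assoc]
    exact intervalIntegral.integral_const_mul _ _
  have hnn : ∀ p : ℝ[X], 0 ≤ I (p * p) := by
    intro p
    refine intervalIntegral.integral_nonneg (by norm_num) fun x hx => ?_
    have := density_nonneg hα hβ hx
    rw [eval_mul]
    exact mul_nonneg (mul_self_nonneg _) this
  have hdef : ∀ p : ℝ[X], I (p * p) = 0 → p = 0 := by
    intro p hp
    by_contra hne
    have key : 0 < I (p * p) := by
      refine (intervalIntegral.integral_pos_iff_support_of_nonneg_ae' ?_ (hint _)).2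
        ⟨by norm_num, ?_⟩
      · rw [Set.uIoc_of_le (by norm_num)]
        filter_upwards [ae_restrict_mem measurableSet_Ioc] with x hx
        have := density_nonneg hα hβ (Set.Ioc_subset_Icc_self hx)
        simp only [Pi.zero_apply, eval_mul]
        exact mul_nonneg (mul_self_nonneg _) this
      · have hsub : Set.Ioo (-1 : ℝ) 1 \ (p.roots.toFinset : Set ℝ) ⊆
            (Function.support fun x => (p * p).eval x * density α β x) ∩ Set.Ioc (-1) 1 := by
          rintro x ⟨hx, hr⟩
          refine ⟨?_, Set.Ioo_subset_Ioc_self hx⟩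
          have h1 : p.eval x ≠ 0 := by simpa [hne] using hr
          have h2 := (density_pos hα hβ hx).ne'
          simp [h1, h2]
        refine lt_of_lt_of_le ?_ (measure_mono hsub)
        rw [measure_sdiff_null (Finset.measure_zero _ _)]
        simp
    exact key.ne' hp
  let core : InnerProductSpace.Core ℝ ℝ[X] :=
    { inner := fun p q => I (p * q)
      conj_inner_symm := fun p q => by simp [mul_comm]
      re_inner_nonneg := fun p => by simpa using hnn p
      add_left := fun p q r => by simp [add_mul, hadd]
      smul_left := fun p q c => by simp [hsmul]
      definite := fun p hp => hdef p hp }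
  let : NormedAddCommGroup ℝ[X] := core.toNormedAddCommGroup
  let : InnerProductSpace ℝ ℝ[X] := InnerProductSpace.ofCore core.toCore
  have hli : LinearIndependent ℝ (fun n : ℕ => (X ^ n : ℝ[X])) := by
    have := (Polynomial.basisMonomials ℝ).linearIndependent
    simpa [Polynomial.coe_basisMonomials, Polynomial.monomial_one_right_eq_X_pow] using this
  have hon := InnerProductSpace.gramSchmidtNormed_orthonormal hli
  have hdeg : ∀ n : ℕ,
      (InnerProductSpace.gramSchmidt ℝ (fun n : ℕ => (X ^ n : ℝ[X])) n).degree = n := by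
    intro n
    induction n using Nat.strong_induction_on with
    | _ n ih =>
      rw [InnerProductSpace.gramSchmidt_def]
      rw [Polynomial.degree_sub_eq_left_of_degree_lt, Polynomial.degree_X_pow]
      rw [Polynomial.degree_X_pow]
      refine (Polynomial.degree_sum_le _ _).trans_lt ?_
      refine (Finset.sup_lt_iff (WithBot.bot_lt_coe n)).2 ?_
      intro i hi
      rw [Finset.mem_Iio] at hi
      rw [Submodule.starProjection_singleton]
      refine (Polynomial.degree_smul_le _ _).trans_lt ?_
      rw [ih i hi]
      exact WithBot.coe_lt_coe.2 hi
  refine ⟨InnerProductSpace.gramSchmidtNormed ℝ (fun n : ℕ => (X ^ n : ℝ[X])), ?_, ?_⟩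
  · intro n
    rw [← hdeg n]
    refine Polynomial.degree_smul_of_smul_regular _ ?_
    refine IsSMulRegular.of_ne_zero ?_
    simpa using InnerProductSpace.gramSchmidt_ne_zero n hli
  · intro n m
    have h := orthonormal_iff_ite.1 hon n m
    rw [← h]
    change _ = I (_ * _)
    simp only [I, eval_mul]

end Existence

/-- The tensor-product basis function `ψ_k(x) = ∏ⱼ φʲ_{kⱼ}(xⱼ)`. -/
def psi {d : ℕ} (φ : Fin d → ℕ → Polynomial ℝ) (k : Fin d → ℕ) (x : Fin d → ℝ) : ℝ :=
  ∏ j, (φ j (k j)).eval (x j)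

/-- The partial derivative `∂f/∂x_k` at `x`. -/
def partialDeriv {d : ℕ} (k : Fin d) (f : (Fin d → ℝ) → ℝ) (x : Fin d → ℝ) : ℝ :=
  deriv (fun t => f (Function.update x k t)) (x k)

/-- The total-degree multi-index set `{k ∈ ℕ₀^d : |k| ≤ n}`. -/
def totalDegree (d n : ℕ) : Finset (Fin d → ℕ) :=
  (Fintype.piFinset fun _ => Finset.range (n + 1)).filter fun k => ∑ j, k j ≤ n

theorem mem_totalDegree {d n : ℕ} (k : Fin d → ℕ) :
    k ∈ totalDegree d n ↔ ∑ j, k j ≤ n := by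
  simp only [totalDegree, Finset.mem_filter, Fintype.mem_piFinset, Finset.mem_range,
    and_iff_right_iff_imp]
  intro h j
  have := Finset.single_le_sum (f := k) (fun i _ => Nat.zero_le _) (Finset.mem_univ j)
  omega

/-- The standard design matrix `Φ_{i,k} = ψ_k(z⁽ⁱ⁾)`. -/
def Phi {d : ℕ} (φ : Fin d → ℕ → Polynomial ℝ) (n : ℕ) {N : ℕ} (z : Fin N → Fin d → ℝ) :
    Matrix (Fin N) (totalDegree d n) ℝ :=
  Matrix.of fun i k => psi φ k (z i)

/-- The stacked matrix of the partial derivatives of the basis functions at the samples. -/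
def PhiGrad {d : ℕ} (φ : Fin d → ℕ → Polynomial ℝ) (n : ℕ) {N : ℕ} (z : Fin N → Fin d → ℝ) :
    Matrix (Fin d × Fin N) (totalDegree d n) ℝ :=
  Matrix.of fun r k => partialDeriv r.1 (psi φ k) (z r.2)

/-- The diagonal of the block `W⁰`: `√(ρ^{(α,β)} / ρ_c)` at the samples. -/
def w0 {d : ℕ} (α β : Fin d → ℝ) {N : ℕ} (z : Fin N → Fin d → ℝ) (i : Fin N) : ℝ :=
  √(densityPi α β (z i) / chebDensity (z i))

/-- The diagonals of the blocks `W¹, …, W^d`: `√(ρ^{(α+e_k,β+e_k)} / ρ_c)` at the samples. -/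
def wGrad {d : ℕ} (α β : Fin d → ℝ) {N : ℕ} (z : Fin N → Fin d → ℝ) (r : Fin d × Fin N) : ℝ :=
  √(densityPi (α + Pi.single r.1 1) (β + Pi.single r.1 1) (z r.2) / chebDensity (z r.2))

/-- The preconditioning matrix `W = diag(W⁰, W¹, …, W^d)`. -/
def W {d : ℕ} (α β : Fin d → ℝ) {N : ℕ} (z : Fin N → Fin d → ℝ) :
    Matrix (Fin N ⊕ Fin d × Fin N) (Fin N ⊕ Fin d × Fin N) ℝ :=
  Matrix.diagonal (Sum.elim (w0 α β z) (wGrad α β z))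

/-- The constant `c²(m,α,β)`. -/
def cSq (m : ℕ) (α β : ℝ) : ℝ :=
  m * (m + α + β + 1) * ((α + β + 2) * (α + β + 3) / (4 * (α + 1) * (β + 1)))

/-- The normalizing matrix `P`, with entries `(1 + ∑_k c²(i_k,α_k,β_k))^{-1/2}`. -/
def P {d : ℕ} (α β : Fin d → ℝ) (n : ℕ) :
    Matrix (totalDegree d n) (totalDegree d n) ℝ :=
  Matrix.diagonal fun i => (√(1 + ∑ k, cSq (i.1 k) (α k) (β k)))⁻¹

/-- The standard design matrix preconditioned for Chebyshev sampling, `W⁰ Φ`. -/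
def PhiPre {d : ℕ} (α β : Fin d → ℝ) (φ : Fin d → ℕ → Polynomial ℝ) (n : ℕ) {N : ℕ}
    (z : Fin N → Fin d → ℝ) : Matrix (Fin N) (totalDegree d n) ℝ :=
  Matrix.diagonal (w0 α β z) * Phi φ n z

/-- The gradient-enhanced, preconditioned and normalized design matrix `Φ̂ = W Φ̃ P`, where
`Φ̃` is `Φ` stacked on top of the derivative block. -/
def PhiHat {d : ℕ} (α β : Fin d → ℝ) (φ : Fin d → ℕ → Polynomial ℝ) (n : ℕ) {N : ℕ}
    (z : Fin N → Fin d → ℝ) : Matrix (Fin N ⊕ Fin d × Fin N) (totalDegree d n) ℝ :=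
  W α β z * Matrix.fromRows (Phi φ n z) (PhiGrad φ n z) * P α β n

/-- The coherence parameter of a design matrix with one row for each sample: the largest
squared entry. -/
def muL {N : ℕ} {ι : Type*} (A : Matrix (Fin N) ι ℝ) : ℝ :=
  ⨆ q : ι × Fin N, A q.2 q.1 ^ 2

/-- The coherence parameter of a design matrix with `d + 1` rows for each sample: the largest
squared Euclidean norm of the part of a column that belongs to one sample. -/
def betaL {d N : ℕ} {ι : Type*} (A : Matrix (Fin N ⊕ Fin d × Fin N) ι ℝ) : ℝ :=
  ⨆ q : ι × Fin N, (A (Sum.inl q.2) q.1 ^ 2 + ∑ k : Fin d, A (Sum.inr (k, q.2)) q.1 ^ 2)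

/-- The nullspace of a matrix. -/
def nullspace {m ι : Type*} [Fintype ι] (A : Matrix m ι ℝ) : Submodule ℝ (ι → ℝ) :=
  LinearMap.ker A.mulVecLin

/-- The product `∏ⱼ 2e(2 + √(αⱼ² + βⱼ²))`. -/
def cohBound {d : ℕ} (α β : Fin d → ℝ) : ℝ :=
  ∏ j, 2 * Real.exp 1 * (2 + √(α j ^ 2 + β j ^ 2))

/-- The constant
`C = max_j (2 + √((αⱼ+1)² + (βⱼ+1)²)) / (2 + √(αⱼ² + βⱼ²))`. -/
def gradConst {d : ℕ} (α β : Fin d → ℝ) : ℝ :=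
  ⨆ j, (2 + √((α j + 1) ^ 2 + (β j + 1) ^ 2)) / (2 + √(α j ^ 2 + β j ^ 2))

end JacobiPCE

end

/-!
Everything reduces to one variable, where the claim is that the orthonormal Jacobi polynomials
satisfy `(ρ / ρ_c) pₙ² ≤ 2e (2 + √(α² + β²))` on `[-1, 1]`. The derivatives of the `pₙ` are, up to
the factors `c(n, α, β)`, the orthonormal polynomials of the density with both parameters raised by
one, so the same bound controls the derivative rows of the design matrix.

Two bounds cover all degrees. With `x = re z`, `|z| = 1`, the function `(ρ / ρ_c) |q|²` is on the
circle the squared modulus of a function analytic and zero-free in the disc, which grows at most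
like a power under dilation; comparing it with its circle average through the Poisson kernel gives a
Nikolskii inequality `(ρ / ρ_c) ∑_{k ≤ n} p_k² ≤ e (n + (α + β + 2) / 2)`, which settles the small
degrees. For the large ones, `u = √(ρ / ρ_c) pₙ` satisfies `u'' = -Q u` in the angle
`θ = arccos x`, and the Christoffel–Darboux kernel is an energy of `u`. Thus the Nikolskii
inequality bounds `Q u²` at a maximum of `u²`, which suffices when `Q` is large there; when `Q` is
small there, `Q` is increasing so fast that the energy `u'² + Q u²` gained before the maximum would
exceed its value at the maximum.

The inclusion of nullspaces is strict as soon as some polynomial in the span of the basis vanishes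
at all samples and has a nonzero gradient at one of them. Freeze all samples but one: two
independent polynomials `f, g` vanish at the frozen samples, some Wronskian
`f ∂ₘg - g ∂ₘf` is not the zero polynomial, so it is almost surely nonzero at the last sample `x`,
and then `g(x) f - f(x) g` is such a polynomial.
-/

noncomputable section

namespace JacobiPCE

open Polynomial

section JacobiIntegral

variable {α β : ℝ} (hα : -1 < α) (hβ : -1 < β)

/-- Integration of polynomials against the Jacobi density, as a linear functional; linearity needs
the density to be integrable, whence the two proof arguments. -/
def jacobiIntegral : ℝ[X] →ₗ[ℝ] ℝ where
  toFun p := ∫ x in (-1 : ℝ)..1, p.eval x * density α β x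
  map_add' p q := by
    simp only [eval_add, add_mul]
    exact intervalIntegral.integral_add (poly_density_integrable hα hβ p)
      (poly_density_integrable hα hβ q)
  map_smul' c p := by
    simp only [eval_smul, smul_eq_mul, mul_assoc, RingHom.id_apply]
    exact intervalIntegral.integral_const_mul _ _

theorem jacobiIntegral_apply (p : ℝ[X]) :
    jacobiIntegral hα hβ p = ∫ x in (-1 : ℝ)..1, p.eval x * density α β x := rfl

theorem jacobiIntegral_C_mul (c : ℝ) (p : ℝ[X]) :
    jacobiIntegral hα hβ (C c * p) = c * jacobiIntegral hα hβ p := by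
  rw [← smul_eq_C_mul, map_smul, smul_eq_mul]

theorem hasDerivAt_one_sub_rpow_mul_one_add_rpow (a b : ℝ) {x : ℝ} (hx : x ∈ Set.Ioo (-1 : ℝ) 1) :
    HasDerivAt (fun x : ℝ => (1 - x) ^ (a + 1) * (1 + x) ^ (b + 1))
      ((b - a - (a + b + 2) * x) * ((1 - x) ^ a * (1 + x) ^ b)) x := by
  have h1 : 1 - x ≠ 0 := by linarith [hx.2]
  have h2 : 1 + x ≠ 0 := by linarith [hx.1]
  have d1 := ((hasDerivAt_id x).const_sub 1).rpow_const (p := a + 1) (Or.inl h1)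
  have d2 := ((hasDerivAt_id x).const_add 1).rpow_const (p := b + 1) (Or.inl h2)
  refine (d1.mul d2).congr_deriv ?_
  simp only [id_eq, add_sub_cancel_right, Real.rpow_add_one h1, Real.rpow_add_one h2]
  ring

-- Integration by parts: the integrand is the derivative of `(1 - x²) p ρ`.
theorem jacobiIntegral_pearson (p : ℝ[X]) :
    jacobiIntegral hα hβ
      ((1 - X ^ 2) * derivative p + (C (β - α) - C (α + β + 2) * X) * p) = 0 := by
  have hcont : ContinuousOn
      (fun x : ℝ => normConst α β * p.eval x * ((1 - x) ^ (α + 1) * (1 + x) ^ (β + 1)))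
      (Set.Icc (-1) 1) := by
    refine ((continuous_const.mul p.continuous).mul (Continuous.mul ?_ ?_)).continuousOn
    · exact (continuous_const.sub continuous_id).rpow_const fun x => Or.inr (by linarith)
    · exact (continuous_const.add continuous_id).rpow_const fun x => Or.inr (by linarith)
  rw [jacobiIntegral_apply, intervalIntegral.integral_eq_sub_of_hasDerivAt_of_le (by norm_num)
    hcont (fun x hx => ?_) (poly_density_integrable hα hβ _)]
  · have h1 : α + 1 ≠ 0 := by linarith
    have h2 : β + 1 ≠ 0 := by linarith
    simp [Real.zero_rpow h1, Real.zero_rpow h2]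
  · have h1 : 1 - x ≠ 0 := by linarith [hx.2]
    have h2 : 1 + x ≠ 0 := by linarith [hx.1]
    refine (((p.hasDerivAt x).const_mul (normConst α β)).mul
      (hasDerivAt_one_sub_rpow_mul_one_add_rpow α β hx)).congr_deriv ?_
    simp only [density, eval_add, eval_mul, eval_sub, eval_one, eval_pow, eval_X, eval_C,
      Real.rpow_add_one h1, Real.rpow_add_one h2]
    ring

end JacobiIntegral

theorem coeff_X_mul_derivative (q : ℝ[X]) (m : ℕ) :
    (X * derivative q).coeff m = m * q.coeff m := by
  rcases m with _ | m
  · simp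
  · rw [coeff_X_mul, coeff_derivative]; push_cast; ring

theorem coeff_X_sq_mul_derivative_derivative (q : ℝ[X]) (m : ℕ) :
    (X ^ 2 * derivative (derivative q)).coeff m = m * (m - 1) * q.coeff m := by
  have : X ^ 2 * derivative (derivative q) = X * derivative (X * derivative q) -
      X * derivative q := by
    rw [derivative_mul, derivative_X]; ring
  rw [this, coeff_sub, coeff_X_mul_derivative, coeff_X_mul_derivative]
  ring

/-- The Jacobi differential operator `q ↦ (1 - x²) q'' + (β - α - (α + β + 2) x) q'`. -/
def jacobiOperator (α β : ℝ) (q : ℝ[X]) : ℝ[X] :=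
  (1 - X ^ 2) * derivative (derivative q) + (C (β - α) - C (α + β + 2) * X) * derivative q

theorem coeff_jacobiOperator (α β : ℝ) (q : ℝ[X]) (m : ℕ) :
    (jacobiOperator α β q).coeff m = (m + 2) * (m + 1) * q.coeff (m + 2) +
      (β - α) * (m + 1) * q.coeff (m + 1) - m * (m + α + β + 1) * q.coeff m := by
  have : jacobiOperator α β q = derivative (derivative q) - X ^ 2 * derivative (derivative q) +
      C (β - α) * derivative q - C (α + β + 2) * (X * derivative q) := by
    rw [jacobiOperator]; ring
  rw [this]
  simp only [coeff_sub, coeff_add, coeff_C_mul, coeff_X_mul_derivative,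
    coeff_X_sq_mul_derivative_derivative, coeff_derivative]
  push_cast
  ring

theorem degree_jacobiOperator_lt (α β : ℝ) {q : ℝ[X]} {n : ℕ} (hq : q.degree < n) :
    (jacobiOperator α β q).degree < n := by
  rw [degree_lt_iff_coeff_zero] at hq ⊢
  intro m hm
  rw [coeff_jacobiOperator, hq m hm, hq (m + 1) (by lia), hq (m + 2) (by lia)]
  ring

theorem jacobiIntegral_jacobiOperator_mul {α β : ℝ} (hα : -1 < α) (hβ : -1 < β) (q r : ℝ[X]) :
    jacobiIntegral hα hβ (jacobiOperator α β q * r) =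
      -jacobiIntegral hα hβ ((1 - X ^ 2) * (derivative q * derivative r)) := by
  have h := jacobiIntegral_pearson hα hβ (derivative q * r)
  rw [eq_neg_iff_add_eq_zero, ← map_add, ← h, jacobiOperator, derivative_mul]
  congr 1
  ring

namespace IsJacobiBasis

variable {α β : ℝ} {p : ℕ → ℝ[X]}

theorem degree_lt (h : IsJacobiBasis α β p) {n m : ℕ} (hnm : n < m) :
    (p n).degree < (m : WithBot ℕ) := by
  rw [h.degree_eq]; exact_mod_cast hnm

theorem natDegree_eq (h : IsJacobiBasis α β p) (n : ℕ) : (p n).natDegree = n :=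
  natDegree_eq_of_degree_eq_some (h.degree_eq n)

theorem degree_X_mul_lt (h : IsJacobiBasis α β p) {n m : ℕ} (hnm : n + 1 < m) :
    (X * p n).degree < (m : WithBot ℕ) := by
  rw [X_mul, degree_mul_X, h.degree_eq]; exact_mod_cast hnm

theorem coeff_ne_zero (h : IsJacobiBasis α β p) (n : ℕ) : (p n).coeff n ≠ 0 :=
  coeff_ne_zero_of_eq_degree (h.degree_eq n)

theorem mem_span_of_degree_lt (h : IsJacobiBasis α β p) {n : ℕ} {q : ℝ[X]} (hq : q.degree < n) :
    q ∈ Submodule.span ℝ (p '' Set.Iio n) := by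
  let S : Polynomial.Sequence ℝ := ⟨p, h.degree_eq⟩
  rw [show p = S from rfl, S.span_degreeLT fun i _ => (leadingCoeff_ne_zero.2 (S.ne_zero i)).isUnit]
  exact mem_degreeLT.2 hq

variable (hα : -1 < α) (hβ : -1 < β)

theorem jacobiIntegral_mul (h : IsJacobiBasis α β p) (n m : ℕ) :
    jacobiIntegral hα hβ (p n * p m) = if n = m then 1 else 0 := by
  rw [jacobiIntegral_apply, ← h.orthonormal n m]
  simp only [eval_mul]

theorem eq_sum (h : IsJacobiBasis α β p) {n : ℕ} {q : ℝ[X]} (hq : q.degree < n) :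
    q = ∑ k ∈ Finset.range n, C (jacobiIntegral hα hβ (q * p k)) * p k := by
  have hspan := h.mem_span_of_degree_lt hq
  clear hq
  induction hspan using Submodule.span_induction with
  | mem q hq =>
    obtain ⟨m, hm, rfl⟩ := hq
    simp [h.jacobiIntegral_mul hα hβ, Set.mem_Iio.1 hm]
  | zero => simp
  | add q r _ _ hq hr =>
    simp only [add_mul, map_add, Finset.sum_add_distrib]
    rw [← hq, ← hr]
  | smul c q _ hq =>
    simp only [smul_mul_assoc, map_smul, smul_eq_mul, C_mul, mul_assoc, ← Finset.mul_sum]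
    rw [← hq, smul_eq_C_mul]

theorem jacobiIntegral_mul_eq_zero (h : IsJacobiBasis α β p) {n : ℕ} {q : ℝ[X]}
    (hq : q.degree < n) : jacobiIntegral hα hβ (q * p n) = 0 := by
  rw [h.eq_sum hα hβ hq, Finset.sum_mul, map_sum]
  refine Finset.sum_eq_zero fun k hk => ?_
  rw [mul_assoc, jacobiIntegral_C_mul, h.jacobiIntegral_mul, if_neg (Finset.mem_range.1 hk).ne,
    mul_zero]

include hα hβ in
theorem jacobiOperator_eq (h : IsJacobiBasis α β p) (n : ℕ) :
    jacobiOperator α β (p n) = -C (n * (n + α + β + 1)) * p n := by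
  have hlt := h.degree_lt n.lt_succ_self
  have horth : ∀ k ∈ Finset.range n, jacobiIntegral hα hβ (jacobiOperator α β (p n) * p k) = 0 := by
    intro k hk
    have := h.jacobiIntegral_mul_eq_zero hα hβ
      (degree_jacobiOperator_lt α β (h.degree_lt (Finset.mem_range.1 hk)))
    rwa [jacobiIntegral_jacobiOperator_mul, mul_comm (derivative (p k)),
      ← jacobiIntegral_jacobiOperator_mul] at this
  obtain ⟨c, hc⟩ : ∃ c, jacobiOperator α β (p n) = C c * p n := by
    have hs := h.eq_sum hα hβ (degree_jacobiOperator_lt α β hlt)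
    rw [Finset.sum_range_succ, Finset.sum_eq_zero fun k hk => by rw [horth k hk]; simp,
      zero_add] at hs
    exact ⟨_, hs⟩
  have hcoeff := congrArg (coeff · n) hc
  simp only [coeff_C_mul, coeff_jacobiOperator, coeff_eq_zero_of_degree_lt hlt,
    coeff_eq_zero_of_degree_lt (h.degree_lt (n.lt_add_of_pos_right (k := 2) two_pos))] at hcoeff
  have : c = -(n * (n + α + β + 1)) := mul_right_cancel₀ (h.coeff_ne_zero n) (by linarith)
  rw [hc, this, C_neg]

theorem jacobiIntegral_derivative_mul_derivative (h : IsJacobiBasis α β p) (n m : ℕ) :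
    jacobiIntegral hα hβ ((1 - X ^ 2) * (derivative (p n) * derivative (p m))) =
      n * (n + α + β + 1) * if n = m then 1 else 0 := by
  have := jacobiIntegral_jacobiOperator_mul hα hβ (p n) (p m)
  rw [h.jacobiOperator_eq hα hβ, ← C_neg, mul_assoc, jacobiIntegral_C_mul,
    h.jacobiIntegral_mul] at this
  linarith

end IsJacobiBasis

section Raising

variable {α β : ℝ}

theorem normConst_add_one (hα : -1 < α) (hβ : -1 < β) :
    normConst (α + 1) (β + 1) =
      (α + β + 2) * (α + β + 3) / (4 * (α + 1) * (β + 1)) * normConst α β := by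
  have hΓ : Real.Gamma (α + 1 + (β + 1) + 2) =
      (α + β + 3) * ((α + β + 2) * Real.Gamma (α + β + 2)) := by
    rw [show α + 1 + (β + 1) + 2 = (α + β + 3) + 1 by ring, Real.Gamma_add_one (by linarith),
      show α + β + 3 = (α + β + 2) + 1 by ring, Real.Gamma_add_one (by linarith)]
  have h2pow : (2 : ℝ) ^ (α + 1 + (β + 1) + 1) = 4 * 2 ^ (α + β + 1) := by
    rw [show α + 1 + (β + 1) + 1 = (α + β + 1) + 2 by ring, Real.rpow_add two_pos]
    norm_num; ring
  have h1 : α + 1 ≠ 0 := by linarith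
  have h2 : β + 1 ≠ 0 := by linarith
  have := (Real.Gamma_pos_of_pos (s := α + 1) (by linarith)).ne'
  have := (Real.Gamma_pos_of_pos (s := β + 1) (by linarith)).ne'
  rw [normConst, normConst, hΓ, h2pow, Real.Gamma_add_one h1, Real.Gamma_add_one h2]
  field_simp

theorem density_add_one (hα : -1 < α) (hβ : -1 < β) {x : ℝ} (hx : x ∈ Set.Ioo (-1 : ℝ) 1) :
    density (α + 1) (β + 1) x =
      (α + β + 2) * (α + β + 3) / (4 * (α + 1) * (β + 1)) * ((1 - x ^ 2) * density α β x) := by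
  have h1 : 1 - x ≠ 0 := by linarith [hx.2]
  have h2 : 1 + x ≠ 0 := by linarith [hx.1]
  rw [density, density, normConst_add_one hα hβ, Real.rpow_add_one h1, Real.rpow_add_one h2]
  ring

theorem cSq_pos (hα : -1 < α) (hβ : -1 < β) {m : ℕ} (hm : m ≠ 0) : 0 < cSq m α β := by
  have h1 : 0 < α + 1 := by linarith
  have h2 : 0 < β + 1 := by linarith
  have h3 : 0 < α + β + 2 := by linarith
  have h4 : 0 < α + β + 3 := by linarith
  have hm1 : (1 : ℝ) ≤ m := by exact_mod_cast Nat.one_le_iff_ne_zero.2 hm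
  have h5 : 0 < m + α + β + 1 := by linarith
  unfold cSq
  positivity

theorem cSq_nonneg (hα : -1 < α) (hβ : -1 < β) (m : ℕ) : 0 ≤ cSq m α β := by
  rcases eq_or_ne m 0 with rfl | hm
  · simp [cSq]
  · exact (cSq_pos hα hβ hm).le

theorem IsJacobiBasis.integral_derivative_mul_derivative {p : ℕ → ℝ[X]} (h : IsJacobiBasis α β p)
    (hα : -1 < α) (hβ : -1 < β) (n m : ℕ) :
    ∫ x in (-1 : ℝ)..1, (derivative (p n)).eval x * (derivative (p m)).eval x *
        density (α + 1) (β + 1) x = cSq n α β * if n = m then 1 else 0 := by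
  rw [cSq, mul_right_comm, ← h.jacobiIntegral_derivative_mul_derivative hα hβ n m, mul_comm,
    jacobiIntegral_apply, ← intervalIntegral.integral_const_mul]
  refine intervalIntegral.integral_congr_uIoo fun x hx => ?_
  rw [Set.uIoo_of_le (by norm_num)] at hx
  simp only [eval_mul, eval_sub, eval_one, eval_pow, eval_X, density_add_one hα hβ hx]
  ring

theorem IsJacobiBasis.isJacobiBasis_derivative {p : ℕ → ℝ[X]} (h : IsJacobiBasis α β p)
    (hα : -1 < α) (hβ : -1 < β) :
    IsJacobiBasis (α + 1) (β + 1)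
      (fun m => C (√(cSq (m + 1) α β))⁻¹ * derivative (p (m + 1))) where
  degree_eq n := by
    have hs := (Real.sqrt_pos.2 (cSq_pos hα hβ n.succ_ne_zero)).ne'
    rw [degree_C_mul (inv_ne_zero hs), degree_derivative] <;> simp [h.natDegree_eq]
  orthonormal n m := by
    have hpull : ∀ x, (C (√(cSq (n + 1) α β))⁻¹ * derivative (p (n + 1))).eval x *
        (C (√(cSq (m + 1) α β))⁻¹ * derivative (p (m + 1))).eval x * density (α + 1) (β + 1) x =
        (√(cSq (n + 1) α β))⁻¹ * (√(cSq (m + 1) α β))⁻¹ * ((derivative (p (n + 1))).eval x *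
          (derivative (p (m + 1))).eval x * density (α + 1) (β + 1) x) := fun x => by
      simp only [eval_mul, eval_C]; ring
    simp only [hpull, intervalIntegral.integral_const_mul,
      h.integral_derivative_mul_derivative hα hβ, add_left_inj]
    rcases eq_or_ne n m with rfl | hnm
    · have hc := cSq_pos hα hβ n.succ_ne_zero
      rw [← mul_inv, Real.mul_self_sqrt hc.le, if_pos rfl, mul_one, inv_mul_cancel₀ hc.ne']
    · simp [hnm]

end Raising

/-- The operator `q ↦ (1 - x²) q' + k x q`, which maps polynomials of degree at most `k` to
polynomials of degree at most `k`; applied to a Jacobi polynomial of degree `k` it lowers the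
index. -/
def loweringOperator (k : ℕ) (q : ℝ[X]) : ℝ[X] :=
  (1 - X ^ 2) * derivative q + C (k : ℝ) * X * q

theorem degree_loweringOperator_lt {q : ℝ[X]} {k : ℕ} (hq : q.degree < (k + 1 : ℕ)) :
    (loweringOperator k q).degree < (k + 1 : ℕ) := by
  rw [degree_lt_iff_coeff_zero] at hq ⊢
  intro m hm
  obtain ⟨m, rfl⟩ : ∃ l, m = l + 1 := ⟨m - 1, by lia⟩
  have : loweringOperator k q =
      derivative q - X * (X * derivative q) + C (k : ℝ) * (X * q) := by
    rw [loweringOperator]; ring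
  rw [this, coeff_add, coeff_sub, coeff_C_mul, coeff_X_mul, coeff_X_mul, coeff_derivative,
    coeff_X_mul_derivative, hq (m + 1 + 1) (by lia)]
  rcases (show k ≤ m by lia).eq_or_lt with rfl | h
  · ring
  · rw [hq m h]; ring

namespace IsJacobiBasis

variable {α β : ℝ} {p : ℕ → ℝ[X]} (hα : -1 < α) (hβ : -1 < β)

theorem X_mul_zero (h : IsJacobiBasis α β p) :
    X * p 0 = C (jacobiIntegral hα hβ (X * p 0 * p 0)) * p 0 +
      C (jacobiIntegral hα hβ (X * p 0 * p 1)) * p 1 := by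
  have := h.eq_sum hα hβ (h.degree_X_mul_lt (n := 0) (m := 2) (by norm_num))
  rwa [Finset.sum_range_succ, Finset.sum_range_one] at this

-- The three-term recurrence.
theorem X_mul_succ (h : IsJacobiBasis α β p) (n : ℕ) :
    X * p (n + 1) = C (jacobiIntegral hα hβ (X * p n * p (n + 1))) * p n +
      C (jacobiIntegral hα hβ (X * p (n + 1) * p (n + 1))) * p (n + 1) +
      C (jacobiIntegral hα hβ (X * p (n + 1) * p (n + 2))) * p (n + 2) := by
  have hs := h.eq_sum hα hβ (h.degree_X_mul_lt (n := n + 1) (m := n + 3) (by lia))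
  have hlow : ∀ k ∈ Finset.range n,
      C (jacobiIntegral hα hβ (X * p (n + 1) * p k)) * p k = 0 := by
    intro k hk
    rw [mul_right_comm, h.jacobiIntegral_mul_eq_zero hα hβ
      (h.degree_X_mul_lt (Nat.succ_lt_succ (Finset.mem_range.1 hk))), C_0, zero_mul]
  rwa [Finset.sum_range_succ, Finset.sum_range_succ, Finset.sum_range_succ,
    Finset.sum_eq_zero hlow, zero_add, mul_right_comm X (p (n + 1)) (p n)] at hs

theorem christoffel_darboux (h : IsJacobiBasis α β p) (n : ℕ) :
    C (jacobiIntegral hα hβ (X * p n * p (n + 1))) *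
      (Polynomial.derivative (p (n + 1)) * p n - Polynomial.derivative (p n) * p (n + 1)) =
      ∑ k ∈ Finset.range (n + 1), p k ^ 2 := by
  induction n with
  | zero =>
    have h0 := h.X_mul_zero hα hβ
    have h1 := congrArg Polynomial.derivative h0
    simp only [derivative_add, derivative_mul, derivative_X, derivative_C, zero_mul, zero_add,
      one_mul] at h1
    rw [zero_add, Finset.sum_range_one]
    linear_combination Polynomial.derivative (p 0) * h0 - p 0 * h1
  | succ n ih =>
    have h0 := h.X_mul_succ hα hβ n
    have h1 := congrArg Polynomial.derivative h0
    simp only [derivative_add, derivative_mul, derivative_X, derivative_C, zero_mul, zero_add,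
      one_mul] at h1
    rw [Finset.sum_range_succ, ← ih]
    linear_combination Polynomial.derivative (p (n + 1)) * h0 - p (n + 1) * h1

theorem jacobiIntegral_loweringOperator_mul (h : IsJacobiBasis α β p) {k n : ℕ} (hkn : k ≤ n) :
    jacobiIntegral hα hβ (loweringOperator (n + 1) (p (n + 1)) * p k) =
      (n + 1 + k + α + β + 2) * jacobiIntegral hα hβ (X * p k * p (n + 1)) := by
  have hparts := jacobiIntegral_pearson hα hβ (p (n + 1) * p k)
  have hlow := h.jacobiIntegral_mul_eq_zero hα hβ (n := n + 1)
    ((degree_loweringOperator_lt (h.degree_lt k.lt_succ_self)).trans_le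
      (by exact_mod_cast Nat.succ_le_succ hkn))
  have horth := h.jacobiIntegral_mul hα hβ k (n + 1)
  rw [if_neg (by lia)] at horth
  have hsplit : (1 - X ^ 2) * Polynomial.derivative (p (n + 1) * p k) +
      (C (β - α) - C (α + β + 2) * X) * (p (n + 1) * p k) =
      loweringOperator (n + 1) (p (n + 1)) * p k + loweringOperator k (p k) * p (n + 1) +
      C (β - α) * (p k * p (n + 1)) - C (n + 1 + k + α + β + 2) * (X * p k * p (n + 1)) := by
    simp only [loweringOperator, derivative_mul, C_add, Nat.cast_add, Nat.cast_one]
    ring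
  rw [hsplit, map_sub, map_add, map_add, jacobiIntegral_C_mul, jacobiIntegral_C_mul, hlow,
    horth] at hparts
  linarith

theorem exists_loweringOperator_eq (h : IsJacobiBasis α β p) (n : ℕ) :
    ∃ b : ℝ, loweringOperator (n + 1) (p (n + 1)) =
      C ((2 * n + α + β + 3) * jacobiIntegral hα hβ (X * p n * p (n + 1))) * p n +
        C b * p (n + 1) := by
  have hs := h.eq_sum hα hβ (degree_loweringOperator_lt (h.degree_lt (Nat.lt_succ_self (n + 1))))
  refine ⟨jacobiIntegral hα hβ (loweringOperator (n + 1) (p (n + 1)) * p (n + 1)), ?_⟩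
  have hlow : ∀ k ∈ Finset.range n,
      C (jacobiIntegral hα hβ (loweringOperator (n + 1) (p (n + 1)) * p k)) * p k = 0 := by
    intro k hk
    have hk := Finset.mem_range.1 hk
    rw [h.jacobiIntegral_loweringOperator_mul hα hβ hk.le,
      h.jacobiIntegral_mul_eq_zero hα hβ (h.degree_X_mul_lt (by lia)), mul_zero, C_0, zero_mul]
  rwa [Finset.sum_range_succ, Finset.sum_range_succ, Finset.sum_eq_zero hlow, zero_add,
    h.jacobiIntegral_loweringOperator_mul hα hβ le_rfl,
    show (n + 1 + n + α + β + 2 : ℝ) = 2 * n + α + β + 3 by ring] at hs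

include hα hβ in
-- Eliminate `p n` from the Christoffel–Darboux formula by means of the lowering operator, then the
-- second derivative by means of the Jacobi equation.
theorem sum_sq_eq (h : IsJacobiBasis α β p) (n : ℕ) :
    C (2 * n + α + β + 3) * ∑ k ∈ Finset.range (n + 1), p k ^ 2 =
      (1 - X ^ 2) * Polynomial.derivative (p (n + 1)) ^ 2 +
      (C (β - α) - C (α + β) * X) * (p (n + 1) * Polynomial.derivative (p (n + 1))) +
      C ((n + 1) * (n + 1 + α + β)) * p (n + 1) ^ 2 := by
  obtain ⟨b, hb⟩ := h.exists_loweringOperator_eq hα hβ n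
  have hode := h.jacobiOperator_eq hα hβ (n + 1)
  rw [loweringOperator] at hb
  rw [jacobiOperator] at hode
  have hd := congrArg Polynomial.derivative hb
  rw [← h.christoffel_darboux hα hβ n]
  simp only [derivative_add, derivative_mul, derivative_X, derivative_C, zero_mul, zero_add,
    mul_one, derivative_sub, derivative_one, derivative_pow] at hd
  simp only [C_add, C_mul, C_sub, C_1, Nat.cast_add, Nat.cast_one, map_ofNat] at hode hd hb ⊢
  have h2 : (C ((2 : ℕ) : ℝ) : ℝ[X]) = 2 := map_ofNat C 2
  rw [h2] at hd
  linear_combination Polynomial.derivative (p (n + 1)) * (-hb) + p (n + 1) * hd - p (n + 1) * hode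

end IsJacobiBasis

section HardySpace

/-- `f` grows at most like a polynomial of degree `m` without zeros in the open unit disc when one
passes from radius `r` to the unit circle. -/
def HasDilationBound (f : ℂ → ℂ) (m : ℝ) : Prop :=
  ∀ (ζ : ℂ) (r : ℝ), ‖ζ‖ = 1 → 0 ≤ r → r ≤ 1 → ‖f ζ‖ ≤ (2 / (1 + r)) ^ m * ‖f (r * ζ)‖

theorem norm_sub_le_norm_smul_sub {E : Type*} [NormedAddCommGroup E] [InnerProductSpace ℝ E]
    {x b : E} {r : ℝ} (hx : ‖x‖ = 1) (hb : 1 ≤ ‖b‖) (hr0 : 0 ≤ r) (hr1 : r ≤ 1) :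
    ‖x - b‖ ≤ 2 / (1 + r) * ‖r • x - b‖ := by
  have hr : 0 < 1 + r := by linarith
  rw [div_mul_eq_mul_div, le_div_iff₀ hr]
  refine abs_le_of_sq_le_sq' ?_ (by positivity) |>.2
  have hinner : 0 ≤ inner ℝ x b + ‖b‖ := by
    have := neg_le_of_abs_le (abs_real_inner_le_norm x b)
    rw [hx, one_mul] at this
    linarith
  have h1 : 0 ≤ (1 - r) * (‖b‖ - 1) * (2 * (r + ‖b‖) + (1 + r) * (1 + ‖b‖)) :=
    mul_nonneg (mul_nonneg (sub_nonneg.2 hr1) (sub_nonneg.2 hb)) (by positivity)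
  have h2 : 0 ≤ (1 - r) ^ 2 * (inner ℝ x b + ‖b‖) := by positivity
  rw [mul_pow, mul_pow, norm_sub_sq_real, norm_sub_sq_real, real_inner_smul_left, norm_smul, hx,
    Real.norm_of_nonneg hr0]
  linarith

namespace HasDilationBound

variable {f g : ℂ → ℂ} {m m' : ℝ}

theorem const (c : ℂ) : HasDilationBound (fun _ => c) 0 := fun ζ r _ _ _ => by simp

theorem mul (hf : HasDilationBound f m) (hg : HasDilationBound g m') :
    HasDilationBound (fun z => f z * g z) (m + m') := by
  intro ζ r hζ h0 h1
  have hr : 0 < 2 / (1 + r) := by positivity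
  rw [norm_mul, norm_mul, Real.rpow_add hr, mul_mul_mul_comm]
  exact mul_le_mul (hf ζ r hζ h0 h1) (hg ζ r hζ h0 h1) (norm_nonneg _) (by positivity)

theorem cpow (hf : HasDilationBound f m) {s : ℝ} (hs : 0 ≤ s) :
    HasDilationBound (fun z => f z ^ (s : ℂ)) (m * s) := by
  intro ζ r hζ h0 h1
  have hr : 0 < 2 / (1 + r) := by positivity
  rw [Complex.norm_cpow_real, Complex.norm_cpow_real, Real.rpow_mul hr.le,
    ← Real.mul_rpow (by positivity) (norm_nonneg _)]
  exact Real.rpow_le_rpow (norm_nonneg _) (hf ζ r hζ h0 h1) hs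

theorem mono (hf : HasDilationBound f m) (hm : m ≤ m') : HasDilationBound f m' := by
  intro ζ r hζ h0 h1
  have hr : 1 ≤ 2 / (1 + r) := by rw [le_div_iff₀ (by linarith)]; linarith
  exact (hf ζ r hζ h0 h1).trans (by gcongr)

theorem sub_const {b : ℂ} (hb : 1 ≤ ‖b‖) : HasDilationBound (fun z => z - b) 1 := by
  intro ζ r hζ h0 h1
  simpa [Real.rpow_one] using norm_sub_le_norm_smul_sub hζ hb h0 h1

theorem one_sub : HasDilationBound (fun z => 1 - z) 1 := by
  intro ζ r hζ h0 h1
  simpa only [norm_sub_rev] using sub_const (b := 1) (by simp) ζ r hζ h0 h1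

theorem one_add : HasDilationBound (fun z => 1 + z) 1 := by
  intro ζ r hζ h0 h1
  simpa only [sub_neg_eq_add, add_comm] using sub_const (b := -1) (by simp) ζ r hζ h0 h1

end HasDilationBound

theorem mul_conj_of_norm_eq_one {z : ℂ} (hz : ‖z‖ = 1) : z * starRingEnd ℂ z = 1 := by
  rw [Complex.mul_conj, Complex.normSq_eq_norm_sq, hz]; simp

theorem norm_one_sub_conj_mul {z : ℂ} (hz : ‖z‖ = 1) (w : ℂ) :
    ‖1 - starRingEnd ℂ w * z‖ = ‖z - w‖ := by
  rw [← Complex.norm_conj (z - w), ← one_mul ‖starRingEnd ℂ (z - w)‖, ← hz, ← norm_mul,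
    map_sub, mul_sub, mul_conj_of_norm_eq_one hz, mul_comm z]

theorem exists_one_le_norm_sq_add_one_eq (a : ℂ) : ∃ b : ℂ, 1 ≤ ‖b‖ ∧ b ^ 2 + 1 = 2 * a * b := by
  obtain ⟨s, hs⟩ := IsAlgClosed.exists_pow_nat_eq (a ^ 2 - 1) two_pos
  have h : ‖a + s‖ * ‖a - s‖ = 1 := by
    rw [← norm_mul, show (a + s) * (a - s) = 1 by linear_combination -hs, norm_one]
  rcases le_total 1 ‖a + s‖ with h1 | h1
  · exact ⟨a + s, h1, by linear_combination hs⟩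
  · refine ⟨a - s, ?_, by linear_combination hs⟩
    nlinarith [norm_nonneg (a - s), norm_nonneg (a + s)]

theorem norm_sub_mul_norm_sub_conj {z a b : ℂ} (hz : ‖z‖ = 1) (hb : b ^ 2 + 1 = 2 * a * b) :
    ‖z - b‖ * ‖z - starRingEnd ℂ b‖ = ‖2 * b‖ * ‖(z.re : ℂ) - a‖ := by
  have hfactor : (z - b) * (1 - b * z) = -z * (2 * b * (z.re - a)) := by
    rw [Complex.re_eq_add_conj z]
    linear_combination b * mul_conj_of_norm_eq_one hz + z * hb
  rw [← norm_one_sub_conj_mul hz (starRingEnd ℂ b), Complex.conj_conj, ← norm_mul, hfactor,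
    norm_mul, norm_neg, hz, one_mul, norm_mul]

-- Joukowski: on the unit circle `z⁻¹ (z - b) (z - b⁻¹) = 2 (re z - a)` when `a = (b + b⁻¹) / 2`,
-- and reflecting the zero `b⁻¹` in the circle does not change the modulus there.
theorem exists_norm_eval_eq_norm_re_sub (a : ℂ) : ∃ R : ℂ[X],
    (∀ z : ℂ, ‖z‖ = 1 → ‖R.eval z‖ = ‖(z.re : ℂ) - a‖) ∧
      HasDilationBound (fun z => R.eval z) 2 := by
  obtain ⟨b, hb1, hb⟩ := exists_one_le_norm_sq_add_one_eq a
  have hb0 : ‖2 * b‖ ≠ 0 := by rw [norm_mul, Complex.norm_two]; positivity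
  refine ⟨C (2 * b)⁻¹ * ((X - C b) * (X - C (starRingEnd ℂ b))), fun z hz => ?_, ?_⟩
  · simp only [eval_mul, eval_sub, eval_C, eval_X]
    rw [norm_mul, norm_mul, norm_sub_mul_norm_sub_conj hz hb, norm_inv, inv_mul_cancel_left₀ hb0]
  · simp only [eval_mul, eval_sub, eval_C, eval_X]
    exact ((HasDilationBound.const _).mul ((HasDilationBound.sub_const hb1).mul
      (HasDilationBound.sub_const (by rwa [Complex.norm_conj])))).mono (by norm_num)

theorem exists_norm_eval_eq_norm_eval_re (Q : ℂ[X]) : ∃ R : ℂ[X],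
    (∀ z : ℂ, ‖z‖ = 1 → ‖R.eval z‖ = ‖Q.eval (z.re : ℂ)‖) ∧
      HasDilationBound (fun z => R.eval z) (2 * Q.natDegree) := by
  have hroots : ∀ s : Multiset ℂ, ∃ R : ℂ[X],
      (∀ z : ℂ, ‖z‖ = 1 → ‖R.eval z‖ = ‖((s.map fun a => X - C a).prod).eval (z.re : ℂ)‖) ∧
        HasDilationBound (fun z => R.eval z) (2 * s.card) := by
    intro s
    induction s using Multiset.induction with
    | empty => exact ⟨1, by simp, by simpa using HasDilationBound.const 1⟩
    | cons a s ih =>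
      obtain ⟨R, hR, hRd⟩ := ih
      obtain ⟨S, hS, hSd⟩ := exists_norm_eval_eq_norm_re_sub a
      refine ⟨S * R, fun z hz => by simp [hS z hz, hR z hz], ?_⟩
      simp only [eval_mul]
      exact (hSd.mul hRd).mono (by rw [Multiset.card_cons]; push_cast; linarith)
  obtain ⟨R, hR, hRd⟩ := hroots Q.roots
  refine ⟨C Q.leadingCoeff * R, fun z hz => ?_, ?_⟩
  · conv_rhs => rw [(IsAlgClosed.splits Q).eq_prod_roots]
    rw [eval_mul, eval_mul, norm_mul, norm_mul, hR z hz, eval_C, eval_C]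
  · simp only [eval_mul, eval_C]
    exact ((HasDilationBound.const _).mul hRd).mono (by
      rw [zero_add]; gcongr; exact card_roots' Q)

-- Apply the Poisson integral formula at `w` to `z ↦ f(z)² (1 - w̄ z)²`: on the unit circle
-- `|1 - w̄ z| = |z - w|` cancels the denominator of the Poisson kernel.
theorem norm_sq_mul_le_circleAverage {f : ℂ → ℂ} (hf : DiffContOnCl ℂ f (Metric.ball 0 1))
    {w : ℂ} (hw : ‖w‖ < 1) :
    ‖f w‖ ^ 2 * (1 - ‖w‖ ^ 2) ≤ Real.circleAverage (fun z => ‖f z‖ ^ 2) 0 1 := by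
  set g : ℂ → ℂ := fun z => f z ^ 2 * (1 - starRingEnd ℂ w * z) ^ 2
  have hsq : DiffContOnCl ℂ (fun z => f z ^ 2) (Metric.ball 0 1) := by
    simpa only [sq] using! hf.smul hf
  have hlin : DiffContOnCl ℂ (fun z => (1 - starRingEnd ℂ w * z) ^ 2) (Metric.ball 0 1) :=
    Differentiable.diffContOnCl (by fun_prop)
  have hg : DiffContOnCl ℂ g (Metric.ball 0 1) := hsq.smul hlin
  have hpos : 0 < 1 - ‖w‖ ^ 2 := by nlinarith [norm_nonneg w]
  have hcircle : ∀ z : ℂ, ‖z‖ = 1 →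
      ‖(poissonKernel 0 w • g) z‖ = (1 - ‖w‖ ^ 2) * ‖f z‖ ^ 2 := by
    intro z hz
    have hzw : ‖z - w‖ ≠ 0 := by
      rw [norm_ne_zero_iff, sub_ne_zero]; rintro rfl; linarith
    simp only [g, Pi.smul_apply', poissonKernel_def, sub_zero, norm_smul, norm_mul, norm_pow,
      norm_one_sub_conj_mul hz, hz, Real.norm_eq_abs, abs_div, abs_pow, abs_norm, one_pow,
      abs_of_pos hpos]
    field_simp
  have hgw : ‖g w‖ = ‖f w‖ ^ 2 * (1 - ‖w‖ ^ 2) ^ 2 := by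
    rw [norm_mul, norm_pow, norm_pow, mul_comm (starRingEnd ℂ w), Complex.mul_conj,
      Complex.normSq_eq_norm_sq, ← Complex.ofReal_one, ← Complex.ofReal_sub, Complex.norm_real,
      Real.norm_of_nonneg hpos.le]
  have hle : ‖g w‖ ≤ (1 - ‖w‖ ^ 2) * Real.circleAverage (fun z => ‖f z‖ ^ 2) 0 1 := by
    rw [← hg.circleAverage_poissonKernel_smul (w := w) (by simpa using hw),
      Real.circleAverage_def, Real.circleAverage_def, norm_smul, smul_eq_mul, mul_left_comm,
      ← intervalIntegral.integral_const_mul, Real.norm_of_nonneg (by positivity)]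
    gcongr
    refine (intervalIntegral.norm_integral_le_integral_norm (by positivity)).trans_eq ?_
    exact intervalIntegral.integral_congr fun θ _ => hcircle _ (by simp)
  exact le_of_mul_le_mul_left (by rw [hgw] at hle; linarith) hpos

theorem one_add_inv_rpow_le_exp_one {a : ℝ} (ha : 0 < a) : (1 + a⁻¹) ^ a ≤ Real.exp 1 := by
  calc (1 + a⁻¹) ^ a ≤ Real.exp a⁻¹ ^ a := by
        gcongr
        rw [add_comm]
        exact Real.add_one_le_exp _
    _ = Real.exp 1 := by rw [← Real.exp_mul, inv_mul_cancel₀ ha.ne']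

-- Evaluate at the dilated point `r ζ` with the radius `r = m / (m + 1)`.
theorem HasDilationBound.norm_sq_le_circleAverage {f : ℂ → ℂ} {m : ℝ} (hfm : HasDilationBound f m)
    (hf : DiffContOnCl ℂ f (Metric.ball 0 1)) (hm : 0 ≤ m) {ζ : ℂ} (hζ : ‖ζ‖ = 1) :
    ‖f ζ‖ ^ 2 ≤ Real.exp 1 * ((m + 1) / 2) * Real.circleAverage (fun z => ‖f z‖ ^ 2) 0 1 := by
  set r : ℝ := m / (m + 1) with hr
  have hr0 : 0 ≤ r := by positivity
  have hr1 : r < 1 := by rw [hr, div_lt_one (by positivity)]; linarith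
  have hnorm : ‖(r : ℂ) * ζ‖ = r := by
    rw [norm_mul, hζ, Complex.norm_real, Real.norm_of_nonneg hr0, mul_one]
  have hq : 2 / (1 + r) = 1 + (2 * m + 1)⁻¹ := by rw [hr]; field_simp; ring
  have hfactor : ((2 / (1 + r)) ^ m) ^ 2 ≤ Real.exp 1 * ((m + 1) / 2) * (1 - r ^ 2) := by
    have hpow : ((2 / (1 + r)) ^ m) ^ 2 * (2 / (1 + r)) = (1 + (2 * m + 1)⁻¹) ^ (2 * m + 1) := by
      rw [hq, ← Real.rpow_mul_natCast (by positivity), ← Real.rpow_add_one (by positivity)]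
      congr 1; push_cast; ring
    have hone : (m + 1) / 2 * (1 - r ^ 2) * (2 / (1 + r)) = 1 := by rw [hr]; field_simp; ring
    refine le_of_mul_le_mul_right ?_ (show 0 < 2 / (1 + r) by positivity)
    rw [hpow, mul_assoc (Real.exp 1), mul_assoc (Real.exp 1), hone, mul_one]
    exact one_add_inv_rpow_le_exp_one (by positivity)
  have hhardy := norm_sq_mul_le_circleAverage hf (w := r * ζ) (by rwa [hnorm])
  rw [hnorm] at hhardy
  calc ‖f ζ‖ ^ 2 ≤ ((2 / (1 + r)) ^ m * ‖f (r * ζ)‖) ^ 2 := by gcongr; exact hfm ζ r hζ hr0 hr1.le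
    _ = ((2 / (1 + r)) ^ m) ^ 2 * ‖f (r * ζ)‖ ^ 2 := mul_pow _ _ _
    _ ≤ Real.exp 1 * ((m + 1) / 2) * (1 - r ^ 2) * ‖f (r * ζ)‖ ^ 2 := by gcongr
    _ = Real.exp 1 * ((m + 1) / 2) * (‖f (r * ζ)‖ ^ 2 * (1 - r ^ 2)) := by ring
    _ ≤ _ := by gcongr

end HardySpace

section NikolskiiInequality

/-- The ratio `density α β / density (-1/2) (-1/2)` of a Jacobi density to the Chebyshev density,
given by a formula that is continuous on `[-1, 1]` when `α, β ≥ -1/2`. -/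
def chebyshevRatio (α β x : ℝ) : ℝ :=
  Real.pi * normConst α β * ((1 - x) ^ (α + 1 / 2) * (1 + x) ^ (β + 1 / 2))

theorem normConst_pos {α β : ℝ} (hα : -1 < α) (hβ : -1 < β) : 0 < normConst α β := by
  have := Real.Gamma_pos_of_pos (s := α + β + 2) (by linarith)
  have := Real.Gamma_pos_of_pos (s := β + 1) (by linarith)
  have := Real.Gamma_pos_of_pos (s := α + 1) (by linarith)
  unfold normConst
  positivity

theorem normConst_neg_half : normConst (-1 / 2) (-1 / 2) = Real.pi⁻¹ := by
  norm_num [normConst, Real.Gamma_one_half_eq, Real.mul_self_sqrt Real.pi_pos.le]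

theorem density_eq_chebyshevRatio_mul (α β : ℝ) {x : ℝ} (hx : x ∈ Set.Ioo (-1 : ℝ) 1) :
    density α β x = chebyshevRatio α β x * density (-1 / 2) (-1 / 2) x := by
  have h1 : 0 < 1 - x := by linarith [hx.2]
  have h2 : 0 < 1 + x := by linarith [hx.1]
  have hadd : ∀ {y : ℝ}, 0 < y → ∀ s : ℝ, y ^ s = y ^ (s + 1 / 2) * y ^ (-1 / 2 : ℝ) := by
    intro y hy s
    rw [← Real.rpow_add hy]
    congr 1
    ring
  have hpi := Real.pi_ne_zero
  rw [chebyshevRatio, density, density, normConst_neg_half, hadd h1 α, hadd h2 β]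
  field_simp

theorem density_div_density_neg_half (α β : ℝ) {x : ℝ} (hx : x ∈ Set.Ioo (-1 : ℝ) 1) :
    density α β x / density (-1 / 2) (-1 / 2) x = chebyshevRatio α β x := by
  rw [density_eq_chebyshevRatio_mul α β hx,
    mul_div_cancel_right₀ _ (density_pos (by norm_num) (by norm_num) hx).ne']

theorem density_neg_half {x : ℝ} (hx : x ∈ Set.Ioo (-1 : ℝ) 1) :
    density (-1 / 2) (-1 / 2) x = Real.pi⁻¹ * √(1 - x ^ 2)⁻¹ := by
  have h1 : 0 < 1 - x := by linarith [hx.2]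
  have h2 : 0 < 1 + x := by linarith [hx.1]
  rw [density, normConst_neg_half, mul_assoc, ← Real.mul_rpow h1.le h2.le, Real.sqrt_eq_rpow,
    Real.inv_rpow (by nlinarith), ← Real.rpow_neg (by nlinarith)]
  congr 2 <;> ring

theorem circleAverage_comp_re {g : ℝ → ℝ} (hg : Continuous g) :
    Real.circleAverage (fun z => g z.re) 0 1 =
      Real.pi⁻¹ * ∫ θ in (0 : ℝ)..Real.pi, g (Real.cos θ) := by
  have hre : ∀ θ : ℝ, (circleMap 0 1 θ).re = Real.cos θ := by
    simp [circleMap, Complex.exp_ofReal_mul_I_re]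
  have hc : Continuous fun θ => g (Real.cos θ) := hg.comp Real.continuous_cos
  have hreflect : ∫ θ in Real.pi..2 * Real.pi, g (Real.cos θ) =
      ∫ θ in (0 : ℝ)..Real.pi, g (Real.cos θ) := by
    have := intervalIntegral.integral_comp_sub_left (a := 0) (b := Real.pi)
      (fun θ => g (Real.cos θ)) (2 * Real.pi)
    simp only [Real.cos_two_pi_sub, sub_zero] at this
    rw [this]
    congr 1
    ring
  simp only [Real.circleAverage_def, hre, smul_eq_mul]
  rw [← intervalIntegral.integral_add_adjacent_intervals (b := Real.pi)
    (hc.intervalIntegrable _ _) (hc.intervalIntegrable _ _), hreflect]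
  field_simp
  ring

theorem continuous_chebyshevRatio {α β : ℝ} (hα : -1 / 2 ≤ α) (hβ : -1 / 2 ≤ β) :
    Continuous (chebyshevRatio α β) := by
  unfold chebyshevRatio
  refine continuous_const.mul (Continuous.mul ?_ ?_)
  · exact (continuous_const.sub continuous_id).rpow_const fun _ => Or.inr (by linarith)
  · exact (continuous_const.add continuous_id).rpow_const fun _ => Or.inr (by linarith)

-- `x = cos θ` turns the Chebyshev density into the uniform density on the circle.
theorem circleAverage_chebyshevRatio_mul_eval {α β : ℝ} (hα : -1 / 2 ≤ α) (hβ : -1 / 2 ≤ β)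
    (Q : ℝ[X]) :
    Real.circleAverage (fun z => chebyshevRatio α β z.re * Q.eval z.re) 0 1 =
      jacobiIntegral (by linarith : -1 < α) (by linarith : -1 < β) Q := by
  rw [circleAverage_comp_re (g := fun x => chebyshevRatio α β x * Q.eval x)
      ((continuous_chebyshevRatio hα hβ).mul Q.continuous),
    ← Chebyshev.integral_measureT_eq_integral_cos
      (f := fun x => chebyshevRatio α β x * Q.eval x),
    Chebyshev.integral_measureT, jacobiIntegral_apply, ← intervalIntegral.integral_const_mul]
  refine intervalIntegral.integral_congr_uIoo fun x hx => ?_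
  rw [Set.uIoo_of_le (by norm_num)] at hx
  simp only [density_eq_chebyshevRatio_mul α β hx, density_neg_half hx]
  ring

theorem one_sub_mem_slitPlane {z : ℂ} (hz : ‖z‖ ≤ 1) (h1 : z ≠ 1) : 1 - z ∈ Complex.slitPlane := by
  have hre : z.re < 1 := by
    refine lt_of_le_of_ne ((Complex.re_le_norm z).trans hz) fun hre => h1 ?_
    have him := Complex.sq_norm z
    rw [Complex.normSq_apply, hre] at him
    exact Complex.ext hre (by rw [Complex.one_im]; nlinarith [norm_nonneg z])
  exact Complex.mem_slitPlane_iff.2 (Or.inl (by rw [Complex.sub_re, Complex.one_re]; linarith))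

theorem diffContOnCl_one_sub_cpow {s : ℝ} (hs : 0 ≤ s) :
    DiffContOnCl ℂ (fun z : ℂ => (1 - z) ^ (s : ℂ)) (Metric.ball 0 1) := by
  rcases hs.eq_or_lt with rfl | hs
  · simpa using diffContOnCl_const
  refine DiffContOnCl.mk_ball (fun z hz => ?_) fun z hz => ?_
  · rw [mem_ball_zero_iff] at hz
    refine (DifferentiableAt.cpow_const (by fun_prop)
      (one_sub_mem_slitPlane hz.le ?_)).differentiableWithinAt
    rintro rfl
    simp at hz
  · rw [mem_closedBall_zero_iff] at hz
    refine ContinuousAt.continuousWithinAt ?_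
    by_cases h1 : z = 1
    · have h0 : ContinuousAt (fun y : ℂ => y ^ (s : ℂ)) (1 - z) := by
        rw [h1, sub_self]
        exact (Complex.continuousAt_cpow_zero_of_re_pos (z := (s : ℂ)) (by simpa using hs)).comp
          (f := fun y : ℂ => (y, (s : ℂ))) (by fun_prop)
      exact ContinuousAt.comp (f := fun z : ℂ => 1 - z) h0 (by fun_prop)
    · exact ContinuousAt.cpow (by fun_prop) continuousAt_const (one_sub_mem_slitPlane hz h1)

theorem diffContOnCl_one_add_cpow {s : ℝ} (hs : 0 ≤ s) :
    DiffContOnCl ℂ (fun z : ℂ => (1 + z) ^ (s : ℂ)) (Metric.ball 0 1) := by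
  have hneg : Set.MapsTo (fun z : ℂ => -z) (Metric.ball 0 1) (Metric.ball 0 1) := fun z hz => by
    rwa [mem_ball_zero_iff, norm_neg, ← mem_ball_zero_iff]
  simpa only [Function.comp_def, sub_neg_eq_add] using
    (diffContOnCl_one_sub_cpow hs).comp differentiable_neg.diffContOnCl hneg

theorem norm_one_sub_sq {z : ℂ} (hz : ‖z‖ = 1) : ‖1 - z‖ ^ 2 = 2 * (1 - z.re) := by
  have h := Complex.sq_norm z
  rw [hz, Complex.normSq_apply] at h
  rw [Complex.sq_norm, Complex.normSq_apply, Complex.sub_re, Complex.sub_im, Complex.one_re,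
    Complex.one_im]
  linear_combination -h

theorem norm_one_sub_cpow_sq (s : ℝ) {z : ℂ} (hz : ‖z‖ = 1) :
    ‖(1 - z) ^ (s : ℂ)‖ ^ 2 = (2 * (1 - z.re)) ^ s := by
  rw [Complex.norm_cpow_real, ← norm_one_sub_sq hz, Real.rpow_pow_comm (norm_nonneg _)]

theorem norm_one_add_cpow_sq (s : ℝ) {z : ℂ} (hz : ‖z‖ = 1) :
    ‖(1 + z) ^ (s : ℂ)‖ ^ 2 = (2 * (1 + z.re)) ^ s := by
  simpa using norm_one_sub_cpow_sq s (z := -z) (by simpa using hz)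

theorem exists_norm_sq_eq_chebyshevRatio_mul {α β : ℝ} (hα : -1 / 2 ≤ α) (hβ : -1 / 2 ≤ β)
    (Q : ℝ[X]) : ∃ f : ℂ → ℂ, DiffContOnCl ℂ f (Metric.ball 0 1) ∧
      HasDilationBound f (2 * Q.natDegree + α + β + 1) ∧
      ∀ z : ℂ, ‖z‖ = 1 → ‖f z‖ ^ 2 = chebyshevRatio α β z.re * Q.eval z.re ^ 2 := by
  have hs : 0 ≤ α + 1 / 2 := by linarith
  have ht : 0 ≤ β + 1 / 2 := by linarith
  obtain ⟨R, hR, hRd⟩ := exists_norm_eval_eq_norm_eval_re (Q.map (algebraMap ℝ ℂ))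
  have hRsq : ∀ z : ℂ, ‖z‖ = 1 → ‖R.eval z‖ ^ 2 = Q.eval z.re ^ 2 := by
    intro z hz
    rw [hR z hz, eval_map_algebraMap, ← Complex.coe_algebraMap,
      aeval_algebraMap_apply_eq_algebraMap_eval, Complex.coe_algebraMap, Complex.norm_real,
      Real.norm_eq_abs, sq_abs]
  set c : ℝ := √(Real.pi * normConst α β / 2 ^ (α + β + 1))
  have hcsq : c ^ 2 = Real.pi * normConst α β / 2 ^ (α + β + 1) := by
    have := normConst_pos (α := α) (β := β) (by linarith) (by linarith)
    exact Real.sq_sqrt (by positivity)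
  refine ⟨fun z => c * ((1 - z) ^ ((α + 1 / 2 : ℝ) : ℂ) * (1 + z) ^ ((β + 1 / 2 : ℝ) : ℂ) *
    R.eval z), ?_, ?_, fun z hz => ?_⟩
  · exact (((diffContOnCl_one_sub_cpow hs).smul (diffContOnCl_one_add_cpow ht)).smul
      R.differentiable.diffContOnCl).const_smul (c : ℂ)
  · refine (HasDilationBound.const _ |>.mul ((HasDilationBound.one_sub.cpow hs).mul
      (HasDilationBound.one_add.cpow ht) |>.mul hRd)).mono (le_of_eq ?_)
    rw [natDegree_map]
    ring
  · have hre := abs_le.1 ((Complex.abs_re_le_norm z).trans hz.le)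
    have h2 : (2 : ℝ) ^ (α + β + 1) = 2 ^ (α + 1 / 2) * 2 ^ (β + 1 / 2) := by
      rw [← Real.rpow_add two_pos]
      congr 1
      ring
    simp only [norm_mul, mul_pow, norm_one_sub_cpow_sq _ hz, norm_one_add_cpow_sq _ hz, hRsq z hz,
      Complex.norm_real, Real.norm_eq_abs, sq_abs, hcsq, chebyshevRatio, h2]
    rw [Real.mul_rpow two_pos.le (by linarith), Real.mul_rpow two_pos.le (by linarith)]
    field_simp

theorem chebyshevRatio_mul_sq_le {α β : ℝ} (hα : -1 / 2 ≤ α) (hβ : -1 / 2 ≤ β) {n : ℕ} {Q : ℝ[X]}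
    (hQ : Q.natDegree ≤ n) {x : ℝ} (hx : x ∈ Set.Icc (-1 : ℝ) 1) :
    chebyshevRatio α β x * Q.eval x ^ 2 ≤
      Real.exp 1 * (n + (α + β) / 2 + 1) *
        jacobiIntegral (by linarith : -1 < α) (by linarith : -1 < β) (Q ^ 2) := by
  obtain ⟨f, hf, hfd, hfsq⟩ := exists_norm_sq_eq_chebyshevRatio_mul hα hβ Q
  have hfn : HasDilationBound f (2 * n + α + β + 1) := hfd.mono (by gcongr)
  set ζ : ℂ := Complex.exp (Real.arccos x * Complex.I) with hζ
  have hζ1 : ‖ζ‖ = 1 := Complex.norm_exp_ofReal_mul_I _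
  have hζre : ζ.re = x := by
    rw [hζ, Complex.exp_ofReal_mul_I_re, Real.cos_arccos hx.1 hx.2]
  have haverage : Real.circleAverage (fun z => ‖f z‖ ^ 2) 0 1 =
      jacobiIntegral (by linarith : -1 < α) (by linarith : -1 < β) (Q ^ 2) := by
    rw [← circleAverage_chebyshevRatio_mul_eval hα hβ]
    refine Real.circleAverage_congr_sphere fun z hz => ?_
    simpa using hfsq z (by simpa using hz)
  have : (0 : ℝ) ≤ n := n.cast_nonneg
  have hle := hfn.norm_sq_le_circleAverage hf (by linarith) hζ1
  rw [hfsq ζ hζ1, hζre, haverage] at hle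
  convert hle using 3
  ring

theorem IsJacobiBasis.jacobiIntegral_sum_sq {α β : ℝ} {p : ℕ → ℝ[X]} (h : IsJacobiBasis α β p)
    (hα : -1 < α) (hβ : -1 < β) (s : Finset ℕ) (a : ℕ → ℝ) :
    jacobiIntegral hα hβ ((∑ k ∈ s, C (a k) * p k) ^ 2) = ∑ k ∈ s, a k ^ 2 := by
  rw [sq, Finset.sum_mul_sum, map_sum]
  refine Finset.sum_congr rfl fun j hj => ?_
  have hterm : ∀ k, jacobiIntegral hα hβ (C (a j) * p j * (C (a k) * p k)) =
      if j = k then a j * a k else 0 := by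
    intro k
    rw [mul_mul_mul_comm, ← C_mul, jacobiIntegral_C_mul, h.jacobiIntegral_mul, mul_ite, mul_one,
      mul_zero]
  rw [map_sum, Finset.sum_congr rfl fun k _ => hterm k, Finset.sum_ite_eq, if_pos hj, sq]

-- Apply the Nikolskii inequality to the reproducing kernel at `x`.
theorem IsJacobiBasis.chebyshevRatio_mul_sum_sq_le {α β : ℝ} {p : ℕ → ℝ[X]}
    (h : IsJacobiBasis α β p) (hα : -1 / 2 ≤ α) (hβ : -1 / 2 ≤ β) (n : ℕ) {x : ℝ}
    (hx : x ∈ Set.Icc (-1 : ℝ) 1) :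
    chebyshevRatio α β x * ∑ k ∈ Finset.range (n + 1), (p k).eval x ^ 2 ≤
      Real.exp 1 * (n + (α + β) / 2 + 1) := by
  set K := ∑ k ∈ Finset.range (n + 1), (p k).eval x ^ 2 with hK
  set Q : ℝ[X] := ∑ k ∈ Finset.range (n + 1), C ((p k).eval x) * p k with hQ
  have hdeg : Q.natDegree ≤ n := by
    refine natDegree_sum_le_of_forall_le _ _ fun k hk => (natDegree_C_mul_le _ _).trans ?_
    rw [h.natDegree_eq]
    exact Finset.mem_range_succ_iff.1 hk
  have hQx : Q.eval x = K := by simp only [hQ, hK, eval_finsetSum, eval_mul, eval_C, sq]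
  have hnikolskii := chebyshevRatio_mul_sq_le hα hβ hdeg hx
  rw [hQx, h.jacobiIntegral_sum_sq, ← hK] at hnikolskii
  have hK0 : 0 ≤ K := Finset.sum_nonneg fun k _ => sq_nonneg _
  rcases hK0.eq_or_lt with h0 | h0
  · rw [← h0, mul_zero]
    have : (0 : ℝ) ≤ n := n.cast_nonneg
    exact mul_nonneg (Real.exp_pos 1).le (by linarith)
  · exact le_of_mul_le_mul_right (by nlinarith) h0

end NikolskiiInequality

section SturmComparison

/-- `u'' = -q u` on `s`, where `u'` and `q'` are the derivatives of `u` and `q`. -/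
structure IsSturmSolution (u u' q q' : ℝ → ℝ) (s : Set ℝ) : Prop where
  hasDerivAt : ∀ θ ∈ s, HasDerivAt u (u' θ) θ
  hasDerivAt_deriv : ∀ θ ∈ s, HasDerivAt u' (-q θ * u θ) θ
  hasDerivAt_potential : ∀ θ ∈ s, HasDerivAt q (q' θ) θ

theorem exists_last_zero {u : ℝ → ℝ} {a T : ℝ} (haT : a ≤ T) (hu : ContinuousOn u (Set.Icc a T))
    (ha : u a = 0) (hT : 0 < u T) :
    ∃ ξ ∈ Set.Ico a T, u ξ = 0 ∧ ∀ θ ∈ Set.Ioc ξ T, 0 < u θ := by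
  have hcompact : IsCompact (Set.Icc a T ∩ u ⁻¹' {0}) :=
    isCompact_Icc.of_isClosed_subset (hu.preimage_isClosed_of_isClosed isClosed_Icc
      isClosed_singleton) Set.inter_subset_left
  obtain ⟨ξ, ⟨hξ, hξ0 : u ξ = 0⟩, hlast⟩ := hcompact.exists_isGreatest ⟨a, ⟨le_rfl, haT⟩, ha⟩
  refine ⟨ξ, ⟨hξ.1, hξ.2.lt_of_ne (by rintro rfl; exact hT.ne' hξ0)⟩, hξ0, fun θ hθ => ?_⟩
  by_contra hneg
  obtain ⟨η, hη, hη0⟩ := intermediate_value_Icc hθ.2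
    (hu.mono (Set.Icc_subset_Icc_left (hξ.1.trans hθ.1.le))) ⟨not_lt.1 hneg, hT.le⟩
  have : η ≤ ξ := hlast ⟨⟨hξ.1.trans (hθ.1.le.trans hη.1), hη.2⟩, hη0⟩
  linarith [hη.1, hθ.1]

namespace IsSturmSolution

variable {u u' q q' : ℝ → ℝ} {s : Set ℝ} {a ξ T L h : ℝ}

theorem mono {t : Set ℝ} (H : IsSturmSolution u u' q q' s) (hts : t ⊆ s) :
    IsSturmSolution u u' q q' t :=
  ⟨fun θ hθ => H.hasDerivAt θ (hts hθ), fun θ hθ => H.hasDerivAt_deriv θ (hts hθ),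
    fun θ hθ => H.hasDerivAt_potential θ (hts hθ)⟩

theorem neg (H : IsSturmSolution u u' q q' s) : IsSturmSolution (-u) (-u') q q' s :=
  ⟨fun θ hθ => (H.hasDerivAt θ hθ).neg,
    fun θ hθ => (H.hasDerivAt_deriv θ hθ).neg.congr_deriv (by simp), H.hasDerivAt_potential⟩

theorem hasDerivAt_energy (H : IsSturmSolution u u' q q' s) {θ : ℝ} (hθ : θ ∈ s) :
    HasDerivAt (fun θ => u' θ ^ 2 + q θ * u θ ^ 2) (q' θ * u θ ^ 2) θ := by
  refine (((H.hasDerivAt_deriv θ hθ).fun_pow 2).fun_add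
    ((H.hasDerivAt_potential θ hθ).fun_mul ((H.hasDerivAt θ hθ).fun_pow 2))).congr_deriv ?_
  push_cast
  ring

theorem monotoneOn_energy (H : IsSturmSolution u u' q q' s) (hs : Convex ℝ s)
    (hq : ∀ θ ∈ s, 0 ≤ q' θ) : MonotoneOn (fun θ => u' θ ^ 2 + q θ * u θ ^ 2) s :=
  monotoneOn_of_hasDerivWithinAt_nonneg hs
    (fun _ hθ => (H.hasDerivAt_energy hθ).continuousAt.continuousWithinAt)
    (fun _ hθ => (H.hasDerivAt_energy (interior_subset hθ)).hasDerivWithinAt)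
    fun θ hθ => mul_nonneg (hq θ (interior_subset hθ)) (sq_nonneg _)

theorem monotoneOn_potential (H : IsSturmSolution u u' q q' s) (hs : Convex ℝ s)
    (hq : ∀ θ ∈ s, 0 ≤ q' θ) : MonotoneOn q s :=
  monotoneOn_of_hasDerivWithinAt_nonneg hs
    (fun θ hθ => (H.hasDerivAt_potential θ hθ).continuousAt.continuousWithinAt)
    (fun θ hθ => (H.hasDerivAt_potential θ (interior_subset hθ)).hasDerivWithinAt)
    fun θ hθ => hq θ (interior_subset hθ)

-- Since `u a = 0`, there are points with `u u' ≥ 0` arbitrarily close to `a`.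
theorem energy_nonneg (H : IsSturmSolution u u' q q' (Set.Ioc a T))
    (hu : ContinuousOn u (Set.Icc a T)) (ha : u a = 0) (hq : ∀ θ ∈ Set.Ioc a T, 0 ≤ q' θ)
    (hE : ∀ θ ∈ Set.Ioc a T, 0 ≤ u θ * u' θ → 0 ≤ u' θ ^ 2 + q θ * u θ ^ 2)
    {θ : ℝ} (hθ : θ ∈ Set.Ioc a T) : 0 ≤ u' θ ^ 2 + q θ * u θ ^ 2 := by
  obtain ⟨η, hη, hslope⟩ := exists_hasDerivAt_eq_slope (fun θ => u θ ^ 2)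
    (fun θ => 2 * (u θ * u' θ)) hθ.1 ((hu.mono (Set.Icc_subset_Icc_right hθ.2)).pow 2) (by
      intro x hx
      refine ((H.hasDerivAt x ⟨hx.1, hx.2.le.trans hθ.2⟩).fun_pow 2).congr_deriv ?_
      push_cast
      ring)
  have hηT : η ∈ Set.Ioc a T := ⟨hη.1, hη.2.le.trans hθ.2⟩
  have hgrow : 0 ≤ u η * u' η := by
    have : 0 ≤ (u θ ^ 2 - u a ^ 2) / (θ - a) := by
      rw [ha, zero_pow two_ne_zero, sub_zero]
      exact div_nonneg (sq_nonneg _) (sub_nonneg.2 hθ.1.le)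
    linarith
  exact (hE η hηT hgrow).trans (H.monotoneOn_energy (convex_Ioc a T) hq hηT hθ hη.2.le)

theorem deriv_le_of_isMax (H : IsSturmSolution u u' q q' (Set.Ioc ξ T)) (hξ : ξ < T)
    (hq : ∀ θ ∈ Set.Ioc ξ T, q θ ≤ q T) (hqT : 0 ≤ q T) (hpos : ∀ θ ∈ Set.Ioc ξ T, 0 < u θ)
    (hmax : ∀ θ ∈ Set.Ioc ξ T, u θ ≤ u T) (hcrit : u' T = 0) {θ : ℝ} (hθ : θ ∈ Set.Ioc ξ T) :
    u' θ ≤ u T * (q T * (T - θ)) := by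
  have hd : ∀ θ ∈ Set.Ioc ξ T, HasDerivAt (fun θ => u' θ - u T * (q T * (T - θ)))
      (-q θ * u θ + u T * q T) θ := fun θ hθ =>
    ((H.hasDerivAt_deriv θ hθ).fun_sub
      ((((hasDerivAt_id θ).const_sub T).const_mul (q T)).const_mul (u T))).congr_deriv (by ring)
  have hmono : MonotoneOn (fun θ => u' θ - u T * (q T * (T - θ))) (Set.Ioc ξ T) := by
    refine monotoneOn_of_hasDerivWithinAt_nonneg (convex_Ioc ξ T)
      (fun θ hθ => (hd θ hθ).continuousAt.continuousWithinAt)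
      (fun θ hθ => (hd θ (interior_subset hθ)).hasDerivWithinAt) fun θ hθ => ?_
    have hθ := interior_subset hθ
    have : q θ * u θ ≤ q T * u T :=
      (mul_le_mul_of_nonneg_right (hq θ hθ) (hpos θ hθ).le).trans
        (mul_le_mul_of_nonneg_left (hmax θ hθ) hqT)
    linarith
  have := hmono hθ ⟨hξ, le_rfl⟩ hθ.2
  simp only [hcrit, sub_self, mul_zero] at this
  linarith

theorem le_of_isMax (H : IsSturmSolution u u' q q' (Set.Ioc ξ T)) (hξ : ξ < T)
    (hu : ContinuousOn u (Set.Icc ξ T)) (hq : ∀ θ ∈ Set.Ioc ξ T, q θ ≤ q T) (hqT : 0 ≤ q T)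
    (hpos : ∀ θ ∈ Set.Ioc ξ T, 0 < u θ) (hmax : ∀ θ ∈ Set.Ioc ξ T, u θ ≤ u T) (hcrit : u' T = 0)
    {θ : ℝ} (hθ : θ ∈ Set.Icc ξ T) : u T * (1 - q T * (T - θ) ^ 2 / 2) ≤ u θ := by
  have hd : ∀ θ, HasDerivAt (fun θ => u T * (1 - q T * (T - θ) ^ 2 / 2))
      (u T * (q T * (T - θ))) θ := fun θ => by
    refine (((((hasDerivAt_id θ).const_sub T).fun_pow 2).const_mul (q T)).div_const 2
      |>.const_sub 1 |>.const_mul (u T)).congr_deriv ?_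
    push_cast
    simp only [id]
    ring
  have hanti : AntitoneOn (fun θ => u θ - u T * (1 - q T * (T - θ) ^ 2 / 2)) (Set.Icc ξ T) := by
    refine antitoneOn_of_hasDerivWithinAt_nonpos (convex_Icc ξ T)
      (f' := fun θ => u' θ - u T * (q T * (T - θ)))
      (hu.sub fun θ _ => (hd θ).continuousAt.continuousWithinAt) (fun θ hθ => ?_) fun θ hθ => ?_
    all_goals
      rw [interior_Icc] at hθ
      have hθ := Set.Ioo_subset_Ioc_self hθ
    · exact ((H.hasDerivAt θ hθ).sub (hd θ)).hasDerivWithinAt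
    · exact sub_nonpos.2 (H.deriv_le_of_isMax hξ hq hqT hpos hmax hcrit hθ)
  have := hanti hθ ⟨hξ.le, le_rfl⟩ hθ.2
  norm_num at this
  linarith

theorem energy_add_le_energy {Q U : ℝ} (H : IsSturmSolution u u' q q' (Set.Icc (T - h) T))
    (hh : 0 ≤ h) (hQ : 0 ≤ Q) (hU : 0 ≤ U) (hQh : Q * h ^ 2 ≤ 1) (hL0 : 0 ≤ L)
    (hL : ∀ θ ∈ Set.Icc (T - h) T, L ≤ q' θ)
    (hu : ∀ θ ∈ Set.Icc (T - h) T, U * (1 - Q * (T - θ) ^ 2 / 2) ≤ u θ) :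
    u' (T - h) ^ 2 + q (T - h) * u (T - h) ^ 2 + L * U ^ 2 * (h - Q * h ^ 3 / 3) ≤
      u' T ^ 2 + q T * u T ^ 2 := by
  have hd : ∀ θ ∈ Set.Icc (T - h) T, HasDerivAt (fun θ => u' θ ^ 2 + q θ * u θ ^ 2 -
      L * U ^ 2 * (θ + Q * (T - θ) ^ 3 / 3))
      (q' θ * u θ ^ 2 - L * U ^ 2 * (1 - Q * (T - θ) ^ 2)) θ := fun θ hθ => by
    refine (H.hasDerivAt_energy hθ).fun_sub ((((hasDerivAt_id θ).fun_add
      ((((hasDerivAt_id θ).const_sub T).fun_pow 3).const_mul Q |>.div_const 3)).const_mul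
        (L * U ^ 2)).congr_deriv ?_)
    push_cast
    simp only [id]
    ring
  have hmono : MonotoneOn (fun θ => u' θ ^ 2 + q θ * u θ ^ 2 -
      L * U ^ 2 * (θ + Q * (T - θ) ^ 3 / 3)) (Set.Icc (T - h) T) := by
    refine monotoneOn_of_hasDerivWithinAt_nonneg (convex_Icc _ T)
      (fun θ hθ => (hd θ hθ).continuousAt.continuousWithinAt)
      (fun θ hθ => (hd θ (interior_subset hθ)).hasDerivWithinAt) fun θ hθ => ?_
    have hθ := interior_subset hθ
    have hTθ : Q * (T - θ) ^ 2 ≤ 1 := by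
      refine le_trans ?_ hQh
      have := sub_nonneg.2 hθ.2
      gcongr
      linarith [hθ.1]
    have husq : U ^ 2 * (1 - Q * (T - θ) ^ 2) ≤ u θ ^ 2 := by
      calc U ^ 2 * (1 - Q * (T - θ) ^ 2) ≤ U ^ 2 * (1 - Q * (T - θ) ^ 2 / 2) ^ 2 := by
            gcongr
            nlinarith [sq_nonneg (Q * (T - θ) ^ 2)]
        _ = (U * (1 - Q * (T - θ) ^ 2 / 2)) ^ 2 := (mul_pow _ _ _).symm
        _ ≤ u θ ^ 2 := pow_le_pow_left₀ (mul_nonneg hU (by linarith)) (hu θ hθ) 2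
    have := (mul_le_mul_of_nonneg_left husq hL0).trans
      (mul_le_mul_of_nonneg_right (hL θ hθ) (sq_nonneg _))
    linarith
  have := hmono (a := T - h) (b := T) ⟨le_rfl, by linarith⟩ ⟨by linarith, le_rfl⟩ (by linarith)
  simp only [sub_self, sub_sub_cancel] at this
  linarith

-- On the interval of length `q(T)^(-1/2)` before the maximum, `u` is comparable to `u T`, so the
-- energy, which is `q(T) u(T)²` at `T`, must have grown there by a multiple of `L q(T)^(-1/2)`.
theorem sq_le_potential_pow_three_of_pos (H : IsSturmSolution u u' q q' (Set.Ioc a T))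
    (haT : a < T) (hu : ContinuousOn u (Set.Icc a T)) (ha : u a = 0) (hL0 : 0 ≤ L)
    (hL : ∀ θ ∈ Set.Ioc a T, L ≤ q' θ)
    (hE : ∀ θ ∈ Set.Ioc a T, 0 ≤ u θ * u' θ → 0 ≤ u' θ ^ 2 + q θ * u θ ^ 2)
    (hcrit : u' T = 0) (hpos : 0 < u T) (hmax : ∀ θ ∈ Set.Icc a T, u θ ≤ u T) :
    4 / 9 * L ^ 2 ≤ q T ^ 3 := by
  have hq0 : ∀ θ ∈ Set.Ioc a T, 0 ≤ q' θ := fun θ hθ => hL0.trans (hL θ hθ)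
  have hQ0 : 0 ≤ q T := by
    have := H.energy_nonneg hu ha hq0 hE ⟨haT, le_rfl⟩
    rw [hcrit] at this
    exact nonneg_of_mul_nonneg_left (by linarith) (pow_pos hpos 2)
  obtain ⟨ξ, hξ, hξ0, hξpos⟩ := exists_last_zero haT.le hu ha hpos
  have hsub : Set.Ioc ξ T ⊆ Set.Ioc a T := Set.Ioc_subset_Ioc_left hξ.1
  have hlower : ∀ θ ∈ Set.Icc ξ T, u T * (1 - q T * (T - θ) ^ 2 / 2) ≤ u θ := fun θ hθ =>
    (H.mono hsub).le_of_isMax hξ.2 (hu.mono (Set.Icc_subset_Icc_left hξ.1))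
      (fun θ hθ => H.monotoneOn_potential (convex_Ioc a T) hq0 (hsub hθ) ⟨haT, le_rfl⟩ hθ.2)
      hQ0 hξpos (fun θ hθ => hmax θ (Set.Ioc_subset_Icc_self (hsub hθ))) hcrit hθ
  have hwidth : 2 ≤ q T * (T - ξ) ^ 2 := by
    have := hlower ξ ⟨le_rfl, hξ.2.le⟩
    rw [hξ0] at this
    linarith [nonpos_of_mul_nonpos_right this hpos]
  have hQpos : 0 < q T := hQ0.lt_of_ne (by rintro h; rw [← h] at hwidth; linarith)
  set h := (√(q T))⁻¹ with hh
  have hh0 : 0 < h := by positivity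
  have hQh : q T * h ^ 2 = 1 := by
    rw [hh, inv_pow, Real.sq_sqrt hQ0, mul_inv_cancel₀ hQpos.ne']
  have hhξ : h < T - ξ := by
    refine lt_of_pow_lt_pow_left₀ 2 (sub_nonneg.2 hξ.2.le) (lt_of_mul_lt_mul_left ?_ hQ0)
    linarith
  have hsubh : Set.Icc (T - h) T ⊆ Set.Ioc ξ T := fun θ hθ => ⟨by linarith [hθ.1], hθ.2⟩
  have hgain := (H.mono (hsubh.trans hsub)).energy_add_le_energy hh0.le hQ0 hpos.le hQh.le hL0
    (fun θ hθ => hL θ (hsub (hsubh hθ))) fun θ hθ => hlower θ (Set.Ioc_subset_Icc_self (hsubh hθ))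
  have hE0 := H.energy_nonneg hu ha hq0 hE (hsub (hsubh ⟨le_rfl, by linarith⟩))
  have hLh : L * (2 / 3 * h) ≤ q T := by
    refine le_of_mul_le_mul_right ?_ (pow_pos hpos 2)
    rw [hcrit, pow_succ h 2, ← mul_assoc, hQh] at hgain
    linarith
  calc 4 / 9 * L ^ 2 = 4 / 9 * L ^ 2 * (q T * h ^ 2) := by rw [hQh, mul_one]
    _ = (L * (2 / 3 * h)) ^ 2 * q T := by ring
    _ ≤ q T ^ 2 * q T := by gcongr
    _ = q T ^ 3 := by ring

theorem sq_le_potential_pow_three (H : IsSturmSolution u u' q q' (Set.Ioc a T))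
    (haT : a < T) (hu : ContinuousOn u (Set.Icc a T)) (ha : u a = 0) (hL0 : 0 ≤ L)
    (hL : ∀ θ ∈ Set.Ioc a T, L ≤ q' θ)
    (hE : ∀ θ ∈ Set.Ioc a T, 0 ≤ u θ * u' θ → 0 ≤ u' θ ^ 2 + q θ * u θ ^ 2)
    (hcrit : u' T = 0) (hne : u T ≠ 0) (hmax : ∀ θ ∈ Set.Icc a T, u θ ^ 2 ≤ u T ^ 2) :
    4 / 9 * L ^ 2 ≤ q T ^ 3 := by
  have hmax' : ∀ θ ∈ Set.Icc a T, |u θ| ≤ |u T| := fun θ hθ => sq_le_sq.1 (hmax θ hθ)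
  rcases lt_or_gt_of_ne hne with hneg | hpos
  · refine H.neg.sq_le_potential_pow_three_of_pos haT hu.neg (by simp [ha]) hL0 hL
      (fun θ hθ h => ?_) (by simp [hcrit]) (neg_pos.2 hneg) fun θ hθ => ?_
    · simpa using hE θ hθ (by simpa using h)
    · exact (neg_le_abs _).trans ((hmax' θ hθ).trans_eq (abs_of_neg hneg))
  · exact H.sq_le_potential_pow_three_of_pos haT hu ha hL0 hL hE hcrit hpos fun θ hθ =>
      (le_abs_self _).trans ((hmax' θ hθ).trans_eq (abs_of_pos hpos))

end IsSturmSolution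

end SturmComparison

section LiouvilleNormalForm

open Real

/-- The weight `√(ρ / ρ_c)` at `x = cos θ`, as a function of the angle `θ`. -/
def angularWeight (α β θ : ℝ) : ℝ :=
  √(π * normConst α β * 2 ^ (α + β + 1)) *
    (sin (θ / 2) ^ (α + 1 / 2) * cos (θ / 2) ^ (β + 1 / 2))

/-- The logarithmic derivative of `angularWeight`. -/
def angularLogDeriv (α β θ : ℝ) : ℝ :=
  (α + 1 / 2) * cos (θ / 2) / (2 * sin (θ / 2)) - (β + 1 / 2) * sin (θ / 2) / (2 * cos (θ / 2))

/-- The potential of the Jacobi equation in Liouville normal form. -/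
def liouvillePotential (α β ν θ : ℝ) : ℝ :=
  ν ^ 2 - (α ^ 2 - 1 / 4) / 4 / sin (θ / 2) ^ 2 - (β ^ 2 - 1 / 4) / 4 / cos (θ / 2) ^ 2

/-- The derivative of `liouvillePotential` in the angle; it does not involve the frequency. -/
def liouvillePotentialDeriv (α β θ : ℝ) : ℝ :=
  (α ^ 2 - 1 / 4) / 4 * cos (θ / 2) / sin (θ / 2) ^ 3 -
    (β ^ 2 - 1 / 4) / 4 * sin (θ / 2) / cos (θ / 2) ^ 3

/-- The frequency `ν` in the Liouville normal form of the Jacobi equation of degree `n`. -/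
def jacobiFrequency (α β : ℝ) (n : ℕ) : ℝ := n + (α + β + 1) / 2

/-- The Liouville transform `√(ρ / ρ_c) p` of a polynomial, as a function of `θ = arccos x`. -/
def liouvilleFun (α β : ℝ) (p : ℝ[X]) (θ : ℝ) : ℝ := angularWeight α β θ * p.eval (cos θ)

/-- The derivative of `liouvilleFun`. -/
def liouvilleFunDeriv (α β : ℝ) (p : ℝ[X]) (θ : ℝ) : ℝ :=
  angularWeight α β θ *
    (angularLogDeriv α β θ * p.eval (cos θ) - sin θ * (derivative p).eval (cos θ))

variable {α β θ : ℝ} {p : ℕ → ℝ[X]}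

theorem sin_half_pos (hθ : θ ∈ Set.Ioo 0 π) : 0 < sin (θ / 2) :=
  sin_pos_of_pos_of_lt_pi (by linarith [hθ.1]) (by linarith [hθ.1, hθ.2])

theorem cos_half_pos (hθ : θ ∈ Set.Ioo 0 π) : 0 < cos (θ / 2) :=
  cos_pos_of_mem_Ioo ⟨by linarith [hθ.1, hθ.2], by linarith [hθ.2]⟩

theorem cos_eq_one_sub_sin_half_sq (θ : ℝ) : cos θ = 1 - 2 * sin (θ / 2) ^ 2 := by
  have h := cos_two_mul (θ / 2)
  rw [mul_div_cancel₀ θ two_ne_zero, cos_sq'] at h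
  linarith

theorem sin_eq_sin_half_mul_cos_half (θ : ℝ) : sin θ = 2 * sin (θ / 2) * cos (θ / 2) := by
  rw [← sin_two_mul, mul_div_cancel₀ θ two_ne_zero]

theorem hasDerivAt_sin_half (θ : ℝ) : HasDerivAt (fun θ => sin (θ / 2)) (cos (θ / 2) / 2) θ :=
  (((hasDerivAt_id' θ).div_const 2).sin).congr_deriv (by ring)

theorem hasDerivAt_cos_half (θ : ℝ) : HasDerivAt (fun θ => cos (θ / 2)) (-sin (θ / 2) / 2) θ :=
  (((hasDerivAt_id' θ).div_const 2).cos).congr_deriv (by ring)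

theorem hasDerivAt_eval_cos (p : ℝ[X]) (θ : ℝ) :
    HasDerivAt (fun θ => p.eval (cos θ)) (-sin θ * (derivative p).eval (cos θ)) θ :=
  ((p.hasDerivAt (cos θ)).comp θ (hasDerivAt_cos θ)).congr_deriv (by ring)

theorem angularWeight_sq (hα : -1 < α) (hβ : -1 < β) (hθ : θ ∈ Set.Icc 0 π) :
    angularWeight α β θ ^ 2 = chebyshevRatio α β (cos θ) := by
  have hsin : 0 ≤ sin (θ / 2) :=
    sin_nonneg_of_nonneg_of_le_pi (by linarith [hθ.1]) (by linarith [hθ.1, hθ.2])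
  have hcos : 0 ≤ cos (θ / 2) :=
    cos_nonneg_of_mem_Icc ⟨by linarith [hθ.1, hθ.2], by linarith [hθ.2]⟩
  have hconst := normConst_pos hα hβ
  have one_sub_cos : 1 - cos θ = 2 * sin (θ / 2) ^ 2 := by
    rw [cos_eq_one_sub_sin_half_sq]; ring
  have one_add_cos : 1 + cos θ = 2 * cos (θ / 2) ^ 2 := by
    rw [cos_eq_one_sub_sin_half_sq, cos_sq']; ring
  have two_mul_sq_rpow {y : ℝ} (s : ℝ) (hy : 0 ≤ y) : (2 * y ^ 2) ^ s = 2 ^ s * (y ^ s) ^ 2 := by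
    rw [mul_rpow two_pos.le (by positivity), ← rpow_pow_comm hy]
  have two_rpow : (2 : ℝ) ^ (α + β + 1) = 2 ^ (α + 1 / 2) * 2 ^ (β + 1 / 2) := by
    rw [← rpow_add two_pos]; congr 1; ring
  rw [angularWeight, chebyshevRatio, one_sub_cos, one_add_cos, two_mul_sq_rpow _ hsin,
    two_mul_sq_rpow _ hcos, mul_pow, mul_pow, sq_sqrt (by positivity), two_rpow]
  ring

theorem continuous_angularWeight (hα : -1 / 2 ≤ α) (hβ : -1 / 2 ≤ β) :
    Continuous (angularWeight α β) := by
  refine continuous_const.mul (Continuous.mul ?_ ?_)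
  · exact (by fun_prop : Continuous fun θ : ℝ => sin (θ / 2)).rpow_const
      fun _ => Or.inr (by linarith)
  · exact (by fun_prop : Continuous fun θ : ℝ => cos (θ / 2)).rpow_const
      fun _ => Or.inr (by linarith)

theorem hasDerivAt_angularWeight (α β : ℝ) (hθ : θ ∈ Set.Ioo 0 π) :
    HasDerivAt (angularWeight α β) (angularWeight α β θ * angularLogDeriv α β θ) θ := by
  have hsin := (sin_half_pos hθ).ne'
  have hcos := (cos_half_pos hθ).ne'
  refine ((((hasDerivAt_sin_half θ).rpow_const (p := α + 1 / 2) (Or.inl hsin)).mul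
    ((hasDerivAt_cos_half θ).rpow_const (p := β + 1 / 2) (Or.inl hcos))).const_mul _).congr_deriv ?_
  rw [angularWeight, angularLogDeriv, rpow_sub_one hsin, rpow_sub_one hcos]
  field_simp
  ring

theorem hasDerivAt_angularLogDeriv (α β : ℝ) (hθ : θ ∈ Set.Ioo 0 π) :
    HasDerivAt (angularLogDeriv α β) (-(α + 1 / 2) / (4 * sin (θ / 2) ^ 2) -
      (β + 1 / 2) / (4 * cos (θ / 2) ^ 2)) θ := by
  have hsin := (sin_half_pos hθ).ne'
  have hcos := (cos_half_pos hθ).ne'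
  have dsin := hasDerivAt_sin_half θ
  have dcos := hasDerivAt_cos_half θ
  refine (((dcos.const_mul (α + 1 / 2)).div (dsin.const_mul 2) (by positivity)).sub
    ((dsin.const_mul (β + 1 / 2)).div (dcos.const_mul 2) (by positivity))).congr_deriv ?_
  field_simp
  linear_combination (-4 * (α * 2 + 1) * cos (θ / 2) ^ 2 -
    4 * (β * 2 + 1) * sin (θ / 2) ^ 2) * sin_sq_add_cos_sq (θ / 2)

theorem two_mul_angularLogDeriv_mul_sin (α β : ℝ) (hθ : θ ∈ Set.Ioo 0 π) :
    2 * angularLogDeriv α β θ * sin θ = (α - β) + (α + β + 1) * cos θ := by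
  have hsin := (sin_half_pos hθ).ne'
  have hcos := (cos_half_pos hθ).ne'
  rw [angularLogDeriv, sin_eq_sin_half_mul_cos_half θ, cos_eq_one_sub_sin_half_sq θ]
  field_simp
  linear_combination (2 * α + 1) * sin_sq_add_cos_sq (θ / 2)

theorem angularLogDeriv_sq_add_liouvillePotential (α β ν : ℝ) (hθ : θ ∈ Set.Ioo 0 π) :
    angularLogDeriv α β θ ^ 2 + liouvillePotential α β ν θ = ν ^ 2 - (α + β + 1) ^ 2 / 4 +
      (α + 1 / 2) / (4 * sin (θ / 2) ^ 2) + (β + 1 / 2) / (4 * cos (θ / 2) ^ 2) := by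
  have hsin := (sin_half_pos hθ).ne'
  have hcos := (cos_half_pos hθ).ne'
  have logDeriv_sq : angularLogDeriv α β θ ^ 2 =
      (α + 1 / 2) ^ 2 * cos (θ / 2) ^ 2 / (4 * sin (θ / 2) ^ 2) -
      (α + 1 / 2) * (β + 1 / 2) / 2 +
      (β + 1 / 2) ^ 2 * sin (θ / 2) ^ 2 / (4 * cos (θ / 2) ^ 2) := by
    rw [angularLogDeriv]
    field_simp
    ring
  have hsin_sq : sin (θ / 2) ^ 2 ≠ 0 := pow_ne_zero 2 hsin
  have hcos_sq : cos (θ / 2) ^ 2 ≠ 0 := pow_ne_zero 2 hcos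
  rw [logDeriv_sq, liouvillePotential]
  rw [sin_sq] at hsin_sq ⊢
  generalize cos (θ / 2) ^ 2 = c at *
  field_simp
  ring

theorem hasDerivAt_liouvillePotential (α β ν : ℝ) (hθ : θ ∈ Set.Ioo 0 π) :
    HasDerivAt (liouvillePotential α β ν) (liouvillePotentialDeriv α β θ) θ := by
  have hsin := (sin_half_pos hθ).ne'
  have hcos := (cos_half_pos hθ).ne'
  refine ((((hasDerivAt_const θ ((α ^ 2 - 1 / 4) / 4)).fun_div
    ((hasDerivAt_sin_half θ).fun_pow 2) (pow_ne_zero 2 hsin)).const_sub (ν ^ 2)).fun_sub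
    ((hasDerivAt_const θ ((β ^ 2 - 1 / 4) / 4)).fun_div
      ((hasDerivAt_cos_half θ).fun_pow 2) (pow_ne_zero 2 hcos))).congr_deriv ?_
  rw [liouvillePotentialDeriv]
  field_simp
  push_cast
  ring

theorem continuous_liouvilleFun (hα : -1 / 2 ≤ α) (hβ : -1 / 2 ≤ β) (p : ℝ[X]) :
    Continuous (liouvilleFun α β p) :=
  (continuous_angularWeight hα hβ).mul (p.continuous.comp continuous_cos)

theorem liouvilleFun_zero (hα : α ≠ -1 / 2) (p : ℝ[X]) : liouvilleFun α β p 0 = 0 := by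
  simp only [liouvilleFun, angularWeight, zero_div, sin_zero]
  rw [zero_rpow fun h => hα (by linarith), zero_mul, mul_zero, zero_mul]

theorem liouvilleFun_sq (hα : -1 < α) (hβ : -1 < β) (p : ℝ[X]) (hθ : θ ∈ Set.Icc 0 π) :
    liouvilleFun α β p θ ^ 2 = chebyshevRatio α β (cos θ) * p.eval (cos θ) ^ 2 := by
  rw [liouvilleFun, mul_pow, angularWeight_sq hα hβ hθ]

theorem hasDerivAt_liouvilleFun (α β : ℝ) (p : ℝ[X]) (hθ : θ ∈ Set.Ioo 0 π) :
    HasDerivAt (liouvilleFun α β p) (liouvilleFunDeriv α β p θ) θ := by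
  refine ((hasDerivAt_angularWeight α β hθ).mul (hasDerivAt_eval_cos p θ)).congr_deriv ?_
  rw [liouvilleFunDeriv]
  ring

theorem IsJacobiBasis.hasDerivAt_liouvilleFunDeriv (h : IsJacobiBasis α β p)
    (hα : -1 < α) (hβ : -1 < β) (n : ℕ) (hθ : θ ∈ Set.Ioo 0 π) :
    HasDerivAt (liouvilleFunDeriv α β (p n))
      (-liouvillePotential α β (jacobiFrequency α β n) θ * liouvilleFun α β (p n) θ) θ := by
  have hode := congrArg (eval (cos θ)) (h.jacobiOperator_eq hα hβ n)
  simp only [jacobiOperator, eval_add, eval_mul, eval_sub, eval_one, eval_pow, eval_X, eval_C,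
    eval_neg] at hode
  refine ((hasDerivAt_angularWeight α β hθ).fun_mul
    (((hasDerivAt_angularLogDeriv α β hθ).fun_mul (hasDerivAt_eval_cos (p n) θ)).fun_sub
      ((hasDerivAt_sin θ).fun_mul (hasDerivAt_eval_cos (derivative (p n)) θ)))).congr_deriv ?_
  have hlog := two_mul_angularLogDeriv_mul_sin α β hθ
  have hpot : angularLogDeriv α β θ ^ 2 + (-(α + 1 / 2) / (4 * sin (θ / 2) ^ 2) -
      (β + 1 / 2) / (4 * cos (θ / 2) ^ 2)) - n * (n + α + β + 1) =
      -liouvillePotential α β (jacobiFrequency α β n) θ := by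
    have := angularLogDeriv_sq_add_liouvillePotential α β (jacobiFrequency α β n) hθ
    rw [jacobiFrequency] at this ⊢
    linear_combination this
  rw [← hpot, liouvilleFun]
  set w := angularWeight α β θ
  linear_combination w * hode - w * (derivative (p n)).eval (cos θ) * hlog +
    w * (derivative (derivative (p n))).eval (cos θ) * sin_sq θ

theorem IsJacobiBasis.isSturmSolution_liouvilleFun (h : IsJacobiBasis α β p)
    (hα : -1 < α) (hβ : -1 < β) (n : ℕ) :
    IsSturmSolution (liouvilleFun α β (p n)) (liouvilleFunDeriv α β (p n))
      (liouvillePotential α β (jacobiFrequency α β n)) (liouvillePotentialDeriv α β)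
      (Set.Ioo 0 π) :=
  ⟨fun _ hθ => hasDerivAt_liouvilleFun α β (p n) hθ,
    fun _ hθ => h.hasDerivAt_liouvilleFunDeriv hα hβ n hθ,
    fun _ hθ => hasDerivAt_liouvillePotential α β _ hθ⟩

theorem sin_mul_sub_cos_mul_angularLogDeriv (α β : ℝ) (n : ℕ) (hθ : θ ∈ Set.Ioo 0 π) :
    sin θ * (angularLogDeriv α β θ ^ 2 + liouvillePotential α β (jacobiFrequency α β n) θ -
      jacobiFrequency α β n) - cos θ * angularLogDeriv α β θ = sin θ * (n * (n + α + β)) := by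
  refine mul_left_cancel₀ (sin_pos_of_mem_Ioo hθ).ne' ?_
  have hsin_sq := pow_ne_zero 2 (sin_half_pos hθ).ne'
  have hcos_sq := pow_ne_zero 2 (cos_half_pos hθ).ne'
  have hlog : sin θ * angularLogDeriv α β θ = ((α - β) + (α + β + 1) * cos θ) / 2 := by
    linarith [two_mul_angularLogDeriv_mul_sin α β hθ]
  rw [angularLogDeriv_sq_add_liouvillePotential α β _ hθ, mul_sub, mul_left_comm _ (cos θ), hlog,
    ← mul_assoc, ← mul_assoc, ← sq, sin_eq_sin_half_mul_cos_half θ, cos_eq_one_sub_sin_half_sq θ,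
    mul_pow, mul_pow, jacobiFrequency]
  rw [sin_sq] at hsin_sq ⊢
  generalize cos (θ / 2) ^ 2 = c at *
  field_simp
  ring

-- The Christoffel–Darboux identity in the variable `θ`: the kernel is an energy of `√(ρ / ρ_c) pₙ`.
theorem IsJacobiBasis.energy_liouvilleFun_eq (h : IsJacobiBasis α β p)
    (hα : -1 < α) (hβ : -1 < β) (n : ℕ) (hθ : θ ∈ Set.Ioo 0 π) :
    let ν := jacobiFrequency α β (n + 1)
    let u := liouvilleFun α β (p (n + 1)) θ
    let u' := liouvilleFunDeriv α β (p (n + 1)) θ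
    sin θ * (u' ^ 2 + (liouvillePotential α β ν θ - ν) * u ^ 2) - cos θ * (u * u') =
      sin θ * (2 * ν * (angularWeight α β θ ^ 2 *
        ∑ k ∈ Finset.range (n + 1), (p k).eval (cos θ) ^ 2)) := by
  intro ν u u'
  have hker := congrArg (eval (cos θ)) (h.sum_sq_eq hα hβ n)
  simp only [eval_add, eval_mul, eval_sub, eval_one, eval_pow, eval_X, eval_C,
    eval_finsetSum] at hker
  have hlog := two_mul_angularLogDeriv_mul_sin α β hθ
  have hpot := sin_mul_sub_cos_mul_angularLogDeriv α β (n + 1) hθ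
  have hν : ν = n + 1 + (α + β + 1) / 2 := by simp [ν, jacobiFrequency]
  have hu : u = angularWeight α β θ * (p (n + 1)).eval (cos θ) := rfl
  have hu' : u' = angularWeight α β θ * (angularLogDeriv α β θ * (p (n + 1)).eval (cos θ) -
    sin θ * (derivative (p (n + 1))).eval (cos θ)) := rfl
  change sin θ * (_ + liouvillePotential α β ν θ - ν) - _ = _ at hpot
  rw [hν] at hpot ⊢
  rw [hu, hu']
  push_cast at hpot
  set w := angularWeight α β θ
  set y := (p (n + 1)).eval (cos θ)
  set y' := (derivative (p (n + 1))).eval (cos θ)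
  linear_combination w ^ 2 * y ^ 2 * hpot - w ^ 2 * sin θ * hker -
    w ^ 2 * sin θ * y * y' * hlog + w ^ 2 * sin θ * y' ^ 2 * sin_sq θ

theorem normConst_comm (α β : ℝ) : normConst β α = normConst α β := by
  rw [normConst, normConst, add_comm β α, mul_comm (Real.Gamma (α + 1))]

theorem density_neg (α β x : ℝ) : density β α (-x) = density α β x := by
  rw [density, density, normConst_comm, sub_neg_eq_add, ← sub_eq_add_neg]
  ring

theorem chebyshevRatio_neg (α β x : ℝ) : chebyshevRatio β α (-x) = chebyshevRatio α β x := by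
  rw [chebyshevRatio, chebyshevRatio, normConst_comm, sub_neg_eq_add, ← sub_eq_add_neg,
    mul_comm ((1 + x) ^ _)]

theorem IsJacobiBasis.comp_neg (h : IsJacobiBasis α β p) :
    IsJacobiBasis β α (fun n => (p n).comp (-X)) where
  degree_eq n := by
    have hne : (p n).comp (-X) ≠ 0 := by
      intro h0
      have := h.degree_eq n
      simp [comp_neg_X_eq_zero_iff.1 h0] at this
    rw [degree_eq_natDegree hne, natDegree_comp, natDegree_neg, natDegree_X, mul_one,
      natDegree_eq_of_degree_eq_some (h.degree_eq n)]
  orthonormal n m := by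
    rw [← h.orthonormal n m]
    have hreflect := intervalIntegral.integral_comp_neg (a := (-1 : ℝ)) (b := 1)
      (fun x => (p n).eval x * (p m).eval x * density α β x)
    rw [neg_neg] at hreflect
    rw [← hreflect]
    refine intervalIntegral.integral_congr fun x _ => ?_
    simp only [eval_comp, eval_neg, eval_X]
    rw [← density_neg α β (-x), neg_neg]

end LiouvilleNormalForm

section UniformBound

open Real

variable {α β θ T : ℝ} {p : ℕ → ℝ[X]}

theorem frequently_deriv_nonpos_of_isMaxOn_left {f f' : ℝ → ℝ} {a b : ℝ} (hab : a < b)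
    (hf : ContinuousOn f (Set.Icc a b)) (hf' : ∀ x ∈ Set.Ioo a b, HasDerivAt f (f' x) x)
    (hmax : IsMaxOn f (Set.Icc a b) a) : ∃ᶠ x in nhdsWithin a (Set.Ioi a), f' x ≤ 0 := by
  intro hpos
  obtain ⟨c, hac, hc⟩ := (mem_nhdsGT_iff_exists_Ioo_subset' hab).1
    (Filter.inter_mem hpos (Ioo_mem_nhdsGT hab))
  have hcb : Set.Ioo a c ⊆ Set.Ioo a b := fun x hx => (hc hx).2
  obtain ⟨e, hae, hec⟩ := exists_between (show a < c from hac)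
  have heb : e < b := (hcb ⟨hae, hec⟩).2
  obtain ⟨x, hx, hslope⟩ := exists_hasDerivAt_eq_slope f f' hae
    (hf.mono (Set.Icc_subset_Icc_right heb.le))
    fun x hx => hf' x ⟨hx.1, hx.2.trans heb⟩
  have : f e ≤ f a := hmax ⟨hae.le, heb.le⟩
  have : f' x ≤ 0 := hslope ▸ div_nonpos_of_nonpos_of_nonneg (by linarith) (by linarith)
  exact (hc ⟨hx.1, hx.2.trans hec⟩).1 this

theorem sin_half_sq_le (h0 : 0 ≤ θ) (h1 : θ ≤ π / 2) : sin (θ / 2) ^ 2 ≤ 1 / 2 := by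
  have := cos_eq_one_sub_sin_half_sq θ
  have := cos_nonneg_of_mem_Icc (x := θ) ⟨by linarith [pi_pos], h1⟩
  linarith

theorem le_liouvillePotential_of_sq_le {ν : ℝ} (hα : α ^ 2 ≤ 1 / 4)
    (hν : 4 * (α ^ 2 + β ^ 2) ≤ ν ^ 2) (hθ : θ ∈ Set.Ioc 0 (π / 2)) :
    7 / 8 * ν ^ 2 ≤ liouvillePotential α β ν θ := by
  have hθ' : θ ∈ Set.Ioo 0 π := ⟨hθ.1, by linarith [hθ.2, pi_pos]⟩
  have hsin := sin_half_pos hθ'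
  have hcos := cos_half_pos hθ'
  have left_term : (α ^ 2 - 1 / 4) / 4 / sin (θ / 2) ^ 2 ≤ 0 :=
    div_nonpos_of_nonpos_of_nonneg (by linarith) (by positivity)
  have right_term : (β ^ 2 - 1 / 4) / 4 / cos (θ / 2) ^ 2 ≤ β ^ 2 / 2 := by
    rw [div_le_iff₀ (by positivity)]
    nlinarith [sq_nonneg β, sin_half_sq_le hθ.1.le hθ.2, sin_sq_add_cos_sq (θ / 2)]
  rw [liouvillePotential]
  linarith [sq_nonneg α]

theorem liouvillePotentialDeriv_ge {b : ℝ} (hα : 1 / 4 ≤ α ^ 2) (hb : (β ^ 2 - 1 / 4) / 4 ≤ b)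
    (hb0 : 0 ≤ b) (hθ : 0 < θ) (hθT : θ ≤ T) (hT : T < π) :
    (α ^ 2 - 1 / 4) / 4 * cos (T / 2) / sin (T / 2) ^ 3 - b * sin (T / 2) / cos (T / 2) ^ 3 ≤
      liouvillePotentialDeriv α β θ := by
  have hsinθ := sin_half_pos ⟨hθ, hθT.trans_lt hT⟩
  have hcosθ := cos_half_pos ⟨hθ, hθT.trans_lt hT⟩
  have hsinT := sin_half_pos ⟨hθ.trans_le hθT, hT⟩
  have hcosT := cos_half_pos ⟨hθ.trans_le hθT, hT⟩
  have hsin : sin (θ / 2) ≤ sin (T / 2) :=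
    sin_le_sin_of_le_of_le_pi_div_two (by linarith) (by linarith) (by linarith)
  have hcos : cos (T / 2) ≤ cos (θ / 2) :=
    cos_le_cos_of_nonneg_of_le_pi (by linarith) (by linarith) (by linarith)
  have : 0 ≤ (α ^ 2 - 1 / 4) / 4 := by linarith
  refine sub_le_sub (by gcongr) ?_
  calc _ ≤ b * sin (θ / 2) / cos (θ / 2) ^ 3 := by gcongr
    _ ≤ _ := by gcongr

theorem sub_potential_le_slope {ν a b b' q S C : ℝ} (hν : 0 < ν) (ha : 0 ≤ a) (hb : b ≤ b')
    (hb' : 0 ≤ b') (hab : 16 * (a + b') ≤ ν ^ 2) (hS : 0 < S) (hC : 0 < C)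
    (hSC : S ^ 2 + C ^ 2 = 1) (hS2 : S ^ 2 ≤ 1 / 2) (hq : q = ν ^ 2 - a / S ^ 2 - b / C ^ 2)
    (hqν : 2 * q ≤ ν ^ 2) :
    5 / 6 ≤ C ^ 2 ∧ 91 / 100 * ν ^ 2 - q ≤ a / S ^ 2 - b' * S ^ 2 / C ^ 4 := by
  have hbC : b / C ^ 2 ≤ b' / C ^ 2 := by gcongr
  have hb'C : b' / C ^ 2 ≤ 2 * b' := by
    rw [div_le_iff₀ (by positivity)]
    nlinarith
  have haS : 3 / 8 * ν ^ 2 ≤ a / S ^ 2 := by linarith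
  have hC2 : 5 / 6 ≤ C ^ 2 := by
    rw [le_div_iff₀ (by positivity)] at haS
    have : 3 / 8 * S ^ 2 ≤ 1 / 16 := le_of_mul_le_mul_left (by linarith) (pow_pos hν 2)
    linarith
  have hb'C4 : b' / C ^ 4 ≤ 9 / 100 * ν ^ 2 := by
    have : (5 / 6) ^ 2 ≤ (C ^ 2) ^ 2 := by gcongr
    rw [div_le_iff₀ (by positivity)]
    nlinarith
  have split_b' : b' / C ^ 2 + b' * S ^ 2 / C ^ 4 = b' / C ^ 4 := by
    rw [eq_sub_of_add_eq hSC]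
    field_simp
    ring
  exact ⟨hC2, by linarith⟩

theorem mul_pow_three_le_slope_sq_mul {a b S C D : ℝ} (hb : 0 ≤ b) (hS : 0 < S)
    (hC : 0 < C) (hC2 : 5 / 6 ≤ C ^ 2) (hD : 0 ≤ D) (hDle : D ≤ a / S ^ 2 - b * S ^ 2 / C ^ 4) :
    0 ≤ a * C / S ^ 3 - b * S / C ^ 3 ∧
      5 / 6 * D ^ 3 ≤ (a * C / S ^ 3 - b * S / C ^ 3) ^ 2 * a := by
  set L := a * C / S ^ 3 - b * S / C ^ 3 with hL
  have hLS : L * S = C * (a / S ^ 2 - b * S ^ 2 / C ^ 4) := by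
    rw [hL]; field_simp
  have hCD : C * D ≤ L * S := by rw [hLS]; gcongr
  have hDa : D ≤ a / S ^ 2 := hDle.trans (sub_le_self _ (by positivity))
  refine ⟨nonneg_of_mul_nonneg_left ((mul_nonneg hC.le hD).trans hCD) hS, ?_⟩
  calc 5 / 6 * D ^ 3 = 5 / 6 * D ^ 2 * D := by ring
    _ ≤ C ^ 2 * D ^ 2 * (a / S ^ 2) := by gcongr
    _ = (C * D) ^ 2 * (a / S ^ 2) := by ring
    _ ≤ (L * S) ^ 2 * (a / S ^ 2) := by
        have := hD.trans hDa
        gcongr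
    _ = L ^ 2 * a := by field_simp

theorem pow_three_lt_of_mul_pow_three_le {A ν a q L : ℝ} (hA : 0 ≤ A) (ha : 4 * a ≤ A ^ 2)
    (hqν : q * (2 + A) < ν ^ 2) (hD : 0 < 91 / 100 * ν ^ 2 - q)
    (hL : 5 / 6 * (91 / 100 * ν ^ 2 - q) ^ 3 ≤ L ^ 2 * a) : q ^ 3 < 4 / 9 * L ^ 2 := by
  by_contra! hLq
  have hLA : 5 / 6 * (91 / 100 * ν ^ 2 - q) ^ 3 ≤ L ^ 2 * (A ^ 2 / 4) :=
    hL.trans (by gcongr; linarith)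
  have hq : 0 < q := by
    refine (Odd.pow_pos_iff (by decide : Odd 3)).1 (lt_of_lt_of_le ?_ hLq)
    have : 0 < L ^ 2 * (A ^ 2 / 4) := lt_of_lt_of_le (by positivity) hLA
    linarith [pos_of_mul_pos_left this (by positivity)]
  have hqD : q * (82 / 100 + 91 / 100 * A) ≤ 91 / 100 * ν ^ 2 - q := by linarith
  have hqA : 10 / 27 * (q * (82 / 100 + 91 / 100 * A)) ^ 3 ≤ q ^ 3 * (A ^ 2 / 4) := by
    calc _ ≤ 4 / 9 * (5 / 6 * (91 / 100 * ν ^ 2 - q) ^ 3) := by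
          linarith [pow_le_pow_left₀ (by positivity) hqD 3]
      _ ≤ 4 / 9 * L ^ 2 * (A ^ 2 / 4) := by linarith
      _ ≤ _ := by gcongr
  have hcubic : 10 / 27 * (82 / 100 + 91 / 100 * A) ^ 3 ≤ A ^ 2 / 4 :=
    le_of_mul_le_mul_left (by rw [mul_pow] at hqA; linarith) (pow_pos hq 3)
  ring_nf at hcubic
  linarith [pow_nonneg hA 3, pow_nonneg hA 2]

theorem pow_three_lt_slope_sq {A ν a b b' q S C : ℝ} (hA : 0 ≤ A) (hν : 2 * A < ν)
    (ha : 0 ≤ a) (hb : b ≤ b') (hb' : 0 ≤ b') (hab : 4 * (a + b') ≤ A ^ 2)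
    (hS : 0 < S) (hC : 0 < C) (hSC : S ^ 2 + C ^ 2 = 1) (hS2 : S ^ 2 ≤ 1 / 2)
    (hq : q = ν ^ 2 - a / S ^ 2 - b / C ^ 2) (hqν : q * (2 + A) < ν ^ 2) :
    0 ≤ a * C / S ^ 3 - b' * S / C ^ 3 ∧
      q ^ 3 < 4 / 9 * (a * C / S ^ 3 - b' * S / C ^ 3) ^ 2 := by
  have hν0 : 0 < ν := by linarith
  have hAν : (2 * A) ^ 2 ≤ ν ^ 2 := by gcongr
  have hq2 : 2 * q ≤ ν ^ 2 := by
    rcases le_total q 0 with hq0 | hq0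
    · linarith [sq_nonneg ν]
    · linarith [mul_nonneg hq0 hA]
  have hD : 0 < 91 / 100 * ν ^ 2 - q := by linarith [pow_pos hν0 2]
  obtain ⟨hC2, hDle⟩ := sub_potential_le_slope hν0 ha hb hb' (by linarith) hS hC hSC hS2 hq hq2
  obtain ⟨hL, hLD⟩ := mul_pow_three_le_slope_sq_mul hb' hS hC hC2 hD.le hDle
  exact ⟨hL, pow_three_lt_of_mul_pow_three_le hA (by linarith) hqν hD hLD⟩

theorem jacobiFrequency_succ_pos (hα : -1 / 2 ≤ α) (hβ : -1 / 2 ≤ β) (n : ℕ) :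
    0 < jacobiFrequency α β (n + 1) := by
  have : (0 : ℝ) ≤ n := n.cast_nonneg
  rw [jacobiFrequency]
  push_cast
  linarith

theorem IsJacobiBasis.potential_add_mul_liouvilleFun_sq_le (h : IsJacobiBasis α β p)
    (hα : -1 / 2 ≤ α) (hβ : -1 / 2 ≤ β) (n : ℕ) (hθ : θ ∈ Set.Ioo 0 π)
    (hle : cos θ * (liouvilleFun α β (p (n + 1)) θ * liouvilleFunDeriv α β (p (n + 1)) θ) ≤ 0) :
    let ν := jacobiFrequency α β (n + 1)
    (liouvillePotential α β ν θ + ν) * liouvilleFun α β (p (n + 1)) θ ^ 2 ≤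
      2 * ν * (exp 1 * (ν + 1 / 2)) := by
  intro ν
  have hsin := sin_pos_of_mem_Ioo hθ
  have henergy := h.energy_liouvilleFun_eq (by linarith) (by linarith) n hθ
  dsimp only at henergy
  have hkernel := h.chebyshevRatio_mul_sum_sq_le hα hβ (n + 1) (x := cos θ)
    ⟨neg_one_le_cos θ, cos_le_one θ⟩
  rw [← angularWeight_sq (by linarith) (by linarith) (Set.Ioo_subset_Icc_self hθ),
    Finset.sum_range_succ, mul_add, ← mul_pow] at hkernel
  have hν : (↑(n + 1) : ℝ) + (α + β) / 2 + 1 = ν + 1 / 2 := by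
    simp only [ν, jacobiFrequency]; ring
  rw [hν] at hkernel
  change sin θ * (_ + (_ - ν) * _) - _ = sin θ * (2 * ν * _) at henergy
  set u := liouvilleFun α β (p (n + 1)) θ
  set K := angularWeight α β θ ^ 2 * ∑ k ∈ Finset.range (n + 1), (p k).eval (cos θ) ^ 2
  have hlow : (liouvillePotential α β ν θ - ν) * u ^ 2 ≤ 2 * ν * K := by
    refine le_of_mul_le_mul_left ?_ hsin
    nlinarith [mul_nonneg hsin.le (sq_nonneg (liouvilleFunDeriv α β (p (n + 1)) θ))]
  have hup : 2 * ν * (K + u ^ 2) ≤ 2 * ν * (exp 1 * (ν + 1 / 2)) :=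
    mul_le_mul_of_nonneg_left hkernel
      (mul_nonneg two_pos.le (jacobiFrequency_succ_pos hα hβ n).le)
  linarith

theorem IsJacobiBasis.energy_liouvilleFun_nonneg (h : IsJacobiBasis α β p)
    (hα : -1 / 2 ≤ α) (hβ : -1 / 2 ≤ β) (n : ℕ) (hθ : θ ∈ Set.Ioo 0 π)
    (hle : 0 ≤ cos θ * (liouvilleFun α β (p (n + 1)) θ * liouvilleFunDeriv α β (p (n + 1)) θ)) :
    0 ≤ liouvilleFunDeriv α β (p (n + 1)) θ ^ 2 +
      liouvillePotential α β (jacobiFrequency α β (n + 1)) θ *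
        liouvilleFun α β (p (n + 1)) θ ^ 2 := by
  have henergy := h.energy_liouvilleFun_eq (by linarith) (by linarith) n hθ
  dsimp only at henergy
  have hν := jacobiFrequency_succ_pos hα hβ n
  have hsin := sin_pos_of_mem_Ioo hθ
  set ν := jacobiFrequency α β (n + 1)
  set u := liouvilleFun α β (p (n + 1)) θ
  have hkernel : 0 ≤ sin θ * (2 * ν * (angularWeight α β θ ^ 2 *
      ∑ k ∈ Finset.range (n + 1), (p k).eval (cos θ) ^ 2)) := by
    have := Finset.sum_nonneg fun k (_ : k ∈ Finset.range (n + 1)) => sq_nonneg ((p k).eval (cos θ))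
    positivity
  have := nonneg_of_mul_nonneg_right (by linarith : 0 ≤ sin θ * (liouvilleFunDeriv α β
    (p (n + 1)) θ ^ 2 + (liouvillePotential α β ν θ - ν) * u ^ 2)) hsin
  linarith [mul_nonneg hν.le (sq_nonneg u)]

theorem le_of_potential_add_mul_le {ν q y : ℝ} (hν : 0 < ν) (hq : 7 / 8 * ν ^ 2 ≤ q) (hy : 0 ≤ y)
    (h : (q + ν) * y ≤ 2 * ν * (exp 1 * (ν + 1 / 2))) : y ≤ 2 * exp 1 * 2 := by
  have hlow : (7 / 8 * ν ^ 2 + ν) * y ≤ 2 * ν * (exp 1 * (ν + 1 / 2)) :=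
    le_trans (by gcongr) h
  have hdiv : (7 / 8 * ν + 1) * y ≤ (ν + 1 / 2) * (2 * exp 1) :=
    le_of_mul_le_mul_left (by linarith) hν
  refine le_of_mul_le_mul_left (hdiv.trans ?_) (by positivity : 0 < 7 / 8 * ν + 1)
  nlinarith [exp_pos 1]

theorem potential_mul_lt_of_lt {A ν q y : ℝ} (hA : 0 ≤ A) (hν : 7 / 2 + 2 * A < ν)
    (hy : 2 * exp 1 * (2 + A) < y) (h : (q + ν) * y ≤ 2 * ν * (exp 1 * (ν + 1 / 2))) :
    q * (2 + A) < ν ^ 2 := by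
  rcases le_or_gt (q + ν) 0 with hq | hq
  · nlinarith
  · have hlow : (q + ν) * (2 * exp 1 * (2 + A)) ≤ 2 * ν * (exp 1 * (ν + 1 / 2)) :=
      le_trans (by gcongr) h
    have hdiv : (q + ν) * (2 + A) ≤ ν * (ν + 1 / 2) :=
      le_of_mul_le_mul_left (by linarith) (by positivity : 0 < 2 * exp 1)
    nlinarith

theorem liouvilleFunDeriv_eq_zero_of_isMaxOn {q : ℝ[X]} (hT : T ∈ Set.Ioo 0 π)
    (hmax : IsMaxOn (fun θ => liouvilleFun α β q θ ^ 2) (Set.Icc 0 π) T)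
    (hne : liouvilleFun α β q T ≠ 0) : liouvilleFunDeriv α β q T = 0 := by
  simpa [hne] using (hmax.isLocalMax (Icc_mem_nhds hT.1 hT.2)).hasDerivAt_eq_zero
    ((hasDerivAt_liouvilleFun α β q hT).fun_pow 2)

theorem chebyshevRatio_nonneg (hα : -1 < α) (hβ : -1 < β) {x : ℝ} (hx : x ∈ Set.Icc (-1 : ℝ) 1) :
    0 ≤ chebyshevRatio α β x := by
  have := normConst_pos hα hβ
  have := sub_nonneg.2 hx.2
  have : 0 ≤ 1 + x := by linarith [hx.1]
  rw [chebyshevRatio]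
  positivity

theorem exists_isMaxOn_liouvilleFun_sq (hα : -1 / 2 ≤ α) (hβ : -1 / 2 ≤ β) (q : ℝ[X]) {x : ℝ}
    (hx : x ∈ Set.Icc (-1 : ℝ) 1) :
    ∃ T ∈ Set.Icc 0 π, IsMaxOn (fun θ => liouvilleFun α β q θ ^ 2) (Set.Icc 0 π) T ∧
      chebyshevRatio α β x * q.eval x ^ 2 ≤ liouvilleFun α β q T ^ 2 := by
  obtain ⟨T, hT, hmax⟩ := isCompact_Icc.exists_isMaxOn (s := Set.Icc 0 π) ⟨0, le_rfl, pi_pos.le⟩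
    ((continuous_liouvilleFun hα hβ q).pow 2).continuousOn
  refine ⟨T, hT, hmax, ?_⟩
  have hmem : arccos x ∈ Set.Icc 0 π := ⟨arccos_nonneg x, arccos_le_pi x⟩
  have : liouvilleFun α β q (arccos x) ^ 2 ≤ _ := hmax hmem
  rwa [liouvilleFun_sq (by linarith) (by linarith) _ hmem, cos_arccos hx.1 hx.2] at this

variable (h : IsJacobiBasis α β p) (hα : -1 / 2 ≤ α) (hβ : -1 / 2 ≤ β) (n : ℕ)
  (hlarge : 7 / 2 + 2 * √(α ^ 2 + β ^ 2) < jacobiFrequency α β (n + 1))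

include h hα hβ hlarge

theorem IsJacobiBasis.liouvilleFun_sq_le_of_mul_deriv_nonpos (hα2 : α ^ 2 ≤ 1 / 4)
    (hθ : θ ∈ Set.Ioc 0 (π / 2))
    (hle : liouvilleFun α β (p (n + 1)) θ * liouvilleFunDeriv α β (p (n + 1)) θ ≤ 0) :
    liouvilleFun α β (p (n + 1)) θ ^ 2 ≤ 2 * exp 1 * 2 := by
  have hcos : 0 ≤ cos θ := cos_nonneg_of_mem_Icc ⟨by linarith [hθ.1, pi_pos], hθ.2⟩
  have hν : 4 * (α ^ 2 + β ^ 2) ≤ jacobiFrequency α β (n + 1) ^ 2 := by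
    have := sqrt_nonneg (α ^ 2 + β ^ 2)
    calc 4 * (α ^ 2 + β ^ 2) = (2 * √(α ^ 2 + β ^ 2)) ^ 2 := by
          rw [mul_pow, sq_sqrt (by positivity)]; norm_num
      _ ≤ _ := by gcongr; linarith
  exact le_of_potential_add_mul_le (jacobiFrequency_succ_pos hα hβ n)
    (le_liouvillePotential_of_sq_le hα2 hν hθ) (sq_nonneg _)
    (h.potential_add_mul_liouvilleFun_sq_le hα hβ n ⟨hθ.1, by linarith [hθ.2, pi_pos]⟩
      (mul_nonpos_of_nonneg_of_nonpos hcos hle))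

theorem IsJacobiBasis.liouvilleFun_zero_sq_le (hα2 : α ^ 2 ≤ 1 / 4)
    (hmax : IsMaxOn (fun θ => liouvilleFun α β (p (n + 1)) θ ^ 2) (Set.Icc 0 π) 0) :
    liouvilleFun α β (p (n + 1)) 0 ^ 2 ≤ 2 * exp 1 * 2 := by
  have hcont : Continuous fun θ => liouvilleFun α β (p (n + 1)) θ ^ 2 :=
    (continuous_liouvilleFun hα hβ _).pow 2
  have hderiv : ∀ θ ∈ Set.Ioo 0 π, HasDerivAt (fun θ => liouvilleFun α β (p (n + 1)) θ ^ 2)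
      (2 * (liouvilleFun α β (p (n + 1)) θ * liouvilleFunDeriv α β (p (n + 1)) θ)) θ :=
    fun θ hθ => ((hasDerivAt_liouvilleFun α β _ hθ).fun_pow 2).congr_deriv (by push_cast; ring)
  have hfreq := (frequently_deriv_nonpos_of_isMaxOn_left pi_pos hcont.continuousOn hderiv
    hmax).and_eventually (Ioo_mem_nhdsGT (half_pos pi_pos))
  refine le_of_tendsto_of_frequently (hcont.continuousWithinAt (s := Set.Ioi 0) (x := 0))
    (hfreq.mono fun θ hθ => ?_)
  exact h.liouvilleFun_sq_le_of_mul_deriv_nonpos hα hβ n hlarge hα2 ⟨hθ.2.1, hθ.2.2.le⟩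
    (by linarith [hθ.1])

-- The energy makes the potential at the maximum small if `u T` is large, while the comparison of
-- the cubed potential with its squared slope makes it large.
theorem IsJacobiBasis.liouvilleFun_sq_le_of_lt_sq (hα2 : 1 / 4 < α ^ 2) (hT : T ∈ Set.Ioc 0 (π / 2))
    (hmax : IsMaxOn (fun θ => liouvilleFun α β (p (n + 1)) θ ^ 2) (Set.Icc 0 π) T) :
    liouvilleFun α β (p (n + 1)) T ^ 2 ≤ 2 * exp 1 * (2 + √(α ^ 2 + β ^ 2)) := by
  by_contra! hbig
  have hsub : Set.Ioc 0 T ⊆ Set.Ioo 0 π := fun θ hθ => ⟨hθ.1, by linarith [hθ.2, hT.2, pi_pos]⟩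
  have hTπ : T ∈ Set.Ioo 0 π := hsub ⟨hT.1, le_rfl⟩
  have hne : liouvilleFun α β (p (n + 1)) T ≠ 0 :=
    pow_ne_zero_iff two_ne_zero |>.1 (hbig.trans' (by positivity)).ne'
  have hcrit := liouvilleFunDeriv_eq_zero_of_isMaxOn hTπ hmax hne
  have hqν := potential_mul_lt_of_lt (sqrt_nonneg _) hlarge hbig
    (h.potential_add_mul_liouvilleFun_sq_le hα hβ n hTπ (by rw [hcrit, mul_zero, mul_zero]))
  set b := max ((β ^ 2 - 1 / 4) / 4) 0
  have hab : 4 * ((α ^ 2 - 1 / 4) / 4 + b) ≤ √(α ^ 2 + β ^ 2) ^ 2 := by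
    rw [sq_sqrt (by positivity)]
    have : b ≤ β ^ 2 / 4 := max_le (by linarith) (by positivity)
    linarith
  obtain ⟨hL, hLq⟩ := pow_three_lt_slope_sq (sqrt_nonneg _) (by linarith) (by linarith)
    (le_max_left _ _) (le_max_right _ _) hab (sin_half_pos hTπ) (cos_half_pos hTπ)
    (sin_sq_add_cos_sq (T / 2)) (sin_half_sq_le hT.1.le hT.2) rfl hqν
  refine hLq.not_ge (((h.isSturmSolution_liouvilleFun (by linarith) (by linarith) (n + 1)).mono
    hsub).sq_le_potential_pow_three hT.1 (continuous_liouvilleFun hα hβ _).continuousOn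
    (liouvilleFun_zero (by rintro rfl; norm_num at hα2) _) hL (fun θ hθ => ?_) (fun θ hθ hpos => ?_)
    hcrit hne fun θ hθ => hmax ⟨hθ.1, by linarith [hθ.2, hTπ.2]⟩)
  · exact liouvillePotentialDeriv_ge hα2.le (le_max_left _ _) (le_max_right _ _) hθ.1 hθ.2 hTπ.2
  · refine h.energy_liouvilleFun_nonneg hα hβ n (hsub hθ) (mul_nonneg ?_ hpos)
    exact cos_nonneg_of_mem_Icc ⟨by linarith [hθ.1, pi_pos], by linarith [hθ.2, hT.2]⟩

theorem IsJacobiBasis.liouvilleFun_sq_le_of_isMaxOn (hT : T ∈ Set.Icc 0 (π / 2))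
    (hmax : IsMaxOn (fun θ => liouvilleFun α β (p (n + 1)) θ ^ 2) (Set.Icc 0 π) T) :
    liouvilleFun α β (p (n + 1)) T ^ 2 ≤ 2 * exp 1 * (2 + √(α ^ 2 + β ^ 2)) := by
  have hfour : 2 * exp 1 * 2 ≤ 2 * exp 1 * (2 + √(α ^ 2 + β ^ 2)) := by
    gcongr
    exact le_add_of_nonneg_right (sqrt_nonneg _)
  rcases hT.1.eq_or_lt with rfl | hT0 <;> rcases le_or_gt (α ^ 2) (1 / 4) with hα2 | hα2
  · exact (h.liouvilleFun_zero_sq_le hα hβ n hlarge hα2 hmax).trans hfour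
  · rw [liouvilleFun_zero (by rintro rfl; norm_num at hα2), zero_pow two_ne_zero]
    positivity
  · rcases eq_or_ne (liouvilleFun α β (p (n + 1)) T) 0 with hzero | hne
    · rw [hzero, zero_pow two_ne_zero]
      positivity
    · refine (h.liouvilleFun_sq_le_of_mul_deriv_nonpos hα hβ n hlarge hα2 ⟨hT0, hT.2⟩ ?_).trans
        hfour
      rw [liouvilleFunDeriv_eq_zero_of_isMaxOn ⟨hT0, by linarith [hT.2, pi_pos]⟩ hmax hne, mul_zero]
  · exact h.liouvilleFun_sq_le_of_lt_sq hα hβ n hlarge hα2 ⟨hT0, hT.2⟩ hmax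

theorem IsJacobiBasis.chebyshevRatio_mul_sq_le_of_large {x : ℝ} (hx : x ∈ Set.Icc (-1 : ℝ) 1) :
    chebyshevRatio α β x * (p (n + 1)).eval x ^ 2 ≤ 2 * exp 1 * (2 + √(α ^ 2 + β ^ 2)) := by
  obtain ⟨T, hT, hmax, hxT⟩ := exists_isMaxOn_liouvilleFun_sq hα hβ (p (n + 1)) hx
  refine hxT.trans ?_
  rcases le_total T (π / 2) with hTle | hTge
  · exact h.liouvilleFun_sq_le_of_isMaxOn hα hβ n hlarge ⟨hT.1, hTle⟩ hmax
  have hreflect : ∀ θ ∈ Set.Icc 0 π, liouvilleFun β α ((p (n + 1)).comp (-X)) (π - θ) ^ 2 =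
      liouvilleFun α β (p (n + 1)) θ ^ 2 := fun θ hθ => by
    rw [liouvilleFun_sq (by linarith) (by linarith) _ ⟨by linarith [hθ.2], by linarith [hθ.1]⟩,
      liouvilleFun_sq (by linarith) (by linarith) _ hθ, cos_pi_sub, chebyshevRatio_neg, eval_comp,
      eval_neg, eval_X, neg_neg]
  rw [← hreflect T hT, add_comm (α ^ 2)]
  refine h.comp_neg.liouvilleFun_sq_le_of_isMaxOn hβ hα n ?_
    ⟨by linarith [hT.2], by linarith⟩ fun θ hθ => ?_
  · rwa [jacobiFrequency, add_comm (β ^ 2), add_comm β α]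
  · have hθ' : π - θ ∈ Set.Icc 0 π := ⟨by linarith [hθ.2], by linarith [hθ.1]⟩
    have : liouvilleFun α β (p (n + 1)) (π - θ) ^ 2 ≤ liouvilleFun α β (p (n + 1)) T ^ 2 :=
      hmax hθ'
    rwa [← hreflect _ hθ', ← hreflect T hT, sub_sub_cancel] at this

omit hlarge in
theorem IsJacobiBasis.chebyshevRatio_mul_sq_le {x : ℝ} (hx : x ∈ Set.Icc (-1 : ℝ) 1) :
    chebyshevRatio α β x * (p n).eval x ^ 2 ≤ 2 * exp 1 * (2 + √(α ^ 2 + β ^ 2)) := by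
  have hA := sqrt_nonneg (α ^ 2 + β ^ 2)
  rcases le_or_gt (jacobiFrequency α β n) (7 / 2 + 2 * √(α ^ 2 + β ^ 2)) with hsmall | hlarge
  · calc chebyshevRatio α β x * (p n).eval x ^ 2
        ≤ chebyshevRatio α β x * ∑ k ∈ Finset.range (n + 1), (p k).eval x ^ 2 :=
          mul_le_mul_of_nonneg_left (Finset.single_le_sum (f := fun k => (p k).eval x ^ 2)
            (fun k _ => sq_nonneg _) (Finset.self_mem_range_succ n))
            (chebyshevRatio_nonneg (by linarith) (by linarith) hx)
      _ ≤ exp 1 * (n + (α + β) / 2 + 1) := h.chebyshevRatio_mul_sum_sq_le hα hβ n hx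
      _ ≤ 2 * exp 1 * (2 + √(α ^ 2 + β ^ 2)) := by
          rw [jacobiFrequency] at hsmall
          nlinarith [exp_pos 1]
  · obtain _ | m := n
    · rw [jacobiFrequency, Nat.cast_zero] at hlarge
      nlinarith [sq_sqrt (by positivity : 0 ≤ α ^ 2 + β ^ 2), sq_nonneg (α - β)]
    · exact h.chebyshevRatio_mul_sq_le_of_large hα hβ m hlarge hx

end UniformBound

section GradConst

theorem sqrt_sq_add_sq_le_sqrt_add_one_sq_add_sq {a b : ℝ} (h : -1 ≤ a + b) :
    √(a ^ 2 + b ^ 2) ≤ √((a + 1) ^ 2 + (b + 1) ^ 2) :=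
  Real.sqrt_le_sqrt (by nlinarith)

theorem sqrt_add_one_sq_add_sq_le (a b : ℝ) :
    √((a + 1) ^ 2 + (b + 1) ^ 2) ≤ √(a ^ 2 + b ^ 2) + √2 := by
  have hcauchy : a + b ≤ √(a ^ 2 + b ^ 2) * √2 := by
    rw [← Real.sqrt_mul (by positivity)]
    exact Real.le_sqrt_of_sq_le (by nlinarith [sq_nonneg (a - b)])
  refine Real.sqrt_le_iff.2 ⟨by positivity, ?_⟩
  nlinarith [Real.sq_sqrt (by positivity : 0 ≤ a ^ 2 + b ^ 2), Real.sq_sqrt (zero_le_two (α := ℝ))]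

variable {d : ℕ} {α β : Fin d → ℝ}

theorem le_gradConst (j : Fin d) :
    (2 + √((α j + 1) ^ 2 + (β j + 1) ^ 2)) / (2 + √(α j ^ 2 + β j ^ 2)) ≤ gradConst α β :=
  le_ciSup (Set.finite_range fun j =>
    (2 + √((α j + 1) ^ 2 + (β j + 1) ^ 2)) / (2 + √(α j ^ 2 + β j ^ 2))).bddAbove j

theorem one_le_gradConst {j : Fin d} (h : -1 ≤ α j + β j) : 1 ≤ gradConst α β := by
  refine le_trans ?_ (le_gradConst j)
  rw [one_le_div₀ (by positivity)]
  gcongr 2 + ?_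
  exact sqrt_sq_add_sq_le_sqrt_add_one_sq_add_sq h

theorem gradConst_le (α β : Fin d → ℝ) : gradConst α β ≤ 1 + √2 / 2 := by
  refine Real.iSup_le (fun j => ?_) (by positivity)
  rw [div_le_iff₀ (by positivity)]
  nlinarith [sqrt_add_one_sq_add_sq_le (α j) (β j),
    mul_nonneg (Real.sqrt_nonneg 2) (Real.sqrt_nonneg (α j ^ 2 + β j ^ 2))]

theorem gradConst_eq_one (hd : 0 < d) (h : ∀ j, α j + β j = -1) : gradConst α β = 1 := by
  have : Nonempty (Fin d) := ⟨⟨0, hd⟩⟩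
  have hratio : ∀ j, (2 + √((α j + 1) ^ 2 + (β j + 1) ^ 2)) / (2 + √(α j ^ 2 + β j ^ 2)) = 1 := by
    intro j
    rw [show (α j + 1) ^ 2 + (β j + 1) ^ 2 = α j ^ 2 + β j ^ 2 by linear_combination 2 * h j]
    exact div_self (by positivity)
  simp only [gradConst, hratio, ciSup_const]

theorem gradConst_eq_of_eq_zero {j : Fin d} (hα : α j = 0) (hβ : β j = 0) :
    gradConst α β = 1 + √2 / 2 := by
  refine (gradConst_le α β).antisymm ?_
  calc 1 + √2 / 2 = (2 + √((α j + 1) ^ 2 + (β j + 1) ^ 2)) / (2 + √(α j ^ 2 + β j ^ 2)) := by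
        norm_num [hα, hβ, add_div]
    _ ≤ gradConst α β := le_gradConst j

end GradConst

theorem IsJacobiBasis.chebyshevRatio_mul_derivative_sq_le {α β : ℝ} {p : ℕ → ℝ[X]}
    (h : IsJacobiBasis α β p) (hα : -1 / 2 ≤ α) (hβ : -1 / 2 ≤ β) (n : ℕ) {x : ℝ}
    (hx : x ∈ Set.Icc (-1 : ℝ) 1) :
    chebyshevRatio (α + 1) (β + 1) x * (derivative (p n)).eval x ^ 2 ≤
      cSq n α β * (2 * Real.exp 1 * (2 + √((α + 1) ^ 2 + (β + 1) ^ 2))) := by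
  obtain _ | n := n
  · have hconst : derivative (p 0) = 0 := derivative_of_natDegree_zero (h.natDegree_eq 0)
    simp [hconst, cSq]
  · have hα' : -1 < α := by linarith
    have hβ' : -1 < β := by linarith
    have hbound := (h.isJacobiBasis_derivative hα' hβ').chebyshevRatio_mul_sq_le (by linarith)
      (by linarith) n hx
    have hc := cSq_pos hα' hβ' n.succ_ne_zero
    rwa [eval_mul, eval_C, mul_pow, inv_pow, Real.sq_sqrt hc.le, mul_left_comm,
      inv_mul_le_iff₀ hc] at hbound

section Weights

theorem chebyshevRatio_pos {α β x : ℝ} (hα : -1 < α) (hβ : -1 < β)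
    (hx : x ∈ Set.Ioo (-1 : ℝ) 1) : 0 < chebyshevRatio α β x := by
  rw [← density_div_density_neg_half α β hx]
  exact div_pos (density_pos hα hβ hx) (density_pos (by norm_num) (by norm_num) hx)

variable {d N : ℕ} {α β : Fin d → ℝ} {x : Fin d → ℝ} {z : Fin N → Fin d → ℝ} {i : Fin N}

theorem densityPi_div_chebDensity (α β : Fin d → ℝ) (hx : x ∈ cube d) :
    densityPi α β x / chebDensity x = ∏ j, chebyshevRatio (α j) (β j) (x j) := by
  rw [chebDensity, densityPi, densityPi, ← Finset.prod_div_distrib]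
  exact Finset.prod_congr rfl fun j _ => density_div_density_neg_half _ _ (hx j)

theorem densityPi_div_chebDensity_pos (hα : ∀ j, -1 < α j) (hβ : ∀ j, -1 < β j)
    (hx : x ∈ cube d) : 0 < densityPi α β x / chebDensity x := by
  rw [densityPi_div_chebDensity α β hx]
  exact Finset.prod_pos fun j _ => chebyshevRatio_pos (hα j) (hβ j) (hx j)

theorem lt_add_single_one {a : ℝ} (h : ∀ j, a < α j) (m j : Fin d) :
    a < (α + Pi.single m 1 : Fin d → ℝ) j := by
  have hsingle : (0 : Fin d → ℝ) ≤ Pi.single m 1 := Pi.single_nonneg.2 zero_le_one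
  exact (h j).trans_le (le_add_of_nonneg_right (hsingle j))

theorem w0_pos (hα : ∀ j, -1 < α j) (hβ : ∀ j, -1 < β j) (hz : z i ∈ cube d) :
    0 < w0 α β z i :=
  Real.sqrt_pos.2 (densityPi_div_chebDensity_pos hα hβ hz)

theorem wGrad_pos (hα : ∀ j, -1 < α j) (hβ : ∀ j, -1 < β j) (hz : z i ∈ cube d) (m : Fin d) :
    0 < wGrad α β z (m, i) :=
  Real.sqrt_pos.2 (densityPi_div_chebDensity_pos (lt_add_single_one hα m) (lt_add_single_one hβ m)
    hz)

theorem w0_sq (hα : ∀ j, -1 < α j) (hβ : ∀ j, -1 < β j) (hz : z i ∈ cube d) :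
    w0 α β z i ^ 2 = ∏ j, chebyshevRatio (α j) (β j) (z i j) := by
  rw [w0, Real.sq_sqrt (densityPi_div_chebDensity_pos hα hβ hz).le,
    densityPi_div_chebDensity _ _ hz]

theorem wGrad_sq (hα : ∀ j, -1 < α j) (hβ : ∀ j, -1 < β j) (hz : z i ∈ cube d) (m : Fin d) :
    wGrad α β z (m, i) ^ 2 = chebyshevRatio (α m + 1) (β m + 1) (z i m) *
      ∏ j ∈ Finset.univ.erase m, chebyshevRatio (α j) (β j) (z i j) := by
  rw [wGrad, Real.sq_sqrt (densityPi_div_chebDensity_pos (lt_add_single_one hα m)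
    (lt_add_single_one hβ m) hz).le, densityPi_div_chebDensity _ _ hz,
    ← Finset.mul_prod_erase _ _ (Finset.mem_univ m)]
  congr 1
  · simp only [Pi.add_apply, Pi.single_eq_same]
  · refine Finset.prod_congr rfl fun j hj => ?_
    simp only [Pi.add_apply, Pi.single_eq_of_ne (Finset.ne_of_mem_erase hj), add_zero]

end Weights

section DesignMatrix

variable {d : ℕ} (φ : Fin d → ℕ → ℝ[X])

theorem psi_update (k : Fin d → ℕ) (x : Fin d → ℝ) (m : Fin d) (t : ℝ) :
    psi φ k (Function.update x m t) =
      (φ m (k m)).eval t * ∏ j ∈ Finset.univ.erase m, (φ j (k j)).eval (x j) := by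
  rw [psi, ← Finset.mul_prod_erase _ _ (Finset.mem_univ m), Function.update_self]
  congr 1
  refine Finset.prod_congr rfl fun j hj => ?_
  rw [Function.update_of_ne (Finset.ne_of_mem_erase hj)]

theorem partialDeriv_psi (k : Fin d → ℕ) (x : Fin d → ℝ) (m : Fin d) :
    partialDeriv m (psi φ k) x = (derivative (φ m (k m))).eval (x m) *
      ∏ j ∈ Finset.univ.erase m, (φ j (k j)).eval (x j) := by
  simp only [partialDeriv, psi_update]
  exact (((φ m (k m)).hasDerivAt (x m)).mul_const _).deriv

variable (α β : Fin d → ℝ) (n : ℕ) {N : ℕ} (z : Fin N → Fin d → ℝ) (i : Fin N)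
  (k : totalDegree d n)

theorem PhiPre_apply : PhiPre α β φ n z i k = w0 α β z i * psi φ k (z i) := by
  rw [PhiPre, Matrix.diagonal_mul, Phi, Matrix.of_apply]

theorem PhiHat_inl : PhiHat α β φ n z (Sum.inl i) k =
    w0 α β z i * psi φ k (z i) * (√(1 + ∑ j, cSq (k.1 j) (α j) (β j)))⁻¹ := by
  rw [PhiHat, P, Matrix.mul_diagonal, W, Matrix.diagonal_mul, Sum.elim_inl,
    Matrix.fromRows_apply_inl, Phi, Matrix.of_apply]

theorem PhiHat_inr (m : Fin d) : PhiHat α β φ n z (Sum.inr (m, i)) k =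
    wGrad α β z (m, i) * partialDeriv m (psi φ k) (z i) *
      (√(1 + ∑ j, cSq (k.1 j) (α j) (β j)))⁻¹ := by
  rw [PhiHat, P, Matrix.mul_diagonal, W, Matrix.diagonal_mul, Sum.elim_inr,
    Matrix.fromRows_apply_inr, PhiGrad, Matrix.of_apply]

end DesignMatrix

section Coherence

theorem cohBound_nonneg {d : ℕ} (α β : Fin d → ℝ) : 0 ≤ cohBound α β :=
  Finset.prod_nonneg fun j _ => by positivity

variable {d : ℕ} {α β : Fin d → ℝ} {φ : Fin d → ℕ → ℝ[X]} (hα : ∀ j, -1 / 2 ≤ α j)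
  (hβ : ∀ j, -1 / 2 ≤ β j) (hφ : ∀ j, IsJacobiBasis (α j) (β j) (φ j))
include hα hβ hφ

theorem prod_chebyshevRatio_mul_psi_sq_le (s : Finset (Fin d)) {x : Fin d → ℝ} (hx : x ∈ cube d)
    (k : Fin d → ℕ) :
    (∏ j ∈ s, chebyshevRatio (α j) (β j) (x j)) * (∏ j ∈ s, (φ j (k j)).eval (x j)) ^ 2 ≤
      ∏ j ∈ s, 2 * Real.exp 1 * (2 + √(α j ^ 2 + β j ^ 2)) := by
  rw [← Finset.prod_pow, ← Finset.prod_mul_distrib]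
  refine Finset.prod_le_prod (fun j _ => mul_nonneg ?_ (sq_nonneg _)) fun j _ =>
    (hφ j).chebyshevRatio_mul_sq_le (hα j) (hβ j) (k j) (Set.Ioo_subset_Icc_self (hx j))
  exact (chebyshevRatio_pos (by linarith [hα j]) (by linarith [hβ j]) (hx j)).le

variable {N : ℕ} {z : Fin N → Fin d → ℝ}

theorem w0_mul_psi_sq_le {i : Fin N} (hz : z i ∈ cube d) (k : Fin d → ℕ) :
    (w0 α β z i * psi φ k (z i)) ^ 2 ≤ cohBound α β := by
  rw [mul_pow, w0_sq (fun j => by linarith [hα j]) (fun j => by linarith [hβ j]) hz]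
  exact prod_chebyshevRatio_mul_psi_sq_le hα hβ hφ Finset.univ hz k

theorem wGrad_mul_partialDeriv_psi_sq_le {i : Fin N} (hz : z i ∈ cube d) (k : Fin d → ℕ)
    (m : Fin d) :
    (wGrad α β z (m, i) * partialDeriv m (psi φ k) (z i)) ^ 2 ≤
      cSq (k m) (α m) (β m) * (gradConst α β * cohBound α β) := by
  have hα' : ∀ j, -1 < α j := fun j => by linarith [hα j]
  have hβ' : ∀ j, -1 < β j := fun j => by linarith [hβ j]
  have hnonneg : 0 ≤ cSq (k m) (α m) (β m) := cSq_nonneg (hα' m) (hβ' m) _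
  calc (wGrad α β z (m, i) * partialDeriv m (psi φ k) (z i)) ^ 2
      = (chebyshevRatio (α m + 1) (β m + 1) (z i m) *
            (derivative (φ m (k m))).eval (z i m) ^ 2) *
          ((∏ j ∈ Finset.univ.erase m, chebyshevRatio (α j) (β j) (z i j)) *
            (∏ j ∈ Finset.univ.erase m, (φ j (k j)).eval (z i j)) ^ 2) := by
        rw [mul_pow, wGrad_sq hα' hβ' hz, partialDeriv_psi]
        ring
    _ ≤ (cSq (k m) (α m) (β m) *
            (2 * Real.exp 1 * (2 + √((α m + 1) ^ 2 + (β m + 1) ^ 2)))) *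
          ∏ j ∈ Finset.univ.erase m, 2 * Real.exp 1 * (2 + √(α j ^ 2 + β j ^ 2)) :=
        mul_le_mul
          ((hφ m).chebyshevRatio_mul_derivative_sq_le (hα m) (hβ m) (k m)
            (Set.Ioo_subset_Icc_self (hz m)))
          (prod_chebyshevRatio_mul_psi_sq_le hα hβ hφ _ hz k)
          (mul_nonneg (Finset.prod_nonneg fun j _ =>
            (chebyshevRatio_pos (hα' j) (hβ' j) (hz j)).le) (sq_nonneg _)) (by positivity)
    _ ≤ (cSq (k m) (α m) (β m) *
            (2 * Real.exp 1 * (gradConst α β * (2 + √(α m ^ 2 + β m ^ 2))))) *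
          ∏ j ∈ Finset.univ.erase m, 2 * Real.exp 1 * (2 + √(α j ^ 2 + β j ^ 2)) := by
        gcongr
        exact (div_le_iff₀ (by positivity)).1 (le_gradConst m)
    _ = cSq (k m) (α m) (β m) * (gradConst α β * cohBound α β) := by
        rw [cohBound, ← Finset.mul_prod_erase _ _ (Finset.mem_univ m)]
        ring

variable (n : ℕ) (hz : ∀ i, z i ∈ cube d)
include hz

theorem muL_PhiPre_le : muL (PhiPre α β φ n z) ≤ cohBound α β := by
  refine Real.iSup_le (fun q => ?_) (cohBound_nonneg α β)
  rw [PhiPre_apply]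
  exact w0_mul_psi_sq_le hα hβ hφ (hz _) _

-- `P` divides column `k` by `1 + ∑ m, c²(k_m, α_m, β_m)`, which is the sum of the bounds for the
-- squared entries of that column, up to the common factor `gradConst α β * cohBound α β`.
theorem betaL_PhiHat_le (hd : 0 < d) :
    betaL (PhiHat α β φ n z) ≤ gradConst α β * cohBound α β := by
  have hC : 1 ≤ gradConst α β :=
    one_le_gradConst (j := ⟨0, hd⟩) (by linarith [hα ⟨0, hd⟩, hβ ⟨0, hd⟩])
  have hB := cohBound_nonneg α β
  refine Real.iSup_le (fun ⟨k, i⟩ => ?_) (mul_nonneg (zero_le_one.trans hC) hB)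
  have hs : 0 < 1 + ∑ j, cSq (k.1 j) (α j) (β j) :=
    add_pos_of_pos_of_nonneg one_pos (Finset.sum_nonneg fun j _ =>
      cSq_nonneg (by linarith [hα j]) (by linarith [hβ j]) _)
  simp only [PhiHat_inl, PhiHat_inr, mul_pow _ (√_)⁻¹, inv_pow, Real.sq_sqrt hs.le]
  rw [← Finset.sum_mul, ← add_mul, ← div_eq_mul_inv, div_le_iff₀' hs, add_mul, one_mul,
    Finset.sum_mul]
  exact add_le_add
    ((w0_mul_psi_sq_le hα hβ hφ (hz i) k.1).trans (le_mul_of_one_le_left hB hC))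
    (Finset.sum_le_sum fun m _ => wGrad_mul_partialDeriv_psi_sq_le hα hβ hφ (hz i) k.1 m)

end Coherence

section Nullspaces

variable {d : ℕ} {α β : Fin d → ℝ} (hα : ∀ j, -1 < α j) (hβ : ∀ j, -1 < β j)
  {φ : Fin d → ℕ → ℝ[X]} {n N : ℕ} {z : Fin N → Fin d → ℝ} (hz : ∀ i, z i ∈ cube d)
include hα hβ hz

theorem mulVec_eq_zero_of_mem_map_nullspace {c : totalDegree d n → ℝ}
    (hc : c ∈ (nullspace (PhiHat α β φ n z)).map (P α β n).mulVecLin) :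
    (Phi φ n z).mulVec c = 0 ∧ (PhiGrad φ n z).mulVec c = 0 := by
  obtain ⟨v, hv, rfl⟩ := hc
  have hv : (PhiHat α β φ n z).mulVec v = 0 := hv
  rw [PhiHat, ← Matrix.mulVec_mulVec, ← Matrix.mulVec_mulVec, Matrix.fromRows_mulVec] at hv
  rw [Matrix.mulVecLin_apply]
  constructor
  · funext i
    have hrow := congrFun hv (Sum.inl i)
    rw [W, Matrix.mulVec_diagonal, Sum.elim_inl, Sum.elim_inl] at hrow
    exact (mul_eq_zero.1 hrow).resolve_left (w0_pos hα hβ (hz i)).ne'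
  · funext r
    have hrow := congrFun hv (Sum.inr r)
    rw [W, Matrix.mulVec_diagonal, Sum.elim_inr, Sum.elim_inr] at hrow
    exact (mul_eq_zero.1 hrow).resolve_left (wGrad_pos hα hβ (hz r.2) r.1).ne'

theorem map_nullspace_PhiHat_le :
    (nullspace (PhiHat α β φ n z)).map (P α β n).mulVecLin ≤ nullspace (Phi φ n z) :=
  fun _ hc => (mulVec_eq_zero_of_mem_map_nullspace hα hβ hz hc).1

end Nullspaces

section Wronskian

open MvPolynomial

variable {σ R : Type*}

theorem totalDegree_pderiv_lt [CommSemiring R] {p : MvPolynomial σ R} {i : σ} (h : pderiv i p ≠ 0) :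
    (pderiv i p).totalDegree < p.totalDegree := by
  obtain ⟨m, hm, hmax⟩ := (pderiv i p).support.exists_mem_eq_sup (support_nonempty.2 h)
    fun m => m.sum fun _ e => e
  have hsup : m + Finsupp.single i 1 ∈ p.support := by
    rw [MvPolynomial.mem_support_iff, coeff_pderiv] at hm
    exact MvPolynomial.mem_support_iff.2 (left_ne_zero_of_mul hm)
  have hle := le_totalDegree hsup
  rw [Finsupp.sum_add_index' (fun _ => rfl) (fun _ _ _ => rfl),
    Finsupp.sum_single_index rfl] at hle
  rw [MvPolynomial.totalDegree, hmax]
  omega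

variable [CommRing R] [IsDomain R]

theorem pderiv_eq_zero_of_dvd {p : MvPolynomial σ R} {i : σ} (h : p ∣ pderiv i p) :
    pderiv i p = 0 := by
  by_contra hne
  obtain ⟨q, hq⟩ := h
  have hlt := totalDegree_pderiv_lt hne
  rw [hq] at hne
  rw [hq, totalDegree_mul_of_isDomain (left_ne_zero_of_mul hne) (right_ne_zero_of_mul hne)] at hlt
  omega

variable [CharZero R]

theorem eq_C_of_forall_pderiv_eq_zero {p : MvPolynomial σ R} (h : ∀ i, pderiv i p = 0) :
    p = MvPolynomial.C (MvPolynomial.coeff 0 p) := by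
  classical
  ext m
  rw [MvPolynomial.coeff_C]
  split_ifs with hm
  · rw [hm]
  obtain ⟨i, hi⟩ := Finsupp.ne_iff.1 (Ne.symm hm)
  have hle : Finsupp.single i 1 ≤ m :=
    Finsupp.single_le_iff.2 (Nat.one_le_iff_ne_zero.2 hi)
  have hcoeff : coeff (m - Finsupp.single i 1) (pderiv i p) = 0 := by
    rw [h i, MvPolynomial.coeff_zero]
  rw [coeff_pderiv, tsub_add_cancel_of_le hle] at hcoeff
  exact (mul_eq_zero.1 hcoeff).resolve_right (Nat.cast_add_one_ne_zero _)

-- After removal of the common factor, a vanishing Wronskian forces each of `f` and `g` to divide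
-- its own derivatives.
theorem exists_wronskian_ne_zero [UniqueFactorizationMonoid R] {f g : MvPolynomial σ R}
    (h : LinearIndependent R ![f, g]) : ∃ i, g * pderiv i f - f * pderiv i g ≠ 0 := by
  by_contra! hW
  have hf : f ≠ 0 := h.ne_zero 0
  have hg : g ≠ 0 := h.ne_zero 1
  obtain ⟨a, b, c, hab, rfl, rfl⟩ :=
    UniqueFactorizationMonoid.exists_reduced_factors f hf g
  have hWab : ∀ i, b * pderiv i a = a * pderiv i b := by
    intro i
    have hc : c * c ≠ 0 := mul_self_ne_zero.2 (left_ne_zero_of_mul hf)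
    refine mul_left_cancel₀ hc ?_
    have hi := hW i
    rw [pderiv_mul, pderiv_mul] at hi
    linear_combination hi
  have ha := eq_C_of_forall_pderiv_eq_zero fun i =>
    pderiv_eq_zero_of_dvd (hab.dvd_of_dvd_mul_left (Dvd.intro _ (hWab i).symm))
  have hb := eq_C_of_forall_pderiv_eq_zero fun i =>
    pderiv_eq_zero_of_dvd (hab.symm.dvd_of_dvd_mul_left (Dvd.intro _ (hWab i)))
  have hcomb : coeff 0 b • (c * a) + -coeff 0 a • (c * b) = 0 := by
    rw [MvPolynomial.smul_eq_C_mul, MvPolynomial.smul_eq_C_mul, C_neg, ← ha, ← hb]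
    ring
  have hb0 := (LinearIndependent.pair_iff.1 h _ _ hcomb).1
  rw [hb, hb0, MvPolynomial.C_0, mul_zero] at hg
  exact hg rfl

end Wronskian

section ProductMeasures

-- By Fubini, the exceptional set is a null set if each of its slices in the first coordinate is.
theorem ae_pi_of_ae_ae_cons {n : ℕ} {X : Type*} [MeasurableSpace X]
    (κ : Fin (n + 1) → Measure X) [∀ i, SigmaFinite (κ i)] {s : Set (Fin (n + 1) → X)}
    (hs : MeasurableSet s)
    (h : ∀ᵐ y ∂Measure.pi fun i => κ (Fin.succ i),
      ∀ᵐ x ∂κ 0, (Fin.cons x y : Fin (n + 1) → X) ∈ s) :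
    ∀ᵐ z ∂Measure.pi κ, z ∈ s := by
  have hmeas : MeasurableSet {p : X × (Fin n → X) | (Fin.cons p.1 p.2 : Fin (n + 1) → X) ∈ s} :=
    (measurable_pi_iff.2 (Fin.cases measurable_fst fun i =>
      (measurable_pi_apply i).comp measurable_snd)) hs
  have hprod := (Measure.ae_prod_mem_iff_ae_ae_mem hmeas).2
    ((Measure.ae_ae_comm (p := fun x y => (Fin.cons x y : Fin (n + 1) → X) ∈ s) hmeas).2 h)
  filter_upwards [(measurePreserving_piFinSuccAbove κ 0).quasiMeasurePreserving.ae hprod]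
    with z hz
  rw [← Fin.cons_self_tail z]
  exact hz

theorem ae_eval_ne_zero {d : ℕ} (ν : Fin d → Measure ℝ) [∀ j, SigmaFinite (ν j)]
    [∀ j, NullSingletonClass (ν j)] {f : MvPolynomial (Fin d) ℝ} (hf : f ≠ 0) :
    ∀ᵐ x ∂Measure.pi ν, MvPolynomial.eval x f ≠ 0 := by
  induction d with
  | zero =>
    refine ae_of_all _ fun x hx => hf ?_
    rw [MvPolynomial.eq_C_of_isEmpty f, MvPolynomial.eval_C] at hx
    rw [MvPolynomial.eq_C_of_isEmpty f, hx, MvPolynomial.C_0]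
  | succ d ih =>
    have hmeas : MeasurableSet {x : Fin (d + 1) → ℝ | MvPolynomial.eval x f ≠ 0} :=
      (isOpen_ne_fun (MvPolynomial.continuous_eval f) continuous_const).measurableSet
    refine ae_pi_of_ae_ae_cons ν hmeas ?_
    obtain ⟨i, hi⟩ : ∃ i, (MvPolynomial.finSuccEquiv ℝ d f).coeff i ≠ 0 := by
      by_contra! hcoeff
      exact hf ((MvPolynomial.finSuccEquiv ℝ d).map_eq_zero_iff.1 (Polynomial.ext hcoeff))
    filter_upwards [ih (fun j => ν j.succ) hi] with y hy
    have hmap : Polynomial.map (MvPolynomial.eval y) (MvPolynomial.finSuccEquiv ℝ d f) ≠ 0 := by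
      intro h0
      rw [← coeff_map, h0, coeff_zero] at hy
      exact hy rfl
    filter_upwards [compl_mem_ae_iff.2 (Finset.measure_zero (Polynomial.roots _).toFinset (ν 0))]
      with x hx hroot
    rw [MvPolynomial.eval_eq_eval_mv_eval'] at hroot
    exact hx (Multiset.mem_toFinset.2 ((mem_roots hmap).2 hroot))

theorem measurableSet_of_isSigmaCompact {X : Type*} [TopologicalSpace X] [T2Space X]
    [MeasurableSpace X] [OpensMeasurableSpace X] {s : Set X} (hs : IsSigmaCompact s) :
    MeasurableSet s := by
  obtain ⟨K, hK, rfl⟩ := hs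
  exact MeasurableSet.iUnion fun i => (hK i).measurableSet

theorem isSigmaCompact_isClosed_inter_isOpen {X : Type*} [PseudoEMetricSpace X]
    [SigmaCompactSpace X] {s u : Set X} (hs : IsClosed s) (hu : IsOpen u) :
    IsSigmaCompact (s ∩ u) := by
  obtain ⟨F, hF, -, hFu, -⟩ := hu.exists_iUnion_isClosed
  rw [← hFu, Set.inter_iUnion]
  exact isSigmaCompact_iUnion _ fun i =>
    isSigmaCompact_univ.of_isClosed_subset (hs.inter (hF i)) (Set.subset_univ _)

end ProductMeasures

section NonflatZeros

variable {σ : Type*} {N : ℕ}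

/-- Some member of the space `V` of polynomials vanishes at all the points `z i`, although its
gradient at the point `z 0` is not zero. This is what makes the inclusion of nullspaces strict. -/
def HasNonflatZero (V : Submodule ℝ (MvPolynomial σ ℝ)) (z : Fin (N + 1) → σ → ℝ) : Prop :=
  ∃ f ∈ V, (∀ i, MvPolynomial.eval (z i) f = 0) ∧
    ∃ m, MvPolynomial.eval (z 0) (MvPolynomial.pderiv m f) ≠ 0

variable {V : Submodule ℝ (MvPolynomial σ ℝ)}

theorem exists_linearIndependent_pair_eval_eq_zero (hN : N + 1 < Module.finrank ℝ V)
    (w : Fin N → σ → ℝ) :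
    ∃ f ∈ V, ∃ g ∈ V, LinearIndependent ℝ ![f, g] ∧
      ∀ i, MvPolynomial.eval (w i) f = 0 ∧ MvPolynomial.eval (w i) g = 0 := by
  have : FiniteDimensional ℝ V := Module.finite_of_finrank_pos (by omega)
  let E : V →ₗ[ℝ] Fin N → ℝ :=
    LinearMap.pi fun i => (MvPolynomial.aeval (w i)).toLinearMap ∘ₗ V.subtype
  have hker : 1 < Module.finrank ℝ E.ker := by
    have hrank := E.finrank_range_add_finrank_ker
    have hrange := E.range.finrank_le
    rw [Module.finrank_fintype_fun_eq_card, Fintype.card_fin] at hrange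
    omega
  have : Nontrivial E.ker := Module.nontrivial_of_finrank_pos (R := ℝ) (by omega)
  obtain ⟨f, hf⟩ : ∃ f : E.ker, f ≠ 0 := exists_ne 0
  obtain ⟨g, hfg⟩ := exists_linearIndependent_pair_of_one_lt_finrank (M := E.ker) hker hf
  refine ⟨f.1, f.1.2, g.1, g.1.2, LinearIndependent.pair_iff.2 fun s t h => ?_, fun i =>
    ⟨congrFun (LinearMap.mem_ker.1 f.2) i, congrFun (LinearMap.mem_ker.1 g.2) i⟩⟩
  exact LinearIndependent.pair_iff.1 hfg s t (Subtype.ext (Subtype.ext h))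

-- If `f` and `g` vanish at the points `w i`, then `g(x) f - f(x) g` vanishes in addition at `x`,
-- and its gradient at `x` is the Wronskian of `f` and `g`.
theorem ae_hasNonflatZero_cons {κ : Measure (σ → ℝ)}
    (hκ : ∀ f : MvPolynomial σ ℝ, f ≠ 0 → ∀ᵐ x ∂κ, MvPolynomial.eval x f ≠ 0)
    (hN : N + 1 < Module.finrank ℝ V) (w : Fin N → σ → ℝ) :
    ∀ᵐ x ∂κ, HasNonflatZero V (Fin.cons x w : Fin (N + 1) → σ → ℝ) := by
  obtain ⟨f, hf, g, hg, hfg, hw⟩ := exists_linearIndependent_pair_eval_eq_zero hN w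
  obtain ⟨m, hm⟩ := exists_wronskian_ne_zero hfg
  filter_upwards [hκ _ hm] with x hx
  refine ⟨MvPolynomial.eval x g • f - MvPolynomial.eval x f • g,
    V.sub_mem (V.smul_mem _ hf) (V.smul_mem _ hg), fun i => ?_, m, ?_⟩
  · cases i using Fin.cases with
    | zero =>
      simp only [Fin.cons_zero, map_sub, MvPolynomial.smul_eval]
      ring
    | succ i => simp only [Fin.cons_succ, map_sub, MvPolynomial.smul_eval, hw, mul_zero, sub_self]
  · simpa only [Fin.cons_zero, map_sub, map_mul, Derivation.map_smul, MvPolynomial.smul_eval]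
      using hx

-- With generators of `V`, the set is the projection of a relatively open subset of a closed subset
-- of the finite-dimensional space of samples and coefficients, hence σ-compact.
theorem measurableSet_hasNonflatZero [Finite σ] [FiniteDimensional ℝ V] :
    MeasurableSet {z : Fin (N + 1) → σ → ℝ | HasNonflatZero V z} := by
  have := Fintype.ofFinite σ
  obtain ⟨n, b, rfl⟩ := Submodule.fg_iff_exists_fin_generating_family.1
    (Module.Finite.iff_fg.1 ‹FiniteDimensional ℝ V›)
  have hcont : ∀ (D : MvPolynomial σ ℝ →ₗ[ℝ] MvPolynomial σ ℝ) (i : Fin (N + 1)), Continuous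
      fun p : (Fin (N + 1) → σ → ℝ) × (Fin n → ℝ) =>
        MvPolynomial.eval (p.1 i) (D (∑ k, p.2 k • b k)) := by
    intro D i
    simp only [map_sum, map_smul, MvPolynomial.smul_eval]
    exact continuous_finsetSum _ fun k _ => Continuous.mul (by fun_prop)
      ((MvPolynomial.continuous_eval (D (b k))).comp (by fun_prop))
  have hclosed : IsClosed {p : (Fin (N + 1) → σ → ℝ) × (Fin n → ℝ) |
      ∀ i, MvPolynomial.eval (p.1 i) (∑ k, p.2 k • b k) = 0} := by
    simp only [Set.ofPred_forall]
    exact isClosed_iInter fun i => isClosed_eq (hcont LinearMap.id i) continuous_const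
  have hopen : IsOpen {p : (Fin (N + 1) → σ → ℝ) × (Fin n → ℝ) |
      ∃ m, MvPolynomial.eval (p.1 0) (MvPolynomial.pderiv m (∑ k, p.2 k • b k)) ≠ 0} := by
    simp only [Set.ofPred_exists]
    exact isOpen_iUnion fun m => isOpen_ne_fun
      (hcont (MvPolynomial.pderiv m).toLinearMap 0) continuous_const
  convert measurableSet_of_isSigmaCompact
    ((isSigmaCompact_isClosed_inter_isOpen hclosed hopen).image continuous_fst) using 1
  ext z
  simp only [HasNonflatZero, Submodule.mem_span_range_iff_exists_fun]
  constructor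
  · rintro ⟨_, ⟨c, rfl⟩, hzero, hgrad⟩
    exact ⟨(z, c), ⟨hzero, hgrad⟩, rfl⟩
  · rintro ⟨⟨z, c⟩, ⟨hzero, hgrad⟩, rfl⟩
    exact ⟨_, ⟨c, rfl⟩, hzero, hgrad⟩

theorem ae_hasNonflatZero [Finite σ] {κ : Measure (σ → ℝ)} [SigmaFinite κ]
    (hκ : ∀ f : MvPolynomial σ ℝ, f ≠ 0 → ∀ᵐ x ∂κ, MvPolynomial.eval x f ≠ 0)
    (hN : N + 1 < Module.finrank ℝ V) :
    ∀ᵐ z ∂Measure.pi fun _ : Fin (N + 1) => κ, HasNonflatZero V z := by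
  have : FiniteDimensional ℝ V := Module.finite_of_finrank_pos (by omega)
  exact ae_pi_of_ae_ae_cons (fun _ => κ) measurableSet_hasNonflatZero
    (ae_of_all _ fun w => ae_hasNonflatZero_cons hκ hN w)

end NonflatZeros

section PsiPoly

variable {d : ℕ} (φ : Fin d → ℕ → ℝ[X])

/-- The basis function `ψ_k` as a polynomial in `d` variables. -/
def psiPoly (k : Fin d → ℕ) : MvPolynomial (Fin d) ℝ :=
  ∏ j, (φ j (k j)).toMvPolynomial j

theorem eval_psiPoly (k : Fin d → ℕ) (x : Fin d → ℝ) :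
    MvPolynomial.eval x (psiPoly φ k) = psi φ k x := by
  rw [psiPoly, psi, map_prod]
  exact Finset.prod_congr rfl fun j _ => MvPolynomial.eval_toMvPolynomial x j _

theorem hasDerivAt_eval_update (p : MvPolynomial (Fin d) ℝ) (x : Fin d → ℝ) (m : Fin d) :
    HasDerivAt (fun t => MvPolynomial.eval (Function.update x m t) p)
      (MvPolynomial.eval x (MvPolynomial.pderiv m p)) (x m) := by
  induction p using MvPolynomial.induction_on with
  | C a => simpa using hasDerivAt_const (x m) a
  | add p q hp hq => simpa only [map_add] using hp.fun_add hq
  | mul_X p j hp =>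
    have hX : HasDerivAt (fun t => Function.update x m t j)
        (MvPolynomial.eval x (MvPolynomial.pderiv m (MvPolynomial.X j))) (x m) := by
      rcases eq_or_ne j m with rfl | hj
      · simpa using hasDerivAt_id' (x j)
      · simpa [hj, MvPolynomial.pderiv_X_of_ne hj] using hasDerivAt_const (x m) (x j)
    simp only [map_mul, MvPolynomial.eval_X]
    refine (hp.fun_mul hX).congr_deriv ?_
    simp only [MvPolynomial.pderiv_mul, map_add, map_mul, Function.update_eq_self,
      MvPolynomial.eval_X]

theorem partialDeriv_psi_eq_eval_pderiv (k : Fin d → ℕ) (x : Fin d → ℝ) (m : Fin d) :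
    partialDeriv m (psi φ k) x = MvPolynomial.eval x (MvPolynomial.pderiv m (psiPoly φ k)) := by
  simp only [partialDeriv, ← eval_psiPoly]
  exact (hasDerivAt_eval_update _ x m).deriv

open Matrix in
theorem Phi_mulVec_apply {n N : ℕ} (z : Fin N → Fin d → ℝ) (c : totalDegree d n → ℝ) (i : Fin N) :
    (Phi φ n z *ᵥ c) i = MvPolynomial.eval (z i) (∑ k, c k • psiPoly φ k) := by
  simp only [mulVec, dotProduct, Phi, of_apply, map_sum, MvPolynomial.smul_eval, eval_psiPoly,
    mul_comm]

open Matrix in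
theorem PhiGrad_mulVec_apply {n N : ℕ} (z : Fin N → Fin d → ℝ) (c : totalDegree d n → ℝ)
    (m : Fin d) (i : Fin N) :
    (PhiGrad φ n z *ᵥ c) (m, i) =
      MvPolynomial.eval (z i) (MvPolynomial.pderiv m (∑ k, c k • psiPoly φ k)) := by
  simp only [mulVec, dotProduct, PhiGrad, of_apply, map_sum, Derivation.map_smul,
    MvPolynomial.smul_eval, partialDeriv_psi_eq_eval_pderiv, mul_comm]

theorem coeff_prod_toMvPolynomial {ι : Type*} [Fintype ι] (p : ι → ℝ[X]) (l : ι →₀ ℕ) :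
    MvPolynomial.coeff l (∏ i, (p i).toMvPolynomial i) = ∏ i, (p i).coeff (l i) := by
  classical
  have hprod (a : ι → ℕ) :
      ∏ i, (MvPolynomial.C ((p i).coeff (a i)) * MvPolynomial.X i ^ a i) =
        MvPolynomial.monomial (Finsupp.equivFunOnFinite.symm a) (∏ i, (p i).coeff (a i)) := by
    rw [MvPolynomial.monomial_eq, Finsupp.prod_fintype _ _ fun _ => pow_zero _,
      Finset.prod_mul_distrib, map_prod]
    rfl
  simp only [Polynomial.toMvPolynomial, Polynomial.aeval_eq_sum_range, MvPolynomial.smul_eq_C_mul,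
    Finset.prod_univ_sum, hprod, MvPolynomial.coeff_sum, MvPolynomial.coeff_monomial,
    Equiv.symm_apply_eq]
  rw [Finset.sum_ite_eq']
  split_ifs with hl
  · rfl
  · obtain ⟨i, hi⟩ : ∃ i, (p i).natDegree < l i := by
      simpa [Fintype.mem_piFinset, Nat.lt_succ_iff] using hl
    exact (Finset.prod_eq_zero (Finset.mem_univ i) (coeff_eq_zero_of_natDegree_lt hi)).symm

variable {φ} (hφ : ∀ j m, (φ j m).degree = m)
include hφ

-- The coefficient of `ψ_k` at the exponent `l` vanishes unless `l ≤ k`, and does not vanish for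
-- `l = k`.
theorem linearIndependent_psiPoly : LinearIndependent ℝ (psiPoly φ) := by
  have hdeg (j m) : (φ j m).natDegree = m := natDegree_eq_of_degree_eq_some (hφ j m)
  rw [linearIndependent_iff]
  intro c hc
  by_contra hne
  obtain ⟨k, hk, hmax⟩ := c.support.exists_maximal (Finsupp.support_nonempty_iff.2 hne)
  refine Finsupp.mem_support_iff.1 hk ?_
  have hcoeff := congrArg (MvPolynomial.coeff (Finsupp.equivFunOnFinite.symm k)) hc
  simp only [Finsupp.linearCombination_apply, Finsupp.sum, MvPolynomial.coeff_sum,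
    MvPolynomial.coeff_smul, psiPoly, coeff_prod_toMvPolynomial, MvPolynomial.coeff_zero,
    Finsupp.equivFunOnFinite_symm_apply_apply, smul_eq_mul] at hcoeff
  rw [Finset.sum_eq_single k, mul_eq_zero, Finset.prod_eq_zero_iff] at hcoeff
  · refine hcoeff.resolve_right ?_
    rintro ⟨j, -, hj⟩
    exact coeff_ne_zero_of_eq_degree (hφ j (k j)) hj
  · intro l hl hlk
    obtain ⟨j, hj⟩ : ∃ j, l j < k j := by
      by_contra! hle
      exact hlk (le_antisymm (hmax hl hle) hle)
    exact mul_eq_zero_of_right _ (Finset.prod_eq_zero (Finset.mem_univ j)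
      (coeff_eq_zero_of_natDegree_lt (by rwa [hdeg])))
  · exact fun h => absurd hk h

theorem finrank_span_psiPoly (n : ℕ) :
    Module.finrank ℝ (Submodule.span ℝ (Set.range fun k : totalDegree d n => psiPoly φ k)) =
      (totalDegree d n).card :=
  (finrank_span_eq_card ((linearIndependent_psiPoly hφ).comp _ Subtype.val_injective)).trans
    (Fintype.card_coe _)

end PsiPoly

section ChebyshevSampling

instance sigmaFinite_jacobiMeasure (α β : ℝ) : SigmaFinite (jacobiMeasure α β) := by
  unfold jacobiMeasure
  infer_instance

instance nullSingletonClass_jacobiMeasure (α β : ℝ) : NullSingletonClass (jacobiMeasure α β) := by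
  unfold jacobiMeasure
  infer_instance

instance sigmaFinite_chebMeasure (d : ℕ) : SigmaFinite (chebMeasure d) := by
  unfold chebMeasure
  infer_instance

theorem ae_jacobiMeasure_mem_Ioo (α β : ℝ) :
    ∀ᵐ x ∂jacobiMeasure α β, x ∈ Set.Ioo (-1 : ℝ) 1 :=
  (withDensity_absolutelyContinuous _ _).ae_le (ae_restrict_mem measurableSet_Ioo)

theorem ae_chebMeasure_mem_cube (d : ℕ) : ∀ᵐ x ∂chebMeasure d, x ∈ cube d :=
  ae_all_iff.2 fun _ => Measure.tendsto_eval_ae_ae.eventually (ae_jacobiMeasure_mem_Ioo _ _)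

variable {d n N : ℕ} {α β : Fin d → ℝ} {φ : Fin d → ℕ → ℝ[X]}

theorem HasNonflatZero.map_nullspace_PhiHat_lt (hα : ∀ j, -1 < α j) (hβ : ∀ j, -1 < β j)
    {z : Fin (N + 1) → Fin d → ℝ} (hz : ∀ i, z i ∈ cube d)
    (h : HasNonflatZero (Submodule.span ℝ (Set.range fun k : totalDegree d n => psiPoly φ k)) z) :
    (nullspace (PhiHat α β φ n z)).map (P α β n).mulVecLin < nullspace (Phi φ n z) := by
  obtain ⟨f, hf, hzero, m, hgrad⟩ := h
  obtain ⟨c, rfl⟩ := (Submodule.mem_span_range_iff_exists_fun ℝ).1 hf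
  refine SetLike.lt_iff_le_and_exists.2
    ⟨map_nullspace_PhiHat_le hα hβ hz, c, funext fun i => ?_, fun hmem => hgrad ?_⟩
  · exact (Phi_mulVec_apply φ z c i).trans (hzero i)
  · rw [← PhiGrad_mulVec_apply, (mulVec_eq_zero_of_mem_map_nullspace hα hβ hz hmem).2,
      Pi.zero_apply]

variable {Ω : Type*} [MeasurableSpace Ω] {μ : Measure Ω} {Z : Fin N → Ω → Fin d → ℝ}
  (hZ : ∀ i, HasLaw (Z i) (chebMeasure d) μ)
include hZ

theorem ae_forall_mem_cube : ∀ᵐ ω ∂μ, ∀ i, Z i ω ∈ cube d := by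
  refine ae_all_iff.2 fun i => ae_of_ae_map (hZ i).aemeasurable ?_
  rw [(hZ i).map_eq]
  exact ae_chebMeasure_mem_cube d

theorem ae_map_nullspace_PhiHat_lt (hα : ∀ j, -1 < α j) (hβ : ∀ j, -1 < β j)
    (hφ : ∀ j m, (φ j m).degree = m) (hindep : iIndepFun Z μ) (hN : 0 < N)
    (hcard : N < (totalDegree d n).card) :
    ∀ᵐ ω ∂μ, (nullspace (PhiHat α β φ n fun i => Z i ω)).map (P α β n).mulVecLin <
        nullspace (Phi φ n fun i => Z i ω) := by
  obtain ⟨N, rfl⟩ := Nat.exists_eq_succ_of_ne_zero hN.ne'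
  have hlaw := hindep.hasLaw_pi hZ
  rw [← finrank_span_psiPoly hφ n] at hcard
  have hzeros := ae_hasNonflatZero (κ := chebMeasure d) (fun f hf => ae_eval_ne_zero _ hf) hcard
  rw [← hlaw.map_eq] at hzeros
  filter_upwards [ae_forall_mem_cube hZ, ae_of_ae_map hlaw.aemeasurable hzeros] with ω hω h
  exact h.map_nullspace_PhiHat_lt hα hβ hω

end ChebyshevSampling

end JacobiPCE

end

theorem mainTheorem1 (d : ℕ) (hd : 0 < d) (α β : Fin d → ℝ)
    (hα : ∀ j, -1 / 2 ≤ α j) (hβ : ∀ j, -1 / 2 ≤ β j)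
    (φ : Fin d → ℕ → Polynomial ℝ) (hφ : ∀ j, JacobiPCE.IsJacobiBasis (α j) (β j) (φ j))
    (n N : ℕ) {Ω : Type*} [MeasurableSpace Ω] (μ : Measure Ω) [IsProbabilityMeasure μ]
    (Z : Fin N → Ω → Fin d → ℝ) (hZ : ∀ i, HasLaw (Z i) (JacobiPCE.chebMeasure d) μ)
    (hindep : iIndepFun Z μ) :
    -- the constant
    (1 ≤ JacobiPCE.gradConst α β ∧ JacobiPCE.gradConst α β ≤ 1 + √2 / 2 ∧
      ((∀ k, α k = -1 / 2 ∧ β k = -1 / 2) → JacobiPCE.gradConst α β = 1) ∧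
      ((∃ k, α k = 0 ∧ β k = 0) → JacobiPCE.gradConst α β = 1 + √2 / 2)) ∧
    -- for every sample set in the open cube: the two coherence bounds and the inclusion
    (∀ z : Fin N → Fin d → ℝ, (∀ i, z i ∈ JacobiPCE.cube d) →
      JacobiPCE.muL (JacobiPCE.PhiPre α β φ n z) ≤ JacobiPCE.cohBound α β ∧
      JacobiPCE.betaL (JacobiPCE.PhiHat α β φ n z) ≤
        JacobiPCE.gradConst α β * JacobiPCE.cohBound α β ∧
      (JacobiPCE.nullspace (JacobiPCE.PhiHat α β φ n z)).map (JacobiPCE.P α β n).mulVecLin ≤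
        JacobiPCE.nullspace (JacobiPCE.Phi φ n z)) ∧
    -- almost surely, the samples lie in the open cube, and the inclusion is strict when
    -- there are fewer samples than basis functions
    (∀ᵐ ω ∂μ, (∀ i, Z i ω ∈ JacobiPCE.cube d) ∧
      (0 < N → N < (JacobiPCE.totalDegree d n).card →
        (JacobiPCE.nullspace (JacobiPCE.PhiHat α β φ n fun i => Z i ω)).map
            (JacobiPCE.P α β n).mulVecLin <
          JacobiPCE.nullspace (JacobiPCE.Phi φ n fun i => Z i ω))) := by
  have hα1 (j) : -1 < α j := by linarith [hα j]
  have hβ1 (j) : -1 < β j := by linarith [hβ j]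
  refine ⟨⟨JacobiPCE.one_le_gradConst (j := ⟨0, hd⟩) (by linarith [hα ⟨0, hd⟩, hβ ⟨0, hd⟩]),
    JacobiPCE.gradConst_le α β, fun h => ?_, fun ⟨k, hαk, hβk⟩ => ?_⟩, fun z hz => ⟨?_, ?_, ?_⟩, ?_⟩
  · exact JacobiPCE.gradConst_eq_one hd fun j => by linarith [(h j).1, (h j).2]
  · exact JacobiPCE.gradConst_eq_of_eq_zero hαk hβk
  · exact JacobiPCE.muL_PhiPre_le hα hβ hφ n hz
  · exact JacobiPCE.betaL_PhiHat_le hα hβ hφ n hz hd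
  · exact JacobiPCE.map_nullspace_PhiHat_le hα1 hβ1 hz
  · simp only [Filter.eventually_and, Filter.eventually_imp_distrib_left]
    exact ⟨JacobiPCE.ae_forall_mem_cube hZ, fun hN hcard =>
      JacobiPCE.ae_map_nullspace_PhiHat_lt hZ hα1 hβ1 (fun j => (hφ j).degree_eq) hindep hN hcard⟩
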